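/- Let $d \ge 2$ and let $n_1 \le n_2$ be sample sizes. Independent raw data $X_1,\dots,X_{n_1}$ and $Y_1,\dots,Y_{n_2}$ take values in $[d]=\{1,\dots,d\}$, the $X_i$ with probability vector $\mathbf p_X$ and the $Y_i$ with probability vector $\mathbf p_Y$. Only privatized views $Z_i$ of $X_i$ and $W_i$ of $Y_i$, with values in arbitrary measurable spaces $\mathcal Z$ and $\mathcal W$, are observed. In a *sequentially interactive* mechanism $Q$, for $i \le n_1$ the views $Z_i$ and $W_i$ are drawn from Markov kernels given $X_i$ (respectively $Y_i$) and the pairs $(Z_k,W_k)_{k<i}$, and for $n_1<j\le n_2$ the view $W_j$ is drawn given $Y_j$, $Z_1,\dots,Z_{n_1}$ and $W_1,\dots,W_{j-1}$. The mechanism is *non-interactive* if each view is drawn given its own raw datum only. It is $\varepsilon$-LDP if for each of its kernels, each value $h$ of the past views, all $x,x'\in[d]$ and every measurable $S$, one has $Q_i(S\mid x,h)\le e^{\varepsilon}Q_i(S\mid x',h)$. For $p\in[1,2]$ consider testing $H_0:\mathbf p_X=\mathbf p_Y$ against $H_1:\|\mathbf p_X-\mathbf p_Y\|_p\ge\rho$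 by means of a measurable $\{0,1\}$-valued function $\phi$ of the private views. For a class $\mathcal Q_\varepsilon$ of $\varepsilon$-LDP mechanisms put $$\mathcal R_\rho=\alpha+\inf_{Q\in\mathcal Q_\varepsilon}\ \inf_{\phi}\ \sup_{\|\mathbf p_X-\mathbf p_Y\|_p\ge\rho}\mathbb P_{\mathbf p_X,\mathbf p_Y,Q}(\phi=0),\qquad \rho^*=\inf\{\rho>0:\mathcal R_\rho\le\alpha+\beta\},$$ where the inner infimum is over the tests with $\sup_{\mathbf p}\mathbb P_{\mathbf p,\mathbf p,Q}(\phi=1)\le\alpha$, and the supremum over an empty set is $0$. Write $\rho^*_{\mathrm{NI}}$ and $\rho^*_{\mathrm I}$ when $\mathcal Q_\varepsilon$ is the class of all non-interactive, respectively all sequentially interactive, $\varepsilon$-LDP mechanisms. There are absolute constants $C,c,K,C',c',K'>0$ such that for all integers $d\ge2$ and $n_1\le n_2$, all $p\in[1,2]$, $\varepsilon\in(0,1]$ and $\alpha,\beta>0$ with $\alpha+\beta\le 1/2$: (i) if $n_1\ge C\log\{1/(\alpha\beta)\}$, then $$c\left(\frac{d^{1/p-1/4}}{(n_1\varepsilon^2)^{1/2}}\wedge\frac{1}{d^{1-1/p}(\log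 d)^{1/2}}\right)\le\rho^*_{\mathrm{NI}}\le K\,\frac{d^{1/p-1/4}}{(n_1\varepsilon^2)^{1/2}}\,[\log\{1/(\alpha\beta)\}]^2;$$ (ii) if $n_1\varepsilon^2\ge C'\log\{1/(\alpha\beta)\}$, then $$c'\left(\frac{d^{1/p-1/2}}{(n_1\varepsilon^2)^{1/2}}\wedge r_{d,p}\right)\le\rho^*_{\mathrm I}\le K'\,\frac{d^{1/p-1/2}}{(n_1\varepsilon^2)^{1/2}}\Bigl(\{\log(1/\beta)\}^2+[\log\{1/(\alpha\beta)\}]^{1/2}\Bigr),$$ where $r_{d,p}=1$ if $p\in\{1,2\}$ and $r_{d,p}=d^{1/p-1}$ if $1<p<2$. -/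

import Mathlib

open MeasureTheory ProbabilityTheory
open scoped ENNReal

noncomputable section

namespace LDPTest

/-- Probability vectors on the `d` outcomes. -/
abbrev ProbVec (d : ℕ) : Type := stdSimplex ℝ (Fin d)

/-- The distribution of a single observation with probability vector `q`. -/
def ProbVec.toMeasure {d : ℕ} (q : ProbVec d) : Measure (Fin d) :=
  ∑ j, ENNReal.ofReal (q.1 j) • Measure.dirac j

instance {d : ℕ} (q : ProbVec d) : IsProbabilityMeasure q.toMeasure := by
  constructor
  have h : ∑ j, ENNReal.ofReal (q.1 j) = 1 := by
    rw [← ENNReal.ofReal_sum_of_nonneg (fun j _ => q.2.1 j), q.2.2, ENNReal.ofReal_one]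
  simpa [ProbVec.toMeasure] using h

/-- The `L_p` distance of two probability vectors. -/
def lpDist {d : ℕ} (p : ℝ) (q q' : ProbVec d) : ℝ :=
  (∑ j, |q.1 j - q'.1 j| ^ p) ^ (1 / p)

section Kernels

variable {d : ℕ} {H 𝒵 α : Type} [MeasurableSpace H] [MeasurableSpace 𝒵] [MeasurableSpace α]

/-- The `ε`-LDP constraint on one channel `Q(· | x, h)`, with `x` the raw datum and `h` the
private views on which the channel may depend. -/
def IsLDPChannel (ε : ℝ) (Q : Kernel (Fin d × H) 𝒵) : Prop :=
  ∀ (x x' : Fin d) (h : H) (S : Set 𝒵), MeasurableSet S →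
    Q (x, h) S ≤ ENNReal.ofReal (Real.exp ε) * Q (x', h) S

/-- The law of the private view given `h`, when the raw datum is drawn from `P` independently
of `h`: it is `∫ Q(· | x, h) dP(x)`. -/
def privateView (P : Measure (Fin d)) (Q : Kernel (Fin d × H) 𝒵) : Kernel H 𝒵 :=
  Q ∘ₖ (Kernel.const H P ×ₖ Kernel.id)

instance (P : Measure (Fin d)) [IsProbabilityMeasure P] (Q : Kernel (Fin d × H) 𝒵)
    [IsMarkovKernel Q] : IsMarkovKernel (privateView P Q) := by
  unfold privateView; infer_instance

lemma measurable_snoc (n : ℕ) :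
    Measurable (fun x : (Fin n → α) × α => (Fin.snoc (α := fun _ => α) x.1 x.2 : Fin (n + 1) → α)) := by
  refine measurable_pi_lambda _ fun i => ?_
  refine Fin.lastCases ?_ (fun j => ?_) i
  · simpa using measurable_snd
  · simpa [Function.comp_def] using (measurable_pi_apply j).comp measurable_fst

/-- Conditionally on `h`, the joint law of variables `A_0, …, A_{n-1}` drawn one after the
other, `A_i` from the kernel `κ i` given `h` and `A_0, …, A_{i-1}`. -/
def sequentialLaw : (n : ℕ) → ((i : ℕ) → i < n → Kernel (H × (Fin i → α)) α) →
    Kernel H (Fin n → α)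
  | 0, _ => Kernel.const H (Measure.dirac Fin.elim0)
  | n + 1, κ =>
      ((sequentialLaw n fun i hi => κ i (Nat.lt_succ_of_lt hi)) ⊗ₖ κ n (Nat.lt_succ_self n)).map
        (fun x => (Fin.snoc (α := fun _ => α) x.1 x.2 : Fin (n + 1) → α))

lemma isMarkovKernel_sequentialLaw (n : ℕ)
    (κ : (i : ℕ) → i < n → Kernel (H × (Fin i → α)) α) (hκ : ∀ i hi, IsMarkovKernel (κ i hi)) :
    IsMarkovKernel (sequentialLaw n κ) := by
  induction n with
  | zero => unfold sequentialLaw; infer_instance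
  | succ n ih =>
    have := ih (fun i hi => κ i (Nat.lt_succ_of_lt hi)) (fun i hi => hκ i _)
    have := hκ n (Nat.lt_succ_self n)
    unfold sequentialLaw
    exact Kernel.IsMarkovKernel.map _ (measurable_snoc n)

end Kernels

/-! ### Non-interactive mechanisms -/

/-- A non-interactive mechanism: each private view is drawn given its own raw datum only. -/
structure NonInteractive (d n₁ n₂ : ℕ) (𝒵 𝒲 : Type) [MeasurableSpace 𝒵] [MeasurableSpace 𝒲] where
  QX : Fin n₁ → Kernel (Fin d) 𝒵
  QY : Fin n₂ → Kernel (Fin d) 𝒲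
  markovX : ∀ i, IsMarkovKernel (QX i)
  markovY : ∀ j, IsMarkovKernel (QY j)

namespace NonInteractive

variable {d n₁ n₂ : ℕ} {𝒵 𝒲 : Type} [MeasurableSpace 𝒵] [MeasurableSpace 𝒲]

def IsLDP (Q : NonInteractive d n₁ n₂ 𝒵 𝒲) (ε : ℝ) : Prop :=
  (∀ (i : Fin n₁) (x x' : Fin d) (S : Set 𝒵), MeasurableSet S →
    Q.QX i x S ≤ ENNReal.ofReal (Real.exp ε) * Q.QX i x' S) ∧
  (∀ (j : Fin n₂) (y y' : Fin d) (S : Set 𝒲), MeasurableSet S →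
    Q.QY j y S ≤ ENNReal.ofReal (Real.exp ε) * Q.QY j y' S)

/-- The joint law of the private views `(Z_1, …, Z_{n₁})`, `(W_1, …, W_{n₂})`, when the raw data
are independent with probability vectors `qX` in the first and `qY` in the second sample. -/
def law (Q : NonInteractive d n₁ n₂ 𝒵 𝒲) (qX qY : ProbVec d) :
    Measure ((Fin n₁ → 𝒵) × (Fin n₂ → 𝒲)) :=
  (Measure.pi fun i => Q.QX i ∘ₘ qX.toMeasure).prod (Measure.pi fun j => Q.QY j ∘ₘ qY.toMeasure)

instance (Q : NonInteractive d n₁ n₂ 𝒵 𝒲) (qX qY : ProbVec d) :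
    IsProbabilityMeasure (Q.law qX qY) := by
  have := Q.markovX
  have := Q.markovY
  unfold law; infer_instance

end NonInteractive

/-! ### Sequentially interactive mechanisms -/

/-- A two-sample sequentially interactive mechanism, for `n₁ ≤ n₂`. With indices starting at `0`:
for `i < n₁` the views `Z_i` and `W_i` may depend on the pairs `(Z_k, W_k)`, `k < i`, and the
view `W_{n₁ + j}` may depend on `(Z_k, W_k)`, `k < n₁`, and on `W_{n₁ + k}`, `k < j`. -/
structure Interactive (d n₁ n₂ : ℕ) (𝒵 𝒲 : Type) [MeasurableSpace 𝒵] [MeasurableSpace 𝒲] where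
  QX : (i : Fin n₁) → Kernel (Fin d × (Fin i → 𝒵 × 𝒲)) 𝒵
  QY : (i : Fin n₁) → Kernel (Fin d × (Fin i → 𝒵 × 𝒲)) 𝒲
  QYtail : (j : Fin (n₂ - n₁)) → Kernel (Fin d × ((Fin n₁ → 𝒵 × 𝒲) × (Fin j → 𝒲))) 𝒲
  markovX : ∀ i, IsMarkovKernel (QX i)
  markovY : ∀ i, IsMarkovKernel (QY i)
  markovYtail : ∀ j, IsMarkovKernel (QYtail j)

namespace Interactive

variable {d n₁ n₂ : ℕ} {𝒵 𝒲 : Type} [MeasurableSpace 𝒵] [MeasurableSpace 𝒲]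

def IsLDP (Q : Interactive d n₁ n₂ 𝒵 𝒲) (ε : ℝ) : Prop :=
  (∀ i, IsLDPChannel ε (Q.QX i)) ∧ (∀ i, IsLDPChannel ε (Q.QY i)) ∧
    (∀ j, IsLDPChannel ε (Q.QYtail j))

/-- The joint law of the private views, `(Z_i, W_i)` for `i < n₁` and then `W_{n₁ + j}` for
`j < n₂ - n₁`, when the raw data are independent with probability vectors `qX` in the first and
`qY` in the second sample. Every raw datum enters one channel only, so that given the past the
views `Z_i` and `W_i` are independent. -/
def law (Q : Interactive d n₁ n₂ 𝒵 𝒲) (qX qY : ProbVec d) :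
    Measure ((Fin n₁ → 𝒵 × 𝒲) × (Fin (n₂ - n₁) → 𝒲)) :=
  (sequentialLaw (H := Unit) n₁ (fun i hi => Kernel.prodMkLeft Unit
      (privateView qX.toMeasure (Q.QX ⟨i, hi⟩) ×ₖ privateView qY.toMeasure (Q.QY ⟨i, hi⟩))) ()) ⊗ₘ
    sequentialLaw (n₂ - n₁) (fun j hj => privateView qY.toMeasure (Q.QYtail ⟨j, hj⟩))

instance (Q : Interactive d n₁ n₂ 𝒵 𝒲) (qX qY : ProbVec d) :
    IsProbabilityMeasure (Q.law qX qY) := by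
  have := Q.markovX
  have := Q.markovY
  have := Q.markovYtail
  have := isMarkovKernel_sequentialLaw (H := Unit) n₁ (fun i hi => Kernel.prodMkLeft Unit
      (privateView qX.toMeasure (Q.QX ⟨i, hi⟩) ×ₖ privateView qY.toMeasure (Q.QY ⟨i, hi⟩)))
      (fun i hi => inferInstance)
  have := isMarkovKernel_sequentialLaw (n₂ - n₁)
    (fun j hj => privateView qY.toMeasure (Q.QYtail ⟨j, hj⟩)) (fun j hj => inferInstance)
  unfold law; infer_instance

end Interactive

/-! ### Tests, risks and separation radii -/

section Tests

variable {d : ℕ} {Ω : Type} [MeasurableSpace Ω]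

/-- `φ` is a test (`φ = true` rejects) of level `α` for the hypothesis `qX = qY`, when the
observation has law `law qX qY`. -/
def IsLevel (law : ProbVec d → ProbVec d → Measure Ω) (α : ℝ) (φ : Ω → Bool) : Prop :=
  Measurable φ ∧ ∀ q : ProbVec d, law q q {ω | φ ω = true} ≤ ENNReal.ofReal α

/-- The worst type-II error of `φ` over all pairs at `L_p` distance at least `ρ`. -/
def typeTwoError (law : ProbVec d → ProbVec d → Measure Ω) (p ρ : ℝ) (φ : Ω → Bool) : ℝ≥0∞ :=
  ⨆ (qX : ProbVec d) (qY : ProbVec d) (_ : ρ ≤ lpDist p qX qY), law qX qY {ω | φ ω = false}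

end Tests

/-- The minimax testing risk over non-interactive `ε`-LDP mechanisms, with arbitrary output
spaces, and level-`α` tests. -/
def riskNI (d n₁ n₂ : ℕ) (ε p α ρ : ℝ) : ℝ≥0∞ :=
  ENNReal.ofReal α +
    ⨅ (𝒵 : Type) (𝒲 : Type) (_ : MeasurableSpace 𝒵) (_ : MeasurableSpace 𝒲)
      (Q : NonInteractive d n₁ n₂ 𝒵 𝒲) (_ : Q.IsLDP ε)
      (φ : (Fin n₁ → 𝒵) × (Fin n₂ → 𝒲) → Bool) (_ : IsLevel Q.law α φ),
      typeTwoError Q.law p ρ φ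

/-- The minimax testing risk over sequentially interactive `ε`-LDP mechanisms, with arbitrary
output spaces, and level-`α` tests. -/
def riskI (d n₁ n₂ : ℕ) (ε p α ρ : ℝ) : ℝ≥0∞ :=
  ENNReal.ofReal α +
    ⨅ (𝒵 : Type) (𝒲 : Type) (_ : MeasurableSpace 𝒵) (_ : MeasurableSpace 𝒲)
      (Q : Interactive d n₁ n₂ 𝒵 𝒲) (_ : Q.IsLDP ε)
      (φ : (Fin n₁ → 𝒵 × 𝒲) × (Fin (n₂ - n₁) → 𝒲) → Bool) (_ : IsLevel Q.law α φ),
      typeTwoError Q.law p ρ φ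

/-- The non-interactive minimax separation radius for `L_p` separation. -/
def radiusNI (d n₁ n₂ : ℕ) (ε p α β : ℝ) : ℝ :=
  sInf {ρ : ℝ | 0 < ρ ∧ riskNI d n₁ n₂ ε p α ρ ≤ ENNReal.ofReal (α + β)}

/-- The interactive minimax separation radius for `L_p` separation. -/
def radiusI (d n₁ n₂ : ℕ) (ε p α β : ℝ) : ℝ :=
  sInf {ρ : ℝ | 0 < ρ ∧ riskI d n₁ n₂ ε p α ρ ≤ ENNReal.ofReal (α + β)}

end LDPTest

end

noncomputable section

namespace LDPTest

/-! Lower bounds. The second sample follows the uniform law on `m` disjoint pairs of coordinates,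
and the first sample follows either the same law or its tilt by a random vector `η`, which moves
mass within each pair. By `ε`-LDP a view of `X` under the tilted law has, relative to the null, a
density `1 + (∑ k, η k * D k) / (2m)` with `|D k| ≤ 3ε` (`exists_mixture_densities`,
`sum_pairVec_mul_eq`, `abs_sub_le_of_exp_bounds`). No test has small errors once the mixture over
`η` is within a small constant of the null in `L¹`.

Interactive channels adapt to the past, so the likelihood ratio does not factor into fixed terms.
With `η = γ ξ` for uniform signs `ξ`, two triangular discriminations are followed through the
rounds: `A`, between neighbours of the sign cube, and `B`, between the mixture and the null. The
first-order terms of both integrate out. A round adds `O((γε/m)²)` to `A`, because one sign moves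
the view density by `O(γε/m)`. It adds `O((γε)² A)` to `B`, because the mixture moves only through
the correlations of the likelihood with the signs, which `A` controls (`sq_signAvg_div_le`,
`CloseDensities.step`). After `n₁` rounds `B = O((γ² n₁ε²/m)²)`, so `γ ≍ √(m/(n₁ε²))` is
undetectable (`closeDensities_sequentialLaw`, `CloseDensities.le_error_sum`).

Non-interactive channels are fixed in advance, so the prior may be fitted to them. The second moment
of the mixture is controlled by `exp(ηᵀBη'/(2m)²)`, where `B` is positive semidefinite of trace at
most `9 n₁ε² m`. At least half of its eigenvalues are at most `18 n₁ε²`. With random signs on those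
eigenvectors only (`exists_prior`), the exponent is a Rademacher sum of variance `O(γ⁴(n₁ε²)²/m³)`,
which permits `γ ≍ m^(3/4)/√(n₁ε²)`. The requirement `|η k| ≤ 1` costs a further `γ ≲ 1/√(log d)`.

Upper bounds. Each user reports a uniform sign vector, reweighted by a factor `1 ± k` with `k = ε/4`
according to one of its entries. Even functions of the vector keep their uniform expectation
(`ev_viewLaw_of_even`), so linear statistics have isotropic noise, while the mean is `k` times the
probability vector. Without interaction the statistic is the inner product of the sums of two
independent blocks of `m` pairs: its mean is `m²k²‖Δ‖₂²` for `Δ = p_X - p_Y`, and its noise is of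
order `m√d`. With interaction, the second half of a block reports through a single sign the
truncated sum found by the first half at the user's own datum. The noise of this statistic does not
grow with `d`, which gains the factor `d^(1/4)`. The key estimate is that the truncated sums still
correlate with `Δ` (`mul_ev_clip_blockSum_ge`). A majority vote over about `2 log(1/(αβ))` blocks
lowers the error from `1/16` to `αβ` (`FinLaw.ev_iid_majority_le`), and `ℓ_p` separation is
converted into `ℓ₂` separation by the power mean inequality. -/

/-! ### Comparison of `ℓ_p` norms -/

/-- The power mean inequality for unnormalised `ℓ_p` norms. -/
lemma lp_norm_le_card_rpow_mul {ι : Type*} [Fintype ι] {a : ι → ℝ} (ha : ∀ i, 0 ≤ a i) {p q : ℝ}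
    (hp : 0 < p) (hpq : p ≤ q) :
    (∑ i, a i ^ p) ^ (1 / p) ≤
      (Fintype.card ι : ℝ) ^ (1 / p - 1 / q) * (∑ i, a i ^ q) ^ (1 / q) := by
  have hq : 0 < q := hp.trans_le hpq
  have h := Real.rpow_sum_le_const_mul_sum_rpow_of_nonneg (s := Finset.univ) (f := fun i => a i ^ p)
    (p := q / p) (by rwa [le_div_iff₀ hp, one_mul]) (fun i _ => Real.rpow_nonneg (ha i) p)
  have h1 : ∀ i, (a i ^ p) ^ (q / p) = a i ^ q := fun i => by
    rw [← Real.rpow_mul (ha i)]; congr 1; field_simp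
  simp only [h1] at h
  have hs : 0 ≤ ∑ i, a i ^ p := Finset.sum_nonneg fun i _ => Real.rpow_nonneg (ha i) p
  have hs' : 0 ≤ ∑ i, a i ^ q := Finset.sum_nonneg fun i _ => Real.rpow_nonneg (ha i) q
  have h2 := Real.rpow_le_rpow (Real.rpow_nonneg hs _) h (by positivity : 0 ≤ 1 / q)
  rw [← Real.rpow_mul hs, Real.mul_rpow (by positivity) hs', ← Real.rpow_mul (by positivity)] at h2
  convert h2 using 2
  · field_simp
  · simp only [Finset.card_univ]; congr 1; field_simp

/-- Both tests detect only the Euclidean distance; this transfers the assumed `ℓ_p` separation to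
it. -/
lemma lpDist_le_two {d : ℕ} (q q' : ProbVec d) {p : ℝ} (hp : 0 < p) (hp2 : p ≤ 2) :
    lpDist p q q' ≤ (d : ℝ) ^ (1 / p - 1 / 2) * √(∑ j, (q.1 j - q'.1 j) ^ 2) := by
  have h := lp_norm_le_card_rpow_mul (a := fun j => |q.1 j - q'.1 j|) (fun j => abs_nonneg _) hp hp2
  simpa [lpDist, Real.sqrt_eq_rpow] using h

/-! ### Signs and paired perturbations of a uniform distribution -/

/-- The sign encoded by a Boolean. -/
def sgn (b : Bool) : ℝ := if b then 1 else -1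

@[simp] lemma sgn_true : sgn true = 1 := rfl
@[simp] lemma sgn_false : sgn false = -1 := rfl

lemma sgn_not (b : Bool) : sgn (!b) = - sgn b := by cases b <;> simp

lemma sgn_mul_self (b : Bool) : sgn b * sgn b = 1 := by cases b <;> simp

lemma sgn_sq (b : Bool) : sgn b ^ 2 = 1 := by cases b <;> simp

lemma abs_sgn (b : Bool) : |sgn b| = 1 := by cases b <;> simp

section Pairs

variable {d m : ℕ}

/-- The `m` disjoint pairs of coordinates `{2k, 2k+1}`. -/
def pairIdx (h : 2 * m ≤ d) (kb : Fin m × Bool) : Fin d :=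
  ⟨2 * kb.1 + (if kb.2 then 1 else 0), by have := kb.1.2; split_ifs <;> omega⟩

lemma pairIdx_injective (h : 2 * m ≤ d) : Function.Injective (pairIdx h) := by
  rintro ⟨k, b⟩ ⟨k', b'⟩ hk
  simp only [pairIdx, Fin.mk.injEq] at hk
  cases b <;> cases b' <;> simp at hk ⊢ <;> first | (ext; omega) | omega

/-- The uniform distribution on `m` pairs of coordinates, tilted by `η k` within the pair `k`. -/
def pairVec (h : 2 * m ≤ d) (hm : 0 < m) (η : Fin m → ℝ) (hη : ∀ k, |η k| ≤ 1) : ProbVec d :=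
  ⟨fun x => ∑ kb, if pairIdx h kb = x then (1 + sgn kb.2 * η kb.1) / (2 * m) else 0, by
    refine ⟨fun x => Finset.sum_nonneg fun kb _ => ?_, ?_⟩
    · split_ifs
      · have h1 := abs_le.1 (hη kb.1)
        refine div_nonneg ?_ (by positivity)
        rcases kb.2 with _ | _ <;> simp <;> linarith
      · exact le_rfl
    · rw [Finset.sum_comm]
      have hm' : (m : ℝ) ≠ 0 := by positivity
      simp only [Finset.sum_ite_eq, Finset.mem_univ, if_true, Fintype.sum_prod_type,
        Fintype.sum_bool, sgn_true, sgn_false, ← add_div]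
      rw [← Finset.sum_div]
      have : ∀ k, 1 + 1 * η k + (1 + -1 * η k) = 2 := fun k => by ring
      simp only [this, Finset.sum_const, Finset.card_univ, Fintype.card_fin, nsmul_eq_mul]
      field_simp⟩

lemma sum_pairVec_mul (h : 2 * m ≤ d) (hm : 0 < m) (η : Fin m → ℝ) (hη : ∀ k, |η k| ≤ 1)
    (F : Fin d → ℝ) :
    ∑ x, (pairVec h hm η hη).1 x * F x =
      ∑ kb, (1 + sgn kb.2 * η kb.1) / (2 * m) * F (pairIdx h kb) := by
  simp only [pairVec, Finset.sum_mul, ite_mul, zero_mul]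
  rw [Finset.sum_comm]
  simp

lemma pairVec_apply_pairIdx (h : 2 * m ≤ d) (hm : 0 < m) (η : Fin m → ℝ) (hη : ∀ k, |η k| ≤ 1)
    (kb : Fin m × Bool) :
    (pairVec h hm η hη).1 (pairIdx h kb) = (1 + sgn kb.2 * η kb.1) / (2 * m) := by
  simp only [pairVec, (pairIdx_injective h).eq_iff]
  simp

/-- The mixture of `F` over a tilted pair distribution is the mixture over the untilted one plus a
linear term in the tilt. -/
lemma sum_pairVec_mul_eq (h : 2 * m ≤ d) (hm : 0 < m) (η : Fin m → ℝ) (hη : ∀ k, |η k| ≤ 1)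
    (hη0 : ∀ k : Fin m, |(0 : Fin m → ℝ) k| ≤ 1) (F : Fin d → ℝ) :
    ∑ x, (pairVec h hm η hη).1 x * F x = ∑ x, (pairVec h hm 0 hη0).1 x * F x +
      (∑ k, η k * (F (pairIdx h (k, true)) - F (pairIdx h (k, false)))) / (2 * m) := by
  rw [sum_pairVec_mul, sum_pairVec_mul, Finset.sum_div, Fintype.sum_prod_type,
    Fintype.sum_prod_type, ← Finset.sum_add_distrib]
  refine Finset.sum_congr rfl fun k _ => ?_
  simp only [Fintype.sum_bool, sgn_true, sgn_false, Pi.zero_apply]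
  ring

/-- On the `2m` coordinates of the pairs the two vectors differ by `|η k| / (2m)`, and the power
mean inequality compares exponents `1` and `p` there. A prior thus needs control only of the `ℓ₁`
norm of its tilt. -/
lemma le_lpDist_pairVec (h : 2 * m ≤ d) (hm : 0 < m) (η : Fin m → ℝ) (hη : ∀ k, |η k| ≤ 1)
    (hη0 : ∀ k : Fin m, |(0 : Fin m → ℝ) k| ≤ 1) {p : ℝ} (hp : 1 ≤ p) :
    (2 * m : ℝ) ^ (1 / p - 1) * ((∑ k, |η k|) / m) ≤
      lpDist p (pairVec h hm η hη) (pairVec h hm 0 hη0) := by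
  have hp0 : 0 < p := by linarith
  have hm0 : (0 : ℝ) < m := by exact_mod_cast hm
  set D : Fin d → ℝ := fun x => |(pairVec h hm η hη).1 x - (pairVec h hm 0 hη0).1 x|
  have hD : ∀ kb, D (pairIdx h kb) = |η kb.1| / (2 * m) := fun kb => by
    simp only [D, pairVec_apply_pairIdx, Pi.zero_apply]
    rw [← sub_div, abs_div, abs_of_pos (by positivity : (0 : ℝ) < 2 * m)]
    congr 1
    rw [show 1 + sgn kb.2 * η kb.1 - (1 + sgn kb.2 * 0) = sgn kb.2 * η kb.1 by ring, abs_mul,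
      abs_sgn, one_mul]
  have h1 := lp_norm_le_card_rpow_mul (a := fun kb => D (pairIdx h kb)) (fun kb => abs_nonneg _)
    one_pos hp
  simp only [Fintype.card_prod, Fintype.card_fin, Fintype.card_bool, div_one, Real.rpow_one] at h1
  have hsum : ∑ kb, D (pairIdx h kb) = (∑ k, |η k|) / m := by
    simp only [hD, Fintype.sum_prod_type, Fintype.sum_bool]
    rw [Finset.sum_div]
    exact Finset.sum_congr rfl fun k _ => by field_simp; ring
  have h2 : ∑ kb, D (pairIdx h kb) ^ p ≤ ∑ x, D x ^ p := by
    rw [← Finset.sum_image (s := Finset.univ) (g := pairIdx h) (f := fun x => D x ^ p)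
      (fun a _ b _ hab => pairIdx_injective h hab)]
    exact Finset.sum_le_sum_of_subset_of_nonneg (Finset.subset_univ _)
      fun i _ _ => Real.rpow_nonneg (abs_nonneg _) _
  have h3 : (∑ kb, D (pairIdx h kb) ^ p) ^ (1 / p) ≤ lpDist p (pairVec h hm η hη) (pairVec h hm 0 hη0) :=
    Real.rpow_le_rpow (Finset.sum_nonneg fun i _ => Real.rpow_nonneg (abs_nonneg _) _) h2
      (by positivity)
  rw [hsum] at h1
  have hc : (((m * 2 : ℕ) : ℝ)) = 2 * m := by push_cast; ring
  rw [hc] at h1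
  calc (2 * m : ℝ) ^ (1 / p - 1) * ((∑ k, |η k|) / m)
      ≤ (2 * m : ℝ) ^ (1 / p - 1) * ((2 * m : ℝ) ^ (1 - 1 / p) *
          (∑ kb, D (pairIdx h kb) ^ p) ^ (1 / p)) :=
        mul_le_mul_of_nonneg_left h1 (by positivity)
    _ = (∑ kb, D (pairIdx h kb) ^ p) ^ (1 / p) := by
        rw [← mul_assoc, ← Real.rpow_add (by positivity)]
        simp
    _ ≤ _ := h3

end Pairs

/-! ### Densities and finite mixtures -/

/-- Two finite measures that dominate each other up to the factor `c` have a density with values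
in `[c⁻¹, c]`. -/
lemma exists_bounded_density {Ω : Type*} [MeasurableSpace Ω] (ρ ν : Measure Ω) [IsFiniteMeasure ρ]
    [IsFiniteMeasure ν] {c : ℝ} (hc : 1 ≤ c)
    (h1 : ∀ S, MeasurableSet S → ρ S ≤ ENNReal.ofReal c * ν S)
    (h2 : ∀ S, MeasurableSet S → ν S ≤ ENNReal.ofReal c * ρ S) :
    ∃ r : Ω → ℝ, Measurable r ∧ (∀ ω, c⁻¹ ≤ r ω) ∧ (∀ ω, r ω ≤ c) ∧
      ρ = ν.withDensity fun ω => ENNReal.ofReal (r ω) := by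
  have hc0 : 0 < c := by linarith
  have hcc : c⁻¹ ≤ c := (inv_le_one_of_one_le₀ hc).trans hc
  have hac : ρ ≪ ν := by
    refine Measure.AbsolutelyContinuous.mk fun S hS h0 => ?_
    have := h1 S hS
    rw [h0, mul_zero] at this
    exact le_antisymm this bot_le
  have hρ : ν.withDensity (ρ.rnDeriv ν) = ρ := Measure.withDensity_rnDeriv_eq _ _ hac
  have hle : ρ.rnDeriv ν ≤ᵐ[ν] fun _ => ENNReal.ofReal c := by
    refine ae_le_of_forall_setLIntegral_le_of_sigmaFinite (Measure.measurable_rnDeriv _ _) ?_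
    intro S hS _
    rw [← withDensity_apply _ hS, hρ, setLIntegral_const]
    exact h1 S hS
  have hge : (fun _ => ENNReal.ofReal c⁻¹) ≤ᵐ[ν] ρ.rnDeriv ν := by
    refine ae_le_of_forall_setLIntegral_le_of_sigmaFinite measurable_const ?_
    intro S hS _
    rw [setLIntegral_const, ← withDensity_apply _ hS, hρ]
    calc ENNReal.ofReal c⁻¹ * ν S ≤ ENNReal.ofReal c⁻¹ * (ENNReal.ofReal c * ρ S) := by
          gcongr; exact h2 S hS
      _ = ρ S := by
          rw [← mul_assoc, ← ENNReal.ofReal_mul (by positivity), inv_mul_cancel₀ hc0.ne']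
          simp
  -- Clamping turns the almost everywhere bounds on the Radon–Nikodym derivative into bounds at
  -- every point without changing the measure.
  refine ⟨fun ω => max c⁻¹ (min c (ρ.rnDeriv ν ω).toReal), ?_, fun ω => le_max_left _ _,
    fun ω => max_le hcc (min_le_left _ _), ?_⟩
  · exact measurable_const.max (measurable_const.min (Measure.measurable_rnDeriv _ _).ennreal_toReal)
  · conv_lhs => rw [← hρ]
    refine withDensity_congr_ae ?_
    filter_upwards [hle, hge] with ω h3 h4
    have hfin : ρ.rnDeriv ν ω ≠ ∞ := ne_top_of_le_ne_top ENNReal.ofReal_ne_top h3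
    have h5 : (ρ.rnDeriv ν ω).toReal ≤ c := ENNReal.toReal_le_of_le_ofReal hc0.le h3
    have h6 : c⁻¹ ≤ (ρ.rnDeriv ν ω).toReal := (ENNReal.ofReal_le_iff_le_toReal hfin).1 h4
    rw [min_eq_right h5, max_eq_right h6, ENNReal.ofReal_toReal hfin]

lemma sum_smul_withDensity {Ω : Type*} [MeasurableSpace Ω] {d : ℕ} (ν : Measure Ω)
    (q : ProbVec d) (r : Fin d → Ω → ℝ) (hr : ∀ x, Measurable (r x)) (hr0 : ∀ x ω, 0 ≤ r x ω) :
    ∑ x, ENNReal.ofReal (q.1 x) • ν.withDensity (fun ω => ENNReal.ofReal (r x ω)) =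
      ν.withDensity fun ω => ENNReal.ofReal (∑ x, q.1 x * r x ω) := by
  ext S hS
  rw [withDensity_apply _ hS, Measure.finsetSum_apply]
  simp only [Measure.smul_apply, smul_eq_mul, withDensity_apply _ hS]
  have : ∀ ω, ENNReal.ofReal (∑ x, q.1 x * r x ω) =
      ∑ x, ENNReal.ofReal (q.1 x) * ENNReal.ofReal (r x ω) := fun ω => by
    rw [ENNReal.ofReal_sum_of_nonneg fun x _ => mul_nonneg (q.2.1 x) (hr0 x ω)]
    exact Finset.sum_congr rfl fun x _ => ENNReal.ofReal_mul (q.2.1 x)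
  simp only [this]
  rw [lintegral_finsetSum _ fun x _ => (hr x).ennreal_ofReal.const_mul _]
  exact Finset.sum_congr rfl fun x _ => (lintegral_const_mul _ (hr x).ennreal_ofReal).symm

lemma lintegral_toMeasure {d : ℕ} (q : ProbVec d) (f : Fin d → ℝ≥0∞) :
    ∫⁻ x, f x ∂q.toMeasure = ∑ x, ENNReal.ofReal (q.1 x) * f x := by
  simp [ProbVec.toMeasure, lintegral_finsetSum_measure]

lemma sum_ofReal_probVec {d : ℕ} (q : ProbVec d) : ∑ j, ENNReal.ofReal (q.1 j) = 1 := by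
  rw [← ENNReal.ofReal_sum_of_nonneg (fun j _ => q.2.1 j), q.2.2, ENNReal.ofReal_one]

lemma bind_toMeasure {d : ℕ} {𝒵 : Type} [MeasurableSpace 𝒵] (q : ProbVec d)
    (Q : Kernel (Fin d) 𝒵) :
    Q ∘ₘ q.toMeasure = ∑ x, ENNReal.ofReal (q.1 x) • Q x := by
  ext S hS
  rw [Measure.bind_apply hS Q.aemeasurable, lintegral_toMeasure]
  simp [Measure.finsetSum_apply]

lemma privateView_apply {d : ℕ} {H 𝒵 : Type} [MeasurableSpace H] [MeasurableSpace 𝒵]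
    (q : ProbVec d) (Q : Kernel (Fin d × H) 𝒵) (h : H) :
    privateView q.toMeasure Q h = ∑ x, ENNReal.ofReal (q.1 x) • Q (x, h) := by
  ext S hS
  rw [privateView, Kernel.comp_apply' _ _ _ hS, Kernel.prod_apply, Kernel.const_apply,
    Kernel.id_apply, lintegral_prod _ (Q.measurable_coe hS).aemeasurable]
  have : ∀ x, ∫⁻ y, Q (x, y) S ∂(Measure.dirac h) = Q (x, h) S := fun x =>
    lintegral_dirac' _ ((Q.measurable_coe hS).comp measurable_prodMk_left)
  simp only [this, lintegral_toMeasure]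
  simp [Measure.finsetSum_apply]

end LDPTest

end

noncomputable section

namespace LDPTest

/-! ### The triangular discrimination -/

/-- The integrand of the triangular discrimination between two densities. -/
def triDisc (a b : ℝ) : ℝ := (a - b) ^ 2 / (a + b)

lemma triDisc_nonneg {a b : ℝ} (ha : 0 < a) (hb : 0 < b) : 0 ≤ triDisc a b := by
  unfold triDisc; positivity

lemma triDisc_le_add {a b : ℝ} (ha : 0 < a) (hb : 0 < b) : triDisc a b ≤ a + b := by
  unfold triDisc
  rw [div_le_iff₀ (by positivity)]
  nlinarith [mul_pos ha hb]

/-- The coefficients of `u` and `v` are those of the tangent plane at `u = v = 1`. As `triDisc` is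
homogeneous of degree one, the remainder vanishes on the diagonal and is quadratic in `u - v`. When
`u` and `v` are conditional densities, the tangent part integrates to `triDisc a b`. -/
lemma triDisc_mul_le {a b u v : ℝ} (ha : 0 < a) (hb : 0 < b) (hu : 0 < u) (hv : 1 / 3 ≤ v) :
    triDisc (a * u) (b * v) ≤ (a - 4 * a * b ^ 2 / (a + b) ^ 2) * u +
      (triDisc a b - (a - 4 * a * b ^ 2 / (a + b) ^ 2)) * v + 12 * (a * (u - v) ^ 2) := by
  have hv0 : 0 < v := by linarith
  have key : (a - 4 * a * b ^ 2 / (a + b) ^ 2) * u +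
      (triDisc a b - (a - 4 * a * b ^ 2 / (a + b) ^ 2)) * v - triDisc (a * u) (b * v) =
      - (4 * a ^ 2 * b ^ 2 * (u - v) ^ 2 / ((a * u + b * v) * (a + b) ^ 2)) := by
    unfold triDisc
    field_simp
    ring
  have h2 : 4 * a ^ 2 * b ^ 2 * (u - v) ^ 2 / ((a * u + b * v) * (a + b) ^ 2) ≤
      12 * (a * (u - v) ^ 2) := by
    rw [div_le_iff₀ (by positivity)]
    have h3 : a ^ 2 * b ^ 2 ≤ 3 * a * ((a * u + b * v) * (a + b) ^ 2) := by
      have h4 : b ≤ 3 * (a * u + b * v) := by nlinarith [mul_pos ha hu]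
      have h5 : a * b ≤ (a + b) ^ 2 := by nlinarith [sq_nonneg a, sq_nonneg b, mul_pos ha hb]
      calc a ^ 2 * b ^ 2 = a * (b * (a * b)) := by ring
        _ ≤ a * (3 * (a * u + b * v) * (a + b) ^ 2) := by gcongr
        _ = _ := by ring
    nlinarith [mul_le_mul_of_nonneg_right h3 (sq_nonneg (u - v))]
  linarith

lemma abs_triDisc_slope_le {a b : ℝ} (ha : 0 < a) (hb : 0 < b) :
    |a - 4 * a * b ^ 2 / (a + b) ^ 2| ≤ a + b := by
  have h1 : 4 * a * b ^ 2 / (a + b) ^ 2 ≤ b := by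
    rw [div_le_iff₀ (by positivity)]
    nlinarith [mul_nonneg hb.le (sq_nonneg (a - b))]
  have h2 : 0 ≤ 4 * a * b ^ 2 / (a + b) ^ 2 := by positivity
  rw [abs_le]
  constructor <;> linarith

/-- Tangent line at `s`, with a remainder relative to `s`: this is the normalisation in which
`sq_signAvg_div_le` bounds the squared correlations. -/
lemma triDisc_add_one_le {s δ : ℝ} (hs : 0 < s) (hδ : 0 < s + δ) :
    triDisc (s + δ) 1 ≤ triDisc s 1 + (1 - 4 / (s + 1) ^ 2) * δ + 4 * (δ ^ 2 / s) := by
  have key : triDisc s 1 + (1 - 4 / (s + 1) ^ 2) * δ - triDisc (s + δ) 1 =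
      - (4 * δ ^ 2 / ((s + 1) ^ 2 * (s + δ + 1))) := by
    unfold triDisc
    have : s + δ + 1 ≠ 0 := by positivity
    field_simp
    ring
  have h2 : 4 * δ ^ 2 / ((s + 1) ^ 2 * (s + δ + 1)) ≤ 4 * (δ ^ 2 / s) := by
    rw [← mul_div_assoc]
    refine div_le_div_of_nonneg_left (by positivity) hs ?_
    nlinarith [sq_nonneg s, mul_pos hδ (by positivity : 0 < (s + 1) ^ 2)]
  linarith

section SignCube

variable {m : ℕ}

/-- Reverse the sign number `k`. -/
def flipSign (k : Fin m) (ξ : Fin m → Bool) : Fin m → Bool := Function.update ξ k (!ξ k)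

lemma flipSign_flipSign (k : Fin m) (ξ : Fin m → Bool) : flipSign k (flipSign k ξ) = ξ := by
  simp [flipSign]

lemma flipSign_apply_self (k : Fin m) (ξ : Fin m → Bool) : flipSign k ξ k = !ξ k := by
  simp [flipSign]

lemma flipSign_apply_of_ne {k l : Fin m} (h : l ≠ k) (ξ : Fin m → Bool) :
    flipSign k ξ l = ξ l := by
  simp [flipSign, h]

lemma sum_flipSign (k : Fin m) (f : (Fin m → Bool) → ℝ) :
    ∑ ξ, f (flipSign k ξ) = ∑ ξ, f ξ :=
  Equiv.sum_comp (Function.Involutive.toPerm (flipSign k) (flipSign_flipSign k)) f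

/-- The average over the sign cube. -/
def signAvg (f : (Fin m → Bool) → ℝ) : ℝ := (∑ ξ, f ξ) / 2 ^ m

lemma signAvg_const (c : ℝ) : signAvg (fun _ : Fin m → Bool => c) = c := by
  simp [signAvg]

lemma signAvg_mono {f g : (Fin m → Bool) → ℝ} (h : ∀ ξ, f ξ ≤ g ξ) : signAvg f ≤ signAvg g := by
  unfold signAvg
  gcongr
  exact h _

/-- The squared correlation of a positive function with a sign, relative to its mean, is bounded
by the triangular discrimination along that sign. -/
lemma sq_signAvg_div_le (k : Fin m) {L : (Fin m → Bool) → ℝ} (hL : ∀ ξ, 0 < L ξ) :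
    (signAvg fun ξ => sgn (ξ k) * L ξ) ^ 2 / signAvg L ≤
      signAvg (fun ξ => triDisc (L ξ) (L (flipSign k ξ))) / 2 := by
  have h1 : 2 * ∑ ξ, sgn (ξ k) * L ξ = ∑ ξ, sgn (ξ k) * (L ξ - L (flipSign k ξ)) := by
    have := sum_flipSign k fun ξ => sgn (ξ k) * L ξ
    simp only [flipSign_apply_self, sgn_not] at this
    simp only [mul_sub, Finset.sum_sub_distrib]
    rw [two_mul]
    nth_rewrite 2 [← this]
    rw [sub_eq_add_neg, ← Finset.sum_neg_distrib]
    simp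
  have h2 : 2 * ∑ ξ, L ξ = ∑ ξ, (L ξ + L (flipSign k ξ)) := by
    rw [Finset.sum_add_distrib, sum_flipSign k L]; ring
  have h3 := Finset.sq_sum_div_le_sum_sq_div Finset.univ
    (fun ξ => sgn (ξ k) * (L ξ - L (flipSign k ξ)))
    (g := fun ξ => L ξ + L (flipSign k ξ)) (fun ξ _ => add_pos (hL _) (hL _))
  rw [← h1, ← h2] at h3
  have h4 : ∀ ξ, (sgn (ξ k) * (L ξ - L (flipSign k ξ))) ^ 2 / (L ξ + L (flipSign k ξ)) =
      triDisc (L ξ) (L (flipSign k ξ)) := fun ξ => by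
    rw [mul_pow, sgn_sq, one_mul, triDisc]
  simp only [h4] at h3
  have hpos : 0 < ∑ ξ, L ξ := Finset.sum_pos (fun ξ _ => hL ξ) Finset.univ_nonempty
  unfold signAvg
  have h5 : ((∑ ξ, sgn (ξ k) * L ξ) / 2 ^ m) ^ 2 / ((∑ ξ, L ξ) / 2 ^ m) =
      ((2 * ∑ ξ, sgn (ξ k) * L ξ) ^ 2 / (2 * ∑ ξ, L ξ)) / 2 ^ m / 2 := by
    field_simp
  rw [h5]
  gcongr

lemma signAvg_mul_sum (L : (Fin m → Bool) → ℝ) (c : Fin m → ℝ) :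
    signAvg (fun ξ => L ξ * ∑ k, sgn (ξ k) * c k) =
      ∑ k, signAvg (fun ξ => sgn (ξ k) * L ξ) * c k := by
  unfold signAvg
  simp only [Finset.mul_sum, div_mul_eq_mul_div, Finset.sum_mul]
  rw [Finset.sum_comm, Finset.sum_div]
  refine Finset.sum_congr rfl fun k _ => ?_
  congr 1
  exact Finset.sum_congr rfl fun ξ _ => by ring

end SignCube

/-! ### Densities of composition products -/

section CompProd

variable {H α : Type} [MeasurableSpace H] [MeasurableSpace α]

lemma withDensity_compProd_left (μ : Measure H) [IsFiniteMeasure μ] (η : Kernel H α)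
    [IsMarkovKernel η] {L : H → ℝ≥0∞} (hL : Measurable L) [IsFiniteMeasure (μ.withDensity L)] :
    (μ.withDensity L) ⊗ₘ η = (μ ⊗ₘ η).withDensity fun z => L z.1 := by
  ext S hS
  rw [Measure.compProd_apply hS, withDensity_apply _ hS,
    lintegral_withDensity_eq_lintegral_mul _ hL (Kernel.measurable_kernel_prodMk_left hS),
    ← lintegral_indicator hS, Measure.lintegral_compProd
      (f := S.indicator fun z : H × α => L z.1) ((hL.comp measurable_fst).indicator hS)]
  refine lintegral_congr fun h => ?_
  have : ∀ a, S.indicator (fun z : H × α => L z.1) (h, a) =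
      (Prod.mk h ⁻¹' S).indicator (fun _ => L h) a := fun a => by
    by_cases ha : (h, a) ∈ S <;> simp [ha]
  simp only [this, Pi.mul_apply]
  rw [lintegral_indicator (measurable_prodMk_left hS), setLIntegral_const]

lemma integral_comp_fst_compProd (μ : Measure H) [IsFiniteMeasure μ] (η : Kernel H α)
    [IsMarkovKernel η] {f : H → ℝ} (hf : Measurable f) :
    ∫ z, f z.1 ∂(μ ⊗ₘ η) = ∫ h, f h ∂μ := by
  conv_rhs => rw [← Measure.fst_compProd μ η, Measure.fst,
    integral_map measurable_fst.aemeasurable hf.aestronglyMeasurable]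

lemma integral_withDensity_ofReal {Ω : Type*} [MeasurableSpace Ω] (ν : Measure Ω) {g f : Ω → ℝ}
    (hg : Measurable g) (hg0 : ∀ ω, 0 ≤ g ω) :
    ∫ ω, f ω ∂(ν.withDensity fun ω => ENNReal.ofReal (g ω)) = ∫ ω, g ω * f ω ∂ν := by
  rw [integral_withDensity_eq_integral_toReal_smul hg.ennreal_ofReal (by simp)]
  simp [ENNReal.toReal_ofReal (hg0 _)]

lemma integrable_of_bounded {Ω : Type*} [MeasurableSpace Ω] (ν : Measure Ω) [IsFiniteMeasure ν]
    {f : Ω → ℝ} (hf : Measurable f) {C : ℝ} (hC : ∀ ω, |f ω| ≤ C) : Integrable f ν :=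
  Integrable.of_bound hf.aestronglyMeasurable C (Filter.Eventually.of_forall hC)

variable {d : ℕ}

/-- `κ q` is the mixture of the kernels `K x` with weights `q`. -/
def IsMixture (K : Fin d → Kernel H α) (κ : ProbVec d → Kernel H α) : Prop :=
  ∀ q h, κ q h = ∑ x, ENNReal.ofReal (q.1 x) • K x h

lemma compProd_mixture (μ : Measure H) [IsFiniteMeasure μ] (K : Fin d → Kernel H α)
    [∀ x, IsMarkovKernel (K x)] (κ : ProbVec d → Kernel H α) [∀ q, IsMarkovKernel (κ q)]
    (hκ : IsMixture K κ) (q : ProbVec d) :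
    μ ⊗ₘ κ q = ∑ x, ENNReal.ofReal (q.1 x) • (μ ⊗ₘ K x) := by
  ext S hS
  rw [Measure.compProd_apply hS, Measure.finsetSum_apply]
  simp only [hκ q, Measure.finsetSum_apply, Measure.smul_apply, smul_eq_mul,
    Measure.compProd_apply hS]
  rw [lintegral_finsetSum _ fun x _ =>
    (Kernel.measurable_kernel_prodMk_left hS).const_mul _]
  exact Finset.sum_congr rfl fun x _ =>
    lintegral_const_mul _ (Kernel.measurable_kernel_prodMk_left hS)

/-- Densities of laws that dominate each other up to the factor `exp ε`, relative to a mixture of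
them. -/
lemma exists_mixture_densities {Ω : Type*} [MeasurableSpace Ω] (P : Fin d → Measure Ω)
    [∀ x, IsFiniteMeasure (P x)] {ε : ℝ} (hε : 0 ≤ ε)
    (hP : ∀ x x' S, MeasurableSet S → P x S ≤ ENNReal.ofReal (Real.exp ε) * P x' S)
    (q₀ : ProbVec d) :
    ∃ r : Fin d → Ω → ℝ, (∀ x, Measurable (r x)) ∧ (∀ x z, Real.exp (-ε) ≤ r x z) ∧
      (∀ x z, r x z ≤ Real.exp ε) ∧
      ∀ q : ProbVec d, ∑ x, ENNReal.ofReal (q.1 x) • P x =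
        (∑ x, ENNReal.ofReal (q₀.1 x) • P x).withDensity
          fun z => ENNReal.ofReal (∑ x, q.1 x * r x z) := by
  have hfin : IsFiniteMeasure (∑ x, ENNReal.ofReal (q₀.1 x) • P x) := by
    have : ∀ x, IsFiniteMeasure (ENNReal.ofReal (q₀.1 x) • P x) := fun x =>
      Measure.smul_finite _ ENNReal.ofReal_ne_top
    infer_instance
  have hd : ∀ x, ∃ r : Ω → ℝ, Measurable r ∧ (∀ ω, (Real.exp ε)⁻¹ ≤ r ω) ∧
      (∀ ω, r ω ≤ Real.exp ε) ∧
      P x = (∑ x, ENNReal.ofReal (q₀.1 x) • P x).withDensity fun ω => ENNReal.ofReal (r ω) := by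
    intro x
    refine exists_bounded_density _ _ (Real.one_le_exp hε) (fun S hS => ?_) (fun S hS => ?_)
    · rw [Measure.finsetSum_apply, Finset.mul_sum]
      calc P x S = ∑ x', ENNReal.ofReal (q₀.1 x') * P x S := by
            rw [← Finset.sum_mul, sum_ofReal_probVec, one_mul]
        _ ≤ _ := by
            refine Finset.sum_le_sum fun x' _ => ?_
            rw [Measure.smul_apply, smul_eq_mul, mul_left_comm]
            gcongr
            exact hP x x' S hS
    · rw [Measure.finsetSum_apply]
      calc ∑ x', (ENNReal.ofReal (q₀.1 x') • P x') S
          ≤ ∑ x', ENNReal.ofReal (q₀.1 x') * (ENNReal.ofReal (Real.exp ε) * P x S) := by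
            refine Finset.sum_le_sum fun x' _ => ?_
            rw [Measure.smul_apply, smul_eq_mul]
            gcongr
            exact hP x' x S hS
        _ = _ := by rw [← Finset.sum_mul, sum_ofReal_probVec, one_mul]
  choose r hr h1 h2 h3 using hd
  refine ⟨r, hr, fun x z => by rw [Real.exp_neg]; exact h1 x z, h2, fun q => ?_⟩
  rw [← sum_smul_withDensity _ q r hr fun x z => le_trans (by positivity) (h1 x z)]
  exact Finset.sum_congr rfl fun x _ => by rw [← h3 x]

/-- Densities of the `ε`-LDP channels relative to a mixture of them. -/
lemma exists_channel_densities (μ : Measure H) [IsFiniteMeasure μ] (K : Fin d → Kernel H α)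
    [∀ x, IsMarkovKernel (K x)] (κ : ProbVec d → Kernel H α) [∀ q, IsMarkovKernel (κ q)]
    (hκ : IsMixture K κ) {ε : ℝ} (hε : 0 ≤ ε)
    (hK : ∀ x x' h S, MeasurableSet S → K x h S ≤ ENNReal.ofReal (Real.exp ε) * K x' h S)
    (q₀ : ProbVec d) :
    ∃ r : Fin d → H × α → ℝ, (∀ x, Measurable (r x)) ∧ (∀ x z, Real.exp (-ε) ≤ r x z) ∧
      (∀ x z, r x z ≤ Real.exp ε) ∧
      ∀ q, μ ⊗ₘ κ q = (μ ⊗ₘ κ q₀).withDensity fun z => ENNReal.ofReal (∑ x, q.1 x * r x z) := by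
  simp only [compProd_mixture μ K κ hκ]
  refine exists_mixture_densities (fun x => μ ⊗ₘ K x) hε (fun x x' S hS => ?_) q₀
  rw [Measure.compProd_apply hS, Measure.compProd_apply hS,
    ← lintegral_const_mul _ (Kernel.measurable_kernel_prodMk_left hS)]
  exact lintegral_mono fun h => hK x x' h _ (measurable_prodMk_left hS)

lemma abs_sub_le_of_exp_bounds {ε a b : ℝ} (hε : 0 ≤ ε) (hε1 : ε ≤ 1) (ha : Real.exp (-ε) ≤ a)
    (ha' : a ≤ Real.exp ε) (hb : Real.exp (-ε) ≤ b) (hb' : b ≤ Real.exp ε) :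
    |a - b| ≤ 3 * ε := by
  have h1 : Real.exp ε ≤ 1 + ε + ε ^ 2 := by
    have := (abs_le.1 (Real.abs_exp_sub_one_sub_id_le (x := ε) (by rwa [abs_of_nonneg hε]))).2
    linarith
  have h2 : 1 - ε ≤ Real.exp (-ε) := by have := Real.add_one_le_exp (-ε); linarith
  rw [abs_le]
  constructor <;> nlinarith

end CompProd

end LDPTest

end

noncomputable section

namespace LDPTest

/-! ### Mixtures over the sign cube of sequentially interactive experiments -/

section Mixture

variable {m : ℕ} {H α : Type} [MeasurableSpace H] [MeasurableSpace α]

/-- The laws `μ ξ`, indexed by the sign cube, have bounded positive densities relative to `μ₀`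
such that neighbours in the cube are at triangular discrimination at most `A`, and the uniform
mixture is at triangular discrimination at most `B` from `μ₀`. -/
def CloseDensities (μ₀ : Measure H) (μ : (Fin m → Bool) → Measure H) (A B : ℝ) : Prop :=
  ∃ (L : (Fin m → Bool) → H → ℝ) (M : ℝ), (∀ ξ, Measurable (L ξ)) ∧ (∀ ξ h, 0 < L ξ h) ∧
    (∀ ξ h, L ξ h ≤ M) ∧ (∀ ξ, μ ξ = μ₀.withDensity fun h => ENNReal.ofReal (L ξ h)) ∧
    (∀ ξ, ∫ h, L ξ h ∂μ₀ = 1) ∧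
    (∀ ξ k, ∫ h, triDisc (L ξ h) (L (flipSign k ξ) h) ∂μ₀ ≤ A) ∧
    ∫ h, triDisc (signAvg fun ξ => L ξ h) 1 ∂μ₀ ≤ B

lemma measurable_triDisc {f g : H → ℝ} (hf : Measurable f) (hg : Measurable g) :
    Measurable fun h => triDisc (f h) (g h) := by
  unfold triDisc; fun_prop

lemma measurable_signAvg {L : (Fin m → Bool) → H → ℝ} (hL : ∀ ξ, Measurable (L ξ)) :
    Measurable fun h => signAvg fun ξ => L ξ h := by
  unfold signAvg; fun_prop

lemma signAvg_pos {L : (Fin m → Bool) → ℝ} (hL : ∀ ξ, 0 < L ξ) : 0 < signAvg L :=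
  div_pos (Finset.sum_pos (fun ξ _ => hL ξ) Finset.univ_nonempty) (by positivity)

lemma integral_signAvg {μ₀ : Measure H} {L : (Fin m → Bool) → H → ℝ}
    (hL : ∀ ξ, Integrable (L ξ) μ₀) :
    ∫ h, signAvg (fun ξ => L ξ h) ∂μ₀ = signAvg fun ξ => ∫ h, L ξ h ∂μ₀ := by
  unfold signAvg
  rw [integral_div, integral_finsetSum _ fun ξ _ => hL ξ]

lemma integrable_triDisc {μ₀ : Measure H} [IsFiniteMeasure μ₀] {f g : H → ℝ} (hf : Measurable f)
    (hg : Measurable g) (hf0 : ∀ h, 0 < f h) (hg0 : ∀ h, 0 < g h) {M N : ℝ} (hM : ∀ h, f h ≤ M)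
    (hN : ∀ h, g h ≤ N) : Integrable (fun h => triDisc (f h) (g h)) μ₀ := by
  refine integrable_of_bounded μ₀ (measurable_triDisc hf hg) (C := M + N) fun h => ?_
  rw [abs_of_nonneg (triDisc_nonneg (hf0 h) (hg0 h))]
  linarith [triDisc_le_add (hf0 h) (hg0 h), hM h, hN h]

/-- Used to read a history together with a new view as a longer history. The left inverse transports
the densities unchanged. -/
lemma CloseDensities.map {H' : Type} [MeasurableSpace H'] {μ₀ : Measure H}
    {μ : (Fin m → Bool) → Measure H} {A B : ℝ} (h : CloseDensities μ₀ μ A B) {f : H → H'}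
    {g : H' → H} (hf : Measurable f) (hg : Measurable g) (hgf : ∀ x, g (f x) = x) :
    CloseDensities (μ₀.map f) (fun ξ => (μ ξ).map f) A B := by
  obtain ⟨L, M, h1, h2, h3, h4, h5, h6, h7⟩ := h
  have hi : ∀ φ : H → ℝ, Measurable φ → ∫ x, φ (g x) ∂(μ₀.map f) = ∫ x, φ x ∂μ₀ := by
    intro φ hφ
    have hφg : Measurable fun x => φ (g x) := hφ.comp hg
    rw [integral_map hf.aemeasurable hφg.aestronglyMeasurable]
    simp only [hgf]
  refine ⟨fun ξ x => L ξ (g x), M, fun ξ => (h1 ξ).comp hg, fun ξ x => h2 ξ _, fun ξ x => h3 ξ _,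
    fun ξ => ?_, fun ξ => ?_, fun ξ k => ?_, ?_⟩
  · have hLg : Measurable fun x => ENNReal.ofReal (L ξ (g x)) := ((h1 ξ).comp hg).ennreal_ofReal
    ext S hS
    rw [withDensity_apply _ hS, Measure.map_apply hf hS, h4, withDensity_apply _ (hf hS),
      setLIntegral_map hS hLg hf]
    simp only [hgf]
  · rw [hi (L ξ) (h1 ξ), h5]
  · rw [hi (fun x => triDisc (L ξ x) (L (flipSign k ξ) x)) (measurable_triDisc (h1 _) (h1 _))]
    exact h6 ξ k
  · rw [hi (fun x => triDisc (signAvg fun ξ => L ξ x) 1)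
      (measurable_triDisc (measurable_signAvg h1) measurable_const)]
    exact h7

lemma closeDensities_self (μ₀ : Measure H) [IsProbabilityMeasure μ₀] :
    CloseDensities μ₀ (fun _ : Fin m → Bool => μ₀) 0 0 := by
  refine ⟨fun _ _ => 1, 1, fun _ => measurable_const, fun _ _ => one_pos, fun _ _ => le_rfl,
    fun ξ => ?_, fun ξ => ?_, fun ξ k => ?_, ?_⟩
  · ext S hS
    simp
  · simp
  · simp [triDisc]
  · simp [triDisc, signAvg_const]

/-- The mixture of the experiments has almost the same errors as `μ₀`. -/
lemma CloseDensities.le_error_sum {μ₀ : Measure H} [IsProbabilityMeasure μ₀]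
    {μ : (Fin m → Bool) → Measure H} {A B : ℝ} (h : CloseDensities μ₀ μ A B)
    (η : Kernel H α) [IsMarkovKernel η] {S : Set (H × α)} (hS : MeasurableSet S) {b : ℝ}
    (hb0 : 0 ≤ b) (hb : ∀ ξ, (μ ξ ⊗ₘ η) S ≤ ENNReal.ofReal b) :
    ((μ₀ ⊗ₘ η) S).toReal ≤ b + √(2 * B) := by
  obtain ⟨L, M, h1, h2, h3, h4, h5, h6, h7⟩ := h
  have hM : 0 ≤ M := by
    obtain ⟨x⟩ : Nonempty H := nonempty_of_isProbabilityMeasure μ₀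
    exact (h2 (fun _ => true) x).le.trans (h3 _ _)
  have hLi : ∀ ξ, Integrable (L ξ) μ₀ := fun ξ => integrable_of_bounded μ₀ (h1 ξ) (C := M)
    fun x => by rw [abs_of_pos (h2 ξ x)]; exact h3 ξ x
  set s : H → ℝ := fun x => signAvg fun ξ => L ξ x with hs
  have hsm : Measurable s := measurable_signAvg h1
  have hs0 : ∀ x, 0 < s x := fun x => signAvg_pos fun ξ => h2 ξ x
  have hsM : ∀ x, s x ≤ M := fun x =>
    (signAvg_mono fun ξ => h3 ξ x).trans (signAvg_const (m := m) M).le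
  have hsi : Integrable s μ₀ := integrable_of_bounded μ₀ hsm (C := M)
    fun x => by rw [abs_of_pos (hs0 x)]; exact hsM x
  have hs1 : ∫ x, s x ∂μ₀ = 1 := by
    rw [hs, integral_signAvg hLi]
    simp only [h5, signAvg_const]
  -- the `L¹` distance of the mixture from `μ₀`
  have hL1 : ∫ x, |s x - 1| ∂μ₀ ≤ √(2 * B) := by
    have hti : Integrable (fun x => triDisc (s x) 1) μ₀ :=
      integrable_triDisc hsm measurable_const hs0 (fun _ => one_pos) hsM (fun _ => le_rfl)
    have habs : Integrable (fun x => |s x - 1|) μ₀ := (hsi.sub (integrable_const 1)).abs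
    have hs1i : Integrable (fun x => s x + 1) μ₀ := hsi.add (integrable_const 1)
    -- Cauchy–Schwarz for `|s - 1| = √(triDisc s 1) * √(s + 1)`, in the form of the
    -- arithmetic-geometric mean inequality with a free parameter `t`.
    have h8 : ∀ t : ℝ, 0 < t → ∫ x, |s x - 1| ∂μ₀ ≤ t * B / 2 + 1 / t := by
      intro t ht
      have h9 : ∫ x, |s x - 1| ∂μ₀ ≤ ∫ x, (t / 2 * triDisc (s x) 1 + 1 / (2 * t) * (s x + 1)) ∂μ₀ := by
        refine integral_mono habs ((hti.const_mul _).add (hs1i.const_mul _))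
          fun x => ?_
        have hp := hs0 x
        have : |s x - 1| ^ 2 = triDisc (s x) 1 * (s x + 1) := by
          rw [sq_abs, triDisc]; field_simp
        have h10 : 0 ≤ triDisc (s x) 1 := triDisc_nonneg hp one_pos
        have h11 : t / 2 * triDisc (s x) 1 + 1 / (2 * t) * (s x + 1) - |s x - 1| =
          (t * |s x - 1| - (s x + 1)) ^ 2 / (2 * t * (s x + 1)) := by
          have : triDisc (s x) 1 = |s x - 1| ^ 2 / (s x + 1) := by rw [sq_abs, triDisc]
          rw [this]
          field_simp
          ring
        have h12 : 0 ≤ (t * |s x - 1| - (s x + 1)) ^ 2 / (2 * t * (s x + 1)) := by positivity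
        change |s x - 1| ≤ t / 2 * triDisc (s x) 1 + 1 / (2 * t) * (s x + 1)
        linarith
      rw [integral_add (hti.const_mul _) (hs1i.const_mul _),
        integral_const_mul, integral_const_mul, integral_add hsi (integrable_const 1), hs1] at h9
      simp only [integral_const, probReal_univ, one_smul] at h9
      calc _ ≤ _ := h9
        _ ≤ t / 2 * B + 1 / (2 * t) * (1 + 1) := by gcongr
        _ = _ := by field_simp; ring
    have hB : 0 ≤ B := le_trans (integral_nonneg fun x => triDisc_nonneg (hs0 x) one_pos) h7
    rcases hB.eq_or_lt with hB0 | hBpos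
    · refine le_of_forall_pos_le_add fun e he => ?_
      have := h8 (1 / e) (by positivity)
      rw [← hB0] at this ⊢
      simpa using this
    -- This `t` minimises `t * B / 2 + 1 / t`; for `B = 0` the optimum lies at infinity, hence the
    -- separate case.
    · have := h8 (√(2 / B)) (by positivity)
      refine this.trans (le_of_eq ?_)
      have e1 : √(2 * B) = B * √(2 / B) := by
        rw [← Real.sqrt_sq (by positivity : 0 ≤ B * √(2 / B)), mul_pow, Real.sq_sqrt (by positivity)]
        congr 1; field_simp
      have e2 : √(2 / B) * √(2 / B) = 2 / B := Real.mul_self_sqrt (by positivity)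
      have hne : √(2 / B) ≠ 0 := by positivity
      rw [e1]
      field_simp
      have e3 : B * √(2 / B) ^ 2 = 2 := by rw [pow_two, e2]; field_simp
      nlinarith [e3]
  have hmass : ∀ ξ, ∫ z in S, L ξ z.1 ∂(μ₀ ⊗ₘ η) ≤ b := by
    intro ξ
    have hprob : IsFiniteMeasure (μ₀.withDensity fun h => ENNReal.ofReal (L ξ h)) :=
      isFiniteMeasure_withDensity_ofReal (hLi ξ).2
    have h8 := hb ξ
    rw [h4 ξ, withDensity_compProd_left μ₀ η (h1 ξ).ennreal_ofReal, withDensity_apply _ hS] at h8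
    have hm : Measurable fun z : H × α => L ξ z.1 := (h1 ξ).comp measurable_fst
    rw [integral_eq_lintegral_of_nonneg_ae (Filter.Eventually.of_forall fun z : H × α =>
      (h2 ξ z.1).le) hm.aestronglyMeasurable]
    exact ENNReal.toReal_le_of_le_ofReal hb0 h8
  have hLi' : ∀ ξ, Integrable (fun z : H × α => L ξ z.1) (μ₀ ⊗ₘ η) := fun ξ =>
    integrable_of_bounded _ ((h1 ξ).comp measurable_fst) (C := M)
      fun x => by rw [abs_of_pos (h2 ξ x.1)]; exact h3 ξ x.1
  have hsi' : Integrable (fun z : H × α => s z.1) (μ₀ ⊗ₘ η) :=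
    integrable_of_bounded _ (hsm.comp measurable_fst) (C := M)
      fun x => by rw [abs_of_pos (hs0 x.1)]; exact hsM x.1
  have hsS : ∫ z in S, s z.1 ∂(μ₀ ⊗ₘ η) ≤ b := by
    have : ∫ z in S, s z.1 ∂(μ₀ ⊗ₘ η) = signAvg fun ξ => ∫ z in S, L ξ z.1 ∂(μ₀ ⊗ₘ η) :=
      integral_signAvg fun ξ => (hLi' ξ).integrableOn
    rw [this]
    exact (signAvg_mono hmass).trans (signAvg_const (m := m) b).le
  have habs' : Integrable (fun z : H × α => |s z.1 - 1|) (μ₀ ⊗ₘ η) :=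
    (hsi'.sub (integrable_const 1)).abs
  have h9 : ((μ₀ ⊗ₘ η) S).toReal = ∫ z in S, (1 : ℝ) ∂(μ₀ ⊗ₘ η) := by
    simp [Measure.real]
  have h10 : ∫ z in S, (1 : ℝ) ∂(μ₀ ⊗ₘ η) ≤ ∫ z in S, (s z.1 + |s z.1 - 1|) ∂(μ₀ ⊗ₘ η) := by
    refine integral_mono (integrable_const 1) (hsi'.add habs').integrableOn fun z => ?_
    have := neg_abs_le (s z.1 - 1)
    simp only
    linarith
  rw [integral_add hsi'.integrableOn habs'.integrableOn] at h10
  have h11 : ∫ z in S, |s z.1 - 1| ∂(μ₀ ⊗ₘ η) ≤ ∫ z, |s z.1 - 1| ∂(μ₀ ⊗ₘ η) :=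
    setIntegral_le_integral habs' (Filter.Eventually.of_forall fun z => abs_nonneg _)
  have h12 : ∫ z, |s z.1 - 1| ∂(μ₀ ⊗ₘ η) = ∫ x, |s x - 1| ∂μ₀ :=
    integral_comp_fst_compProd μ₀ η (f := fun x => |s x - 1|) (by fun_prop)
  linarith

end Mixture

end LDPTest

end

noncomputable section

namespace LDPTest

/-! ### One round of interaction: growth of the two discriminations. -/

section Step

variable {d m : ℕ} {H α : Type} [MeasurableSpace H] [MeasurableSpace α]

/-- The uniform distribution on `m` pairs of coordinates. -/
def nullVec (h : 2 * m ≤ d) (hm : 0 < m) : ProbVec d := pairVec h hm 0 (by simp)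

/-- The uniform distribution on `m` pairs of coordinates, tilted by `± γ` within each pair. -/
def signVec (h : 2 * m ≤ d) (hm : 0 < m) {γ : ℝ} (hγ : |γ| ≤ 1) (ξ : Fin m → Bool) : ProbVec d :=
  pairVec h hm (fun k => γ * sgn (ξ k)) (fun k => by rw [abs_mul, abs_sgn, mul_one]; exact hγ)

lemma sum_probVec_mul_mem {q : ProbVec d} {r : Fin d → ℝ} {a b : ℝ} (ha : ∀ x, a ≤ r x)
    (hb : ∀ x, r x ≤ b) : a ≤ ∑ x, q.1 x * r x ∧ ∑ x, q.1 x * r x ≤ b := by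
  constructor
  · calc a = ∑ x, q.1 x * a := by rw [← Finset.sum_mul, q.2.2, one_mul]
      _ ≤ _ := Finset.sum_le_sum fun x _ => mul_le_mul_of_nonneg_left (ha x) (q.2.1 x)
  · calc _ ≤ ∑ x, q.1 x * b := Finset.sum_le_sum fun x _ => mul_le_mul_of_nonneg_left (hb x) (q.2.1 x)
      _ = b := by rw [← Finset.sum_mul, q.2.2, one_mul]

lemma one_third_le_exp_neg {ε : ℝ} (hε1 : ε ≤ 1) : 1 / 3 ≤ Real.exp (-ε) := by
  have h1 : Real.exp (-1) ≤ Real.exp (-ε) := Real.exp_le_exp.2 (by linarith)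
  have h2 : (1 / 3 : ℝ) ≤ Real.exp (-1) := by
    rw [Real.exp_neg, one_div]
    exact inv_anti₀ (Real.exp_pos 1) (by linarith [Real.exp_one_lt_d9])
  linarith

/-- One round of interaction with an `ε`-LDP channel. -/
lemma CloseDensities.step {μ₀ : Measure H} [IsProbabilityMeasure μ₀]
    {μ : (Fin m → Bool) → Measure H} {A B : ℝ} (hc : CloseDensities μ₀ μ A B)
    (K : Fin d → Kernel H α) [∀ x, IsMarkovKernel (K x)] (κ : ProbVec d → Kernel H α)
    [∀ q, IsMarkovKernel (κ q)] (hκ : IsMixture K κ) {ε : ℝ} (hε : 0 ≤ ε) (hε1 : ε ≤ 1)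
    (hK : ∀ x x' h S, MeasurableSet S → K x h S ≤ ENNReal.ofReal (Real.exp ε) * K x' h S)
    (h2m : 2 * m ≤ d) (hm : 0 < m) {γ : ℝ} (hγ : |γ| ≤ 1) :
    CloseDensities (μ₀ ⊗ₘ κ (nullVec h2m hm)) (fun ξ => μ ξ ⊗ₘ κ (signVec h2m hm hγ ξ))
      (A + 108 * (γ * ε / m) ^ 2) (B + 9 / 2 * (γ * ε) ^ 2 * A) := by
  obtain ⟨L, M, h1, h2, h3, h4, h5, h6, h7⟩ := hc
  obtain ⟨r, hr, hr1, hr2, hr3⟩ := exists_channel_densities μ₀ K κ hκ hε hK (nullVec h2m hm)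
  have hm0 : (0 : ℝ) < m := by exact_mod_cast hm
  have hM : 0 ≤ M := by
    obtain ⟨x⟩ : Nonempty H := nonempty_of_isProbabilityMeasure μ₀
    exact (h2 (fun _ => true) x).le.trans (h3 _ _)
  set ν := μ₀ ⊗ₘ κ (nullVec h2m hm) with hν
  set g : (Fin m → Bool) → H × α → ℝ := fun ξ z => ∑ x, (signVec h2m hm hγ ξ).1 x * r x z with hg
  set D : Fin m → H × α → ℝ :=
    fun k z => r (pairIdx h2m (k, true)) z - r (pairIdx h2m (k, false)) z with hD
  have hDb : ∀ k z, |D k z| ≤ 3 * ε := fun k z =>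
    abs_sub_le_of_exp_bounds hε hε1 (hr1 _ _) (hr2 _ _) (hr1 _ _) (hr2 _ _)
  have hgm : ∀ ξ, Measurable (g ξ) := fun ξ =>
    Finset.measurable_sum _ fun x _ => (hr x).const_mul _
  have hgl : ∀ ξ z, 1 / 3 ≤ g ξ z := fun ξ z =>
    (one_third_le_exp_neg hε1).trans (sum_probVec_mul_mem (fun x => hr1 x z) fun x => hr2 x z).1
  have hgu : ∀ ξ z, g ξ z ≤ Real.exp ε := fun ξ z =>
    (sum_probVec_mul_mem (fun x => hr1 x z) fun x => hr2 x z).2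
  have hg0 : ∀ ξ z, 0 < g ξ z := fun ξ z => lt_of_lt_of_le (by norm_num) (hgl ξ z)
  have hgden : ∀ ξ, μ₀ ⊗ₘ κ (signVec h2m hm hγ ξ) =
      ν.withDensity fun z => ENNReal.ofReal (g ξ z) := fun ξ => hr3 _
  -- the null density
  have hnull : ∀ᵐ z ∂ν, ∑ x, (nullVec h2m hm).1 x * r x z = 1 := by
    have hm0 : Measurable fun z => ∑ x, (nullVec h2m hm).1 x * r x z :=
      Finset.measurable_sum _ fun x _ => (hr x).const_mul _
    have h8 : ν.withDensity (fun z => ENNReal.ofReal (∑ x, (nullVec h2m hm).1 x * r x z)) =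
        ν.withDensity (fun _ => 1) := by
      rw [withDensity_const, one_smul]; exact (hr3 _).symm
    rw [withDensity_eq_iff_of_sigmaFinite hm0.ennreal_ofReal.aemeasurable aemeasurable_const] at h8
    filter_upwards [h8] with z hz
    simpa using hz
  have hgD : ∀ ξ z, g ξ z = ∑ x, (nullVec h2m hm).1 x * r x z +
      γ / (2 * m) * ∑ k, sgn (ξ k) * D k z := fun ξ z => by
    rw [hg]
    simp only [signVec]
    rw [sum_pairVec_mul_eq h2m hm _ _ (by simp)]
    congr 1
    rw [Finset.mul_sum, Finset.sum_div]
    exact Finset.sum_congr rfl fun k _ => by rw [hD]; ring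
  -- The conditional law of the view given the past has mass one under every tilt. Hence the
  -- first-order terms weighted by functions of the past leave both discriminations unchanged.
  have hmean : ∀ (φ : H → ℝ), Measurable φ → ∀ ξ, ∫ z, φ z.1 * g ξ z ∂ν = ∫ h, φ h ∂μ₀ := by
    intro φ hφ ξ
    rw [← integral_comp_fst_compProd μ₀ (κ (signVec h2m hm hγ ξ)) hφ, hgden,
      integral_withDensity_ofReal ν (hgm ξ) fun z => (hg0 ξ z).le]
    simp only [mul_comm]
  have hfst : ∀ (φ : H → ℝ), Measurable φ → ∫ z, φ z.1 ∂ν = ∫ h, φ h ∂μ₀ := fun φ hφ =>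
    integral_comp_fst_compProd μ₀ _ hφ
  have hint : ∀ (φ : H → ℝ), Measurable φ → ∀ C, (∀ h, |φ h| ≤ C) →
      Integrable (fun z : H × α => φ z.1) ν := fun φ hφ C hC =>
    integrable_of_bounded ν (hφ.comp measurable_fst) (C := C) fun z => hC z.1
  have hintg : ∀ (φ : H → ℝ), Measurable φ → ∀ C, (∀ h, |φ h| ≤ C) → ∀ ξ,
      Integrable (fun z : H × α => φ z.1 * g ξ z) ν := by
    intro φ hφ C hC ξ
    refine integrable_of_bounded ν ((hφ.comp measurable_fst).mul (hgm ξ)) (C := C * Real.exp ε)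
      fun z => ?_
    rw [abs_mul, abs_of_pos (hg0 ξ z)]
    exact mul_le_mul (hC _) (hgu ξ z) (hg0 ξ z).le ((abs_nonneg _).trans (hC z.1))
  have hLabs : ∀ ξ h, |L ξ h| ≤ M := fun ξ h => by rw [abs_of_pos (h2 ξ h)]; exact h3 ξ h
  have htri : ∀ ξ k h, |triDisc (L ξ h) (L (flipSign k ξ) h)| ≤ M + M := fun ξ k h => by
    rw [abs_of_nonneg (triDisc_nonneg (h2 _ _) (h2 _ _))]
    exact (triDisc_le_add (h2 _ _) (h2 _ _)).trans (add_le_add (h3 _ _) (h3 _ _))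
  have htrim : ∀ ξ k, Measurable fun h => triDisc (L ξ h) (L (flipSign k ξ) h) := fun ξ k =>
    measurable_triDisc (h1 _) (h1 _)
  have hL'm : ∀ ξ, Measurable fun z : H × α => L ξ z.1 * g ξ z := fun ξ =>
    ((h1 ξ).comp measurable_fst).mul (hgm ξ)
  have hL'p : ∀ ξ (z : H × α), 0 < L ξ z.1 * g ξ z := fun ξ z => mul_pos (h2 ξ z.1) (hg0 ξ z)
  have hL'b : ∀ ξ (z : H × α), L ξ z.1 * g ξ z ≤ M * Real.exp ε := fun ξ z =>
    mul_le_mul (h3 ξ z.1) (hgu ξ z) (hg0 ξ z).le hM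
  refine ⟨fun ξ z => L ξ z.1 * g ξ z, M * Real.exp ε, hL'm, hL'p, hL'b, fun ξ => ?_, fun ξ => ?_,
    fun ξ k => ?_, ?_⟩
  · have hLi : Integrable (L ξ) μ₀ := integrable_of_bounded μ₀ (h1 ξ) (hLabs ξ)
    have : IsFiniteMeasure (μ₀.withDensity fun h => ENNReal.ofReal (L ξ h)) :=
      isFiniteMeasure_withDensity_ofReal hLi.2
    have hLf : Measurable fun z : H × α => ENNReal.ofReal (L ξ z.1) :=
      ((h1 ξ).comp measurable_fst).ennreal_ofReal
    change μ ξ ⊗ₘ κ (signVec h2m hm hγ ξ) = _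
    rw [h4 ξ, withDensity_compProd_left μ₀ _ (h1 ξ).ennreal_ofReal, hgden,
      ← withDensity_mul _ (hgm ξ).ennreal_ofReal hLf]
    congr 1
    ext z
    simp only [Pi.mul_apply]
    rw [← ENNReal.ofReal_mul (hg0 ξ z).le, mul_comm]
  · rw [hmean _ (h1 ξ), h5]
  -- The tangent coefficients of `triDisc_mul_le`; `c` and `c'` below sum to the discrimination
  -- before the round. The added term is `12 * 9 = 108` times `(γε/m)²`, since only the sign `k`
  -- differs.
  · set c : H → ℝ := fun h => L ξ h - 4 * L ξ h * L (flipSign k ξ) h ^ 2 /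
      (L ξ h + L (flipSign k ξ) h) ^ 2 with hcdef
    have hcm : Measurable c := by
      have := h1 ξ
      have := h1 (flipSign k ξ)
      rw [hcdef]
      fun_prop
    have hcb : ∀ h, |c h| ≤ M + M := fun h =>
      (abs_triDisc_slope_le (h2 _ _) (h2 _ _)).trans (add_le_add (h3 _ _) (h3 _ _))
    set c' : H → ℝ := fun h => triDisc (L ξ h) (L (flipSign k ξ) h) - c h with hc'def
    have hc'm : Measurable c' := (htrim ξ k).sub hcm
    have hc'b : ∀ h, |c' h| ≤ M + M + (M + M) := fun h =>
      (abs_sub _ _).trans (add_le_add (htri ξ k h) (hcb h))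
    have hdiff : ∀ z, (g ξ z - g (flipSign k ξ) z) ^ 2 ≤ 9 * (γ * ε / m) ^ 2 := by
      intro z
      have e1 : g ξ z - g (flipSign k ξ) z = γ / m * (sgn (ξ k) * D k z) := by
        rw [hgD, hgD, add_sub_add_left_eq_sub, ← mul_sub, ← Finset.sum_sub_distrib,
          Finset.sum_eq_single k]
        · rw [flipSign_apply_self, sgn_not]; field_simp; ring
        · intro l _ hl
          rw [flipSign_apply_of_ne hl]; ring
        · simp
      rw [e1, mul_pow, mul_pow, sgn_sq, one_mul, ← sq_abs (D k z)]
      calc (γ / m) ^ 2 * |D k z| ^ 2 ≤ (γ / m) ^ 2 * (3 * ε) ^ 2 := by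
            gcongr; exact hDb k z
        _ = _ := by ring
    have hcc' : Integrable (fun z => c z.1 * g ξ z + c' z.1 * g (flipSign k ξ) z) ν :=
      (hintg c hcm _ hcb ξ).add (hintg c' hc'm _ hc'b _)
    have hle : ∫ z, triDisc (L ξ z.1 * g ξ z) (L (flipSign k ξ) z.1 * g (flipSign k ξ) z) ∂ν ≤
        ∫ z, (c z.1 * g ξ z + c' z.1 * g (flipSign k ξ) z +
          108 * (γ * ε / m) ^ 2 * L ξ z.1) ∂ν := by
      refine integral_mono (integrable_triDisc (hL'm _) (hL'm _) (hL'p _) (hL'p _) (hL'b _)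
        (hL'b _)) (hcc'.add
        ((hint (L ξ) (h1 ξ) M (hLabs ξ)).const_mul _)) fun z => ?_
      have h9 := triDisc_mul_le (h2 ξ z.1) (h2 (flipSign k ξ) z.1) (hg0 ξ z) (hgl (flipSign k ξ) z)
      refine h9.trans ?_
      have h10 := mul_le_mul_of_nonneg_left (hdiff z) (h2 ξ z.1).le
      change _ ≤ c z.1 * g ξ z + c' z.1 * g (flipSign k ξ) z + 108 * (γ * ε / m) ^ 2 * L ξ z.1
      rw [hc'def, hcdef]
      simp only
      linarith
    rw [integral_add hcc'
      ((hint (L ξ) (h1 ξ) M (hLabs ξ)).const_mul _),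
      integral_add (hintg c hcm _ hcb ξ) (hintg c' hc'm _ hc'b _), hmean c hcm, hmean c' hc'm,
      integral_const_mul, hfst _ (h1 ξ), h5, hc'def,
      integral_sub (integrable_of_bounded μ₀ (htrim ξ k) (htri ξ k))
        (integrable_of_bounded μ₀ hcm hcb)] at hle
    linarith [h6 ξ k]
  · set s : H → ℝ := fun x => signAvg fun ξ => L ξ x with hs
    have hsm : Measurable s := measurable_signAvg h1
    have hs0 : ∀ x, 0 < s x := fun x => signAvg_pos fun ξ => h2 ξ x
    have hsM : ∀ x, s x ≤ M := fun x =>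
      (signAvg_mono fun ξ => h3 ξ x).trans (signAvg_const (m := m) M).le
    set s' : H × α → ℝ := fun z => signAvg fun ξ => L ξ z.1 * g ξ z with hs'
    have hs'm : Measurable s' := measurable_signAvg hL'm
    have hs'0 : ∀ z, 0 < s' z := fun z => signAvg_pos fun ξ => hL'p ξ z
    have hs'M : ∀ z, s' z ≤ M * Real.exp ε := fun z =>
      (signAvg_mono fun ξ => hL'b ξ z).trans (signAvg_const (m := m) _).le
    set w : H → ℝ := fun h => 1 - 4 / (s h + 1) ^ 2 with hw
    have hwm : Measurable w := by rw [hw]; fun_prop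
    have hwb : ∀ h, |w h| ≤ 3 := fun h => by
      have h8 : 4 / (s h + 1) ^ 2 ≤ 4 := by
        rw [div_le_iff₀ (by have := hs0 h; positivity)]
        nlinarith [hs0 h]
      have h9 : 0 ≤ 4 / (s h + 1) ^ 2 := by positivity
      rw [hw, abs_le]
      constructor <;> simp only <;> linarith
    have hwL : ∀ ξ h, |w h * L ξ h| ≤ 3 * M := fun ξ h => by
      rw [abs_mul]
      exact mul_le_mul (hwb h) (hLabs ξ h) (abs_nonneg _) (by norm_num)
    -- The total discrimination over the `m` directions of the cube; its mean is at most `m * A`.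
    set T : H → ℝ := fun h => ∑ k, signAvg fun ξ => triDisc (L ξ h) (L (flipSign k ξ) h) with hT
    have hTi : Integrable T μ₀ := integrable_finsetSum _ fun k _ => by
      unfold signAvg
      exact (integrable_finsetSum _ fun ξ _ =>
        integrable_of_bounded μ₀ (htrim ξ k) (htri ξ k)).div_const _
    have hTm : Measurable T := Finset.measurable_sum _ fun k _ => measurable_signAvg fun ξ => htrim ξ k
    have hTb : ∀ h, |T h| ≤ m * (M + M) := fun h => by
      calc |T h| ≤ ∑ k, |signAvg fun ξ => triDisc (L ξ h) (L (flipSign k ξ) h)| :=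
            Finset.abs_sum_le_sum_abs _ _
        _ ≤ ∑ _k : Fin m, (M + M) := Finset.sum_le_sum fun k _ => by
            rw [abs_of_nonneg]
            · exact (signAvg_mono fun ξ => (le_abs_self _).trans (htri ξ k h)).trans
                (signAvg_const (m := m) _).le
            · exact div_nonneg (Finset.sum_nonneg fun ξ _ => triDisc_nonneg (h2 _ _) (h2 _ _))
                (by positivity)
        _ = _ := by simp only [Finset.sum_const, Finset.card_univ, Fintype.card_fin, nsmul_eq_mul]
    have hTle : ∫ h, T h ∂μ₀ ≤ m * A := by
      rw [hT, integral_finsetSum _ fun k _ => by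
        unfold signAvg
        exact (integrable_finsetSum _ fun ξ _ =>
          integrable_of_bounded μ₀ (htrim ξ k) (htri ξ k)).div_const _]
      calc _ ≤ ∑ _k : Fin m, A := Finset.sum_le_sum fun k _ => by
            rw [integral_signAvg fun ξ => integrable_of_bounded μ₀ (htrim ξ k) (htri ξ k)]
            exact (signAvg_mono fun ξ => h6 ξ k).trans (signAvg_const (m := m) _).le
        _ = _ := by simp
    have hws : ∫ z, signAvg (fun ξ => (w z.1 * L ξ z.1) * g ξ z) ∂ν = ∫ h, w h * s h ∂μ₀ := by
      rw [integral_signAvg fun ξ => hintg (fun h => w h * L ξ h) (hwm.mul (h1 ξ)) _ (hwL ξ) ξ]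
      have : ∀ ξ, ∫ z, (w z.1 * L ξ z.1) * g ξ z ∂ν = ∫ h, w h * L ξ h ∂μ₀ := fun ξ =>
        hmean (fun h => w h * L ξ h) (hwm.mul (h1 ξ)) ξ
      simp only [this]
      have hwLi : ∀ ξ, Integrable (fun h => w h * L ξ h) μ₀ := fun ξ =>
        integrable_of_bounded μ₀ (hwm.mul (h1 ξ)) (hwL ξ)
      rw [← integral_signAvg hwLi]
      refine integral_congr_ae (Filter.Eventually.of_forall fun h => ?_)
      simp only [signAvg, hs, ← Finset.mul_sum, mul_div_assoc]
    have hwsi : Integrable (fun z => signAvg (fun ξ => (w z.1 * L ξ z.1) * g ξ z)) ν := by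
      unfold signAvg
      exact (integrable_finsetSum _ fun ξ _ =>
        hintg (fun h => w h * L ξ h) (hwm.mul (h1 ξ)) _ (hwL ξ) ξ).div_const _
    have hts : ∀ h, |triDisc (s h) 1 - w h * s h| ≤ M + 1 + 3 * M := fun h => by
      refine (abs_sub _ _).trans (add_le_add ?_ ?_)
      · rw [abs_of_nonneg (triDisc_nonneg (hs0 h) one_pos)]
        exact (triDisc_le_add (hs0 h) one_pos).trans (add_le_add (hsM h) le_rfl)
      · rw [abs_mul, abs_of_pos (hs0 h)]
        exact mul_le_mul (hwb h) (hsM h) (hs0 h).le (by norm_num)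
    have htsm : Measurable fun h => triDisc (s h) 1 - w h * s h :=
      (measurable_triDisc hsm measurable_const).sub (hwm.mul hsm)
    have htws : Integrable (fun z => (triDisc (s z.1) 1 - w z.1 * s z.1) +
        signAvg (fun ξ => (w z.1 * L ξ z.1) * g ξ z)) ν := (hint _ htsm _ hts).add hwsi
    have hwsi' : Integrable (fun h => w h * s h) μ₀ :=
      integrable_of_bounded μ₀ (hwm.mul hsm) (C := 3 * M) fun h => by
        rw [abs_mul, abs_of_pos (hs0 h)]
        exact mul_le_mul (hwb h) (hsM h) (hs0 h).le (by norm_num)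
    have hle : ∫ z, triDisc (s' z) 1 ∂ν ≤ ∫ z, ((triDisc (s z.1) 1 - w z.1 * s z.1) +
        signAvg (fun ξ => (w z.1 * L ξ z.1) * g ξ z) + 9 / 2 * (γ * ε) ^ 2 / m * T z.1) ∂ν := by
      refine integral_mono_ae (integrable_triDisc hs'm measurable_const hs'0 (fun _ => one_pos)
        hs'M (fun _ => le_rfl)) (htws.add
        ((hint T hTm _ hTb).const_mul _)) ?_
      filter_upwards [hnull] with z hz
      have e0 : s z.1 + (s' z - s z.1) = s' z := by ring
      have h8 := triDisc_add_one_le (hs0 z.1) (δ := s' z - s z.1) (by rw [e0]; exact hs'0 z)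
      rw [e0] at h8
      -- As the null density is `1`, the mixture moves only through the correlations of the
      -- likelihood with the individual signs. Cauchy–Schwarz over `k` and `sq_signAvg_div_le` then
      -- yield `T`.
      have e1 : s' z - s z.1 =
          γ / (2 * m) * ∑ k, signAvg (fun ξ => sgn (ξ k) * L ξ z.1) * D k z := by
        rw [← signAvg_mul_sum (fun ξ => L ξ z.1) (fun k => D k z)]
        simp only [hs', hs, signAvg]
        rw [← sub_div, ← Finset.sum_sub_distrib, ← mul_div_assoc, Finset.mul_sum]
        congr 1
        refine Finset.sum_congr rfl fun ξ _ => ?_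
        rw [hgD, hz]; ring
      have e2 : (s' z - s z.1) ^ 2 / s z.1 ≤ 9 / 8 * (γ * ε) ^ 2 / m * T z.1 := by
        have h9 := Finset.sum_mul_sq_le_sq_mul_sq Finset.univ
          (fun k => signAvg (fun ξ => sgn (ξ k) * L ξ z.1)) (fun k => D k z)
        have h10 : ∑ k, D k z ^ 2 ≤ m * (3 * ε) ^ 2 := by
          calc _ ≤ ∑ _k : Fin m, (3 * ε) ^ 2 := Finset.sum_le_sum fun k _ => by
                rw [← sq_abs]; gcongr; exact hDb k z
            _ = _ := by simp
        have h11 : (∑ k, signAvg (fun ξ => sgn (ξ k) * L ξ z.1) ^ 2) / s z.1 ≤ T z.1 / 2 := by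
          rw [Finset.sum_div, hT, Finset.sum_div]
          exact Finset.sum_le_sum fun k _ => sq_signAvg_div_le k fun ξ => h2 ξ z.1
        rw [e1, mul_pow]
        calc _ ≤ (γ / (2 * m)) ^ 2 * ((∑ k, signAvg (fun ξ => sgn (ξ k) * L ξ z.1) ^ 2) *
              (m * (3 * ε) ^ 2)) / s z.1 := by
              have := (hs0 z.1).le
              gcongr
              exact h9.trans (mul_le_mul_of_nonneg_left h10
                (Finset.sum_nonneg fun k _ => sq_nonneg _))
          _ = (γ / (2 * m)) ^ 2 * (m * (3 * ε) ^ 2) *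
              ((∑ k, signAvg (fun ξ => sgn (ξ k) * L ξ z.1) ^ 2) / s z.1) := by ring
          _ ≤ (γ / (2 * m)) ^ 2 * (m * (3 * ε) ^ 2) * (T z.1 / 2) := by gcongr
          _ = _ := by field_simp; ring
      have e3 : signAvg (fun ξ => (w z.1 * L ξ z.1) * g ξ z) = w z.1 * s' z := by
        simp only [signAvg, hs', mul_assoc, ← Finset.mul_sum, mul_div_assoc]
      rw [e3]
      have e4 : 9 / 2 * (γ * ε) ^ 2 / m * T z.1 = 4 * (9 / 8 * (γ * ε) ^ 2 / m * T z.1) := by ring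
      rw [e4]
      have e5 : (1 - 4 / (s z.1 + 1) ^ 2) = w z.1 := rfl
      rw [e5] at h8
      nlinarith [e2, h8]
    have hfst1 := hfst (fun h => triDisc (s h) 1 - w h * s h) htsm
    have hfst2 := hfst T hTm
    rw [integral_add htws ((hint T hTm _ hTb).const_mul _),
      integral_add (hint _ htsm _ hts) hwsi, hws, integral_const_mul, hfst2, hfst1,
      integral_sub (integrable_triDisc hsm measurable_const hs0 (fun _ => one_pos) hsM
        (fun _ => le_rfl)) hwsi'] at hle
    have h8 : 9 / 2 * (γ * ε) ^ 2 / m * ∫ h, T h ∂μ₀ ≤ 9 / 2 * (γ * ε) ^ 2 / m * (m * A) := by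
      gcongr
    have h9 : 9 / 2 * (γ * ε) ^ 2 / m * (m * A) = 9 / 2 * (γ * ε) ^ 2 * A := by field_simp
    linarith

end Step

end LDPTest

end

noncomputable section

namespace LDPTest

/-! ### The interactive lower bound. -/

section Interactive

variable {d m : ℕ}

lemma CloseDensities.mono {H : Type} [MeasurableSpace H] {μ₀ : Measure H}
    {μ : (Fin m → Bool) → Measure H} {A B A' B' : ℝ} (h : CloseDensities μ₀ μ A B) (hA : A ≤ A')
    (hB : B ≤ B') : CloseDensities μ₀ μ A' B' := by
  obtain ⟨L, M, h1, h2, h3, h4, h5, h6, h7⟩ := h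
  exact ⟨L, M, h1, h2, h3, h4, h5, fun ξ k => (h6 ξ k).trans hA, h7.trans hB⟩

lemma sequentialLaw_succ_apply {H α : Type} [MeasurableSpace H] [MeasurableSpace α] (n : ℕ)
    (κ : (i : ℕ) → i < n + 1 → Kernel (H × (Fin i → α)) α) (hκ : ∀ i hi, IsMarkovKernel (κ i hi))
    (a : H) :
    sequentialLaw (n + 1) κ a =
      ((sequentialLaw n (fun i hi => κ i (Nat.lt_succ_of_lt hi)) a) ⊗ₘ
        ((κ n (Nat.lt_succ_self n)).sectR a)).map
          (fun x => (Fin.snoc (α := fun _ => α) x.1 x.2 : Fin (n + 1) → α)) := by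
  have := isMarkovKernel_sequentialLaw n (fun i hi => κ i (Nat.lt_succ_of_lt hi)) fun i hi => hκ i _
  have := hκ n (Nat.lt_succ_self n)
  rw [sequentialLaw, Kernel.map_apply _ (measurable_snoc n),
    Kernel.compProd_apply_eq_compProd_sectR]

lemma measurable_init_last {α : Type} [MeasurableSpace α] (n : ℕ) :
    Measurable (fun x : Fin (n + 1) → α => ((fun i => x i.castSucc : Fin n → α), x (Fin.last n))) :=
  (measurable_pi_lambda _ fun _ => measurable_pi_apply _).prodMk (measurable_pi_apply _)

/-- `A` grows linearly in the number of rounds, and round `i` adds `(9/2) * 108 * i = 486 * i` times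
the product of squares to `B`. The sum over `i < n` is at most `243 * n²` times that product. -/
lemma closeDensities_sequentialLaw {α : Type} [MeasurableSpace α] {ε : ℝ} (hε : 0 ≤ ε)
    (hε1 : ε ≤ 1) (h2m : 2 * m ≤ d) (hm : 0 < m) {γ : ℝ} (hγ : |γ| ≤ 1) (n : ℕ)
    (K : (i : ℕ) → i < n → Fin d → Kernel (Unit × (Fin i → α)) α)
    (κ : ProbVec d → (i : ℕ) → i < n → Kernel (Unit × (Fin i → α)) α)
    (hKm : ∀ i hi x, IsMarkovKernel (K i hi x)) (hκm : ∀ q i hi, IsMarkovKernel (κ q i hi))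
    (hκ : ∀ i hi, IsMixture (K i hi) (fun q => κ q i hi))
    (hK : ∀ i hi x x' h S, MeasurableSet S →
      K i hi x h S ≤ ENNReal.ofReal (Real.exp ε) * K i hi x' h S) :
    CloseDensities (sequentialLaw n (κ (nullVec h2m hm)) ())
      (fun ξ => sequentialLaw n (κ (signVec h2m hm hγ ξ)) ())
      (n * (108 * (γ * ε / m) ^ 2)) (n ^ 2 * (243 * (γ * ε) ^ 2 * (γ * ε / m) ^ 2)) := by
  induction n with
  | zero =>
    simp only [sequentialLaw, Kernel.const_apply]
    exact (closeDensities_self (m := m) _).mono (by simp) (by simp)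
  | succ n ih =>
    have ih' := ih (fun i hi => K i (Nat.lt_succ_of_lt hi))
      (fun q i hi => κ q i (Nat.lt_succ_of_lt hi)) (fun i hi x => hKm i _ x)
      (fun q i hi => hκm q i _) (fun i hi => hκ i _) (fun i hi => hK i _)
    have := isMarkovKernel_sequentialLaw n
      (fun i hi => κ (nullVec h2m hm) i (Nat.lt_succ_of_lt hi)) fun i hi => hκm _ i _
    have := fun x => hKm n (Nat.lt_succ_self n) x
    have := fun q => hκm q n (Nat.lt_succ_self n)
    have hstep := ih'.step (fun x => (K n (Nat.lt_succ_self n) x).sectR ())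
      (fun q => (κ q n (Nat.lt_succ_self n)).sectR ())
      (fun q h => by
        simp only [Kernel.sectR_apply]
        exact hκ n _ q ((), h)) hε hε1
      (fun x x' h S hS => by
        simp only [Kernel.sectR_apply]
        exact hK n _ x x' ((), h) S hS) h2m hm hγ
    have hmap := hstep.map (measurable_snoc n) (measurable_init_last n) (fun x => by simp)
    simp only [sequentialLaw_succ_apply n _ (hκm _)]
    refine hmap.mono (by push_cast; linarith) ?_
    push_cast
    have : 0 ≤ (γ * ε) ^ 2 * (γ * ε / m) ^ 2 := by positivity
    nlinarith

/-- The total error of a test of a sequentially interactive mechanism. -/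
lemma ofReal_le_typeTwoError_interactive {n₁ n₂ : ℕ} {𝒵 𝒲 : Type} [MeasurableSpace 𝒵]
    [MeasurableSpace 𝒲] (Q : Interactive d n₁ n₂ 𝒵 𝒲) {ε : ℝ} (hQ : Q.IsLDP ε) (hε : 0 ≤ ε)
    (hε1 : ε ≤ 1) {α β : ℝ} (hα : 0 ≤ α) (hβ : 0 ≤ β) (hαβ : α + β ≤ 1 / 2)
    {φ : (Fin n₁ → 𝒵 × 𝒲) × (Fin (n₂ - n₁) → 𝒲) → Bool} (hφ : IsLevel Q.law α φ)
    (h2m : 2 * m ≤ d) (hm : 0 < m) {γ : ℝ} (hγ0 : 0 ≤ γ) (hγ : γ ≤ 1)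
    (hγn : 200 * (γ ^ 2 * (n₁ * ε ^ 2)) ≤ m) {p ρ : ℝ} (hp : 1 ≤ p)
    (hρ : ρ ≤ (2 * m : ℝ) ^ (1 / p - 1) * γ) :
    ENNReal.ofReal (β + 1 / 8) ≤ typeTwoError Q.law p ρ φ := by
  by_contra hlt
  push Not at hlt
  have hγ' : |γ| ≤ 1 := by rwa [abs_of_nonneg hγ0]
  have hm0 : (0 : ℝ) < m := by exact_mod_cast hm
  have := Q.markovX
  have := Q.markovY
  have := Q.markovYtail
  set q₀ := nullVec h2m hm
  -- The second sample keeps the law `q₀` throughout. The view `W i` therefore becomes part of the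
  -- output of a channel whose only raw datum is `X i`, and the pair of views inherits the LDP
  -- bound.
  set V : (i : Fin n₁) → Kernel (Fin i → 𝒵 × 𝒲) 𝒲 := fun i => privateView q₀.toMeasure (Q.QY i)
  set κ : ProbVec d → (i : ℕ) → i < n₁ → Kernel (Unit × (Fin i → 𝒵 × 𝒲)) (𝒵 × 𝒲) :=
    fun q i hi => Kernel.prodMkLeft Unit (privateView q.toMeasure (Q.QX ⟨i, hi⟩) ×ₖ V ⟨i, hi⟩)
    with hκdef
  set K : (i : ℕ) → i < n₁ → Fin d → Kernel (Unit × (Fin i → 𝒵 × 𝒲)) (𝒵 × 𝒲) :=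
    fun i hi x => Kernel.prodMkLeft Unit ((Q.QX ⟨i, hi⟩).sectR x ×ₖ V ⟨i, hi⟩) with hKdef
  have hclose := closeDensities_sequentialLaw hε hε1 h2m hm hγ' n₁ K κ
    (fun i hi x => by rw [hKdef]; infer_instance) (fun q i hi => by rw [hκdef]; infer_instance)
    (fun i hi q h => by
      ext S hS
      simp only [hκdef, hKdef, Kernel.prodMkLeft_apply, Kernel.prod_apply, privateView_apply,
        Kernel.sectR_apply, Measure.finsetSum_apply, Measure.smul_apply, smul_eq_mul,
        Measure.prod_apply hS]
      simp [lintegral_finsetSum_measure, lintegral_smul_measure])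
    (fun i hi x x' h S hS => by
      simp only [hKdef, Kernel.prodMkLeft_apply, Kernel.prod_apply, Kernel.sectR_apply,
        Measure.prod_apply hS]
      rw [← smul_eq_mul, ← lintegral_smul_measure]
      refine lintegral_mono' (Measure.le_iff.2 fun T hT => ?_) le_rfl
      rw [Measure.smul_apply, smul_eq_mul]
      exact hQ.1 ⟨i, hi⟩ x x' h.2 T hT)
  have := isMarkovKernel_sequentialLaw (H := Unit) n₁ (κ q₀) (fun i hi => by
    rw [hκdef]; infer_instance)
  set tail := sequentialLaw (n₂ - n₁) (fun j hj => privateView q₀.toMeasure (Q.QYtail ⟨j, hj⟩))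
  have : IsMarkovKernel tail := isMarkovKernel_sequentialLaw (n₂ - n₁)
    (fun j hj => privateView q₀.toMeasure (Q.QYtail ⟨j, hj⟩)) (fun j hj => inferInstance)
  have hlaw : ∀ q, Q.law q q₀ = sequentialLaw n₁ (κ q) () ⊗ₘ tail := fun q => rfl
  have hS : MeasurableSet {ω | φ ω = false} := hφ.1 (measurableSet_singleton false)
  have herr := hclose.le_error_sum tail hS (b := β + 1 / 8) (by positivity) (fun ξ => by
    rw [← hlaw]
    refine le_trans ?_ hlt.le
    refine le_iSup_of_le (signVec h2m hm hγ' ξ) (le_iSup_of_le q₀ (le_iSup_of_le ?_ le_rfl))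
    refine hρ.trans (le_trans ?_ (le_lpDist_pairVec h2m hm _ _ _ hp))
    have : ∑ k, |γ * sgn (ξ k)| = m * γ := by
      simp [abs_mul, abs_sgn, abs_of_nonneg hγ0]
    rw [this]
    gcongr
    rw [mul_comm, mul_div_assoc, div_self hm0.ne', mul_one])
  rw [← hlaw] at herr
  have hlevel := hφ.2 q₀
  have hcompl : Q.law q₀ q₀ {ω | φ ω = true} = 1 - Q.law q₀ q₀ {ω | φ ω = false} := by
    rw [← prob_compl_eq_one_sub hS]
    congr 1
    ext ω
    simp
  have h1 : 1 - α ≤ (Q.law q₀ q₀ {ω | φ ω = false}).toReal := by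
    have h2 := ENNReal.toReal_le_of_le_ofReal hα hlevel
    rw [hcompl, ENNReal.toReal_sub_of_le prob_le_one ENNReal.one_ne_top, ENNReal.toReal_one] at h2
    linarith
  -- The radicand is at most `486 / 200²`. The conclusion `1 - α ≤ β + 1/8 + 1/4` then contradicts
  -- `α + β ≤ 1/2`.
  have hB : √(2 * ((n₁ : ℝ) ^ 2 * (243 * (γ * ε) ^ 2 * (γ * ε / m) ^ 2))) ≤ 1 / 4 := by
    rw [Real.sqrt_le_left (by norm_num)]
    have e1 : (2 * ((n₁ : ℝ) ^ 2 * (243 * (γ * ε) ^ 2 * (γ * ε / m) ^ 2))) =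
        486 * (γ ^ 2 * (n₁ * ε ^ 2) / m) ^ 2 := by field_simp; ring
    have e2 : γ ^ 2 * (n₁ * ε ^ 2) / m ≤ 1 / 200 := by
      rw [div_le_iff₀ hm0]; linarith
    have e3 : 0 ≤ γ ^ 2 * (n₁ * ε ^ 2) / m := by positivity
    rw [e1]
    nlinarith
  linarith

/-- The premise `hne` is essential, as the real infimum of the empty set is `0`; the upper bound on
the risk supplies it. The margin `1/8` makes the error strictly exceed `β`. -/
lemma le_radiusI {n₁ n₂ : ℕ} {ε p α β r : ℝ} (hα : 0 ≤ α) (hβ : 0 ≤ β)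
    (hne : ∃ ρ, 0 < ρ ∧ riskI d n₁ n₂ ε p α ρ ≤ ENNReal.ofReal (α + β))
    (h : ∀ (𝒵 𝒲 : Type) [MeasurableSpace 𝒵] [MeasurableSpace 𝒲] (Q : Interactive d n₁ n₂ 𝒵 𝒲),
      Q.IsLDP ε → ∀ φ, IsLevel Q.law α φ → ∀ ρ ≤ r,
        ENNReal.ofReal (β + 1 / 8) ≤ typeTwoError Q.law p ρ φ) :
    r ≤ radiusI d n₁ n₂ ε p α β := by
  refine le_csInf hne fun ρ hρ => ?_
  by_contra hlt
  push Not at hlt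
  have h1 := hρ.2
  rw [riskI, ENNReal.ofReal_add hα hβ, ENNReal.add_le_add_iff_left ENNReal.ofReal_ne_top] at h1
  have h2 : ENNReal.ofReal (β + 1 / 8) ≤ ENNReal.ofReal β := by
    refine le_trans ?_ h1
    refine le_iInf fun 𝒵 => le_iInf fun 𝒲 => le_iInf fun i1 => le_iInf fun i2 => le_iInf fun Q =>
      le_iInf fun hQ => le_iInf fun φ => le_iInf fun hφ => ?_
    exact h 𝒵 𝒲 Q hQ φ hφ ρ hlt.le
  rw [ENNReal.ofReal_le_ofReal_iff hβ] at h2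
  linarith

lemma le_radiusNI {n₁ n₂ : ℕ} {ε p α β r : ℝ} (hα : 0 ≤ α) (hβ : 0 ≤ β)
    (hne : ∃ ρ, 0 < ρ ∧ riskNI d n₁ n₂ ε p α ρ ≤ ENNReal.ofReal (α + β))
    (h : ∀ (𝒵 𝒲 : Type) [MeasurableSpace 𝒵] [MeasurableSpace 𝒲]
      (Q : NonInteractive d n₁ n₂ 𝒵 𝒲),
      Q.IsLDP ε → ∀ φ, IsLevel Q.law α φ → ∀ ρ ≤ r,
        ENNReal.ofReal (β + 1 / 8) ≤ typeTwoError Q.law p ρ φ) :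
    r ≤ radiusNI d n₁ n₂ ε p α β := by
  refine le_csInf hne fun ρ hρ => ?_
  by_contra hlt
  push Not at hlt
  have h1 := hρ.2
  rw [riskNI, ENNReal.ofReal_add hα hβ, ENNReal.add_le_add_iff_left ENNReal.ofReal_ne_top] at h1
  have h2 : ENNReal.ofReal (β + 1 / 8) ≤ ENNReal.ofReal β := by
    refine le_trans ?_ h1
    refine le_iInf fun 𝒵 => le_iInf fun 𝒲 => le_iInf fun i1 => le_iInf fun i2 => le_iInf fun Q =>
      le_iInf fun hQ => le_iInf fun φ => le_iInf fun hφ => ?_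
    exact h 𝒵 𝒲 Q hQ φ hφ ρ hlt.le
  rw [ENNReal.ofReal_le_ofReal_iff hβ] at h2
  linarith

/-- The interactive lower bound, with the constant `1 / 50`. -/
theorem interactive_lower_bound {n₁ n₂ : ℕ} {ε p α β : ℝ} (hd : 2 ≤ d) (hp : 1 ≤ p) (hp2 : p ≤ 2)
    (hε : 0 < ε) (hε1 : ε ≤ 1) (hα : 0 ≤ α) (hβ : 0 ≤ β) (hαβ : α + β ≤ 1 / 2) (hn : 0 < n₁)
    (hne : ∃ ρ, 0 < ρ ∧ riskI d n₁ n₂ ε p α ρ ≤ ENNReal.ofReal (α + β)) :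
    1 / 50 * min ((d : ℝ) ^ (1 / p - 1 / 2) / √(n₁ * ε ^ 2))
      (if p = 1 ∨ p = 2 then 1 else (d : ℝ) ^ (1 / p - 1)) ≤ radiusI d n₁ n₂ ε p α β := by
  have hn0 : (0 : ℝ) < n₁ := by exact_mod_cast hn
  have hN : 0 < √(n₁ * ε ^ 2) := Real.sqrt_pos.2 (by positivity)
  have hN2 : √(n₁ * ε ^ 2) ^ 2 = n₁ * ε ^ 2 := Real.sq_sqrt (by positivity)
  have hd0 : (0 : ℝ) < d := by positivity
  have main : ∀ m : ℕ, 2 * m ≤ d → 0 < m →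
      (2 * m : ℝ) ^ (1 / p - 1) * min (√m / (15 * √(n₁ * ε ^ 2))) 1 ≤ radiusI d n₁ n₂ ε p α β := by
    intro m h2m hm
    refine le_radiusI hα hβ hne fun 𝒵 𝒲 _ _ Q hQ φ hφ ρ hρ => ?_
    refine ofReal_le_typeTwoError_interactive Q hQ hε.le hε1 hα hβ hαβ hφ h2m hm (by positivity)
      (min_le_right _ _) ?_ hp hρ
    have h1 : (min (√m / (15 * √(n₁ * ε ^ 2))) 1) ^ 2 ≤ (√m / (15 * √(n₁ * ε ^ 2))) ^ 2 :=
      pow_le_pow_left₀ (by positivity) (min_le_left _ _) 2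
    rw [div_pow, mul_pow, hN2, Real.sq_sqrt (by positivity)] at h1
    calc 200 * ((min (√m / (15 * √(n₁ * ε ^ 2))) 1) ^ 2 * (n₁ * ε ^ 2))
        ≤ 200 * ((m : ℝ) / (15 ^ 2 * (n₁ * ε ^ 2)) * (n₁ * ε ^ 2)) := by gcongr
      _ = 200 / 225 * (m : ℝ) := by field_simp; norm_num
      _ ≤ (m : ℝ) := by nlinarith [(Nat.cast_nonneg m : (0 : ℝ) ≤ m)]
  -- For `p = 2` the rate is free of `d`, and a single pair avoids the cap `(2m)^(1/p - 1)` that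
  -- comes from a tilt of size at most `1`. For `p < 2` all `d / 2` pairs are used.
  by_cases hp2' : p = 2
  · refine le_trans ?_ (main 1 (by omega) one_pos)
    subst hp2'
    have e1 : (2 * ((1 : ℕ) : ℝ)) ^ (1 / (2 : ℝ) - 1) = (√2)⁻¹ := by
      rw [Real.sqrt_eq_rpow, ← Real.rpow_neg (by norm_num)]
      norm_num
    rw [e1]
    simp only [sub_self, Real.rpow_zero, or_true, if_true, Nat.cast_one, Real.sqrt_one]
    have e2 : 1 / 2 ≤ (√2)⁻¹ := by
      rw [one_div]
      refine inv_anti₀ (by positivity) ?_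
      rw [Real.sqrt_le_left (by norm_num)]; norm_num
    have e3 : 1 / 15 * min (1 / √(n₁ * ε ^ 2)) 1 ≤ min (1 / (15 * √(n₁ * ε ^ 2))) 1 := by
      refine le_min ?_ ?_
      · calc _ ≤ 1 / 15 * (1 / √(n₁ * ε ^ 2)) := by gcongr; exact min_le_left _ _
          _ = _ := by field_simp
      · have := min_le_right (1 / √(n₁ * ε ^ 2)) 1
        linarith
    have e4 : 0 ≤ min (1 / √(n₁ * ε ^ 2)) 1 := by positivity
    calc 1 / 50 * min (1 / √(n₁ * ε ^ 2)) 1 ≤ 1 / 2 * (1 / 15 * min (1 / √(n₁ * ε ^ 2)) 1) := by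
          linarith
      _ ≤ _ := by gcongr
  · have hm : 0 < d / 2 := by omega
    have h2m : 2 * (d / 2) ≤ d := by omega
    refine le_trans ?_ (main (d / 2) h2m hm)
    set m := d / 2
    have hmd : (d : ℝ) ≤ 3 * m := by
      have : d ≤ 3 * m := by omega
      exact_mod_cast this
    have hr : (if p = 1 ∨ p = 2 then (1 : ℝ) else (d : ℝ) ^ (1 / p - 1)) = (d : ℝ) ^ (1 / p - 1) := by
      split_ifs with h
      · rcases h with h | h
        · rw [h]; norm_num
        · exact absurd h hp2'
      · rfl
    rw [hr]
    have hm0 : (0 : ℝ) < m := by exact_mod_cast hm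
    have e1 : (d : ℝ) ^ (1 / p - 1) ≤ (2 * m : ℝ) ^ (1 / p - 1) := by
      refine Real.rpow_le_rpow_of_nonpos (by positivity) (by exact_mod_cast h2m) ?_
      have : 1 / p ≤ 1 := by rw [div_le_one (by linarith)]; exact hp
      linarith
    have e2 : √d ≤ 2 * √m := by
      rw [Real.sqrt_le_left (by positivity), mul_pow, Real.sq_sqrt (by positivity)]
      linarith
    have e3 : 1 / 50 * min (√d / √(n₁ * ε ^ 2)) 1 ≤ min (√m / (15 * √(n₁ * ε ^ 2))) 1 := by
      refine le_min ?_ ?_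
      · calc _ ≤ 1 / 50 * (√d / √(n₁ * ε ^ 2)) := by gcongr; exact min_le_left _ _
          _ ≤ 1 / 50 * (2 * √m / √(n₁ * ε ^ 2)) := by gcongr
          _ ≤ √m / (15 * √(n₁ * ε ^ 2)) := by
            rw [mul_div_assoc', div_le_div_iff₀ hN (by positivity)]
            have : 0 ≤ √m * √(n₁ * ε ^ 2) := by positivity
            nlinarith
      · have := min_le_right (√d / √(n₁ * ε ^ 2)) 1
        linarith
    have e4 : (d : ℝ) ^ (1 / p - 1 / 2) = (d : ℝ) ^ (1 / p - 1) * √d := by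
      rw [Real.sqrt_eq_rpow, ← Real.rpow_add hd0]; congr 1; ring
    calc _ = (d : ℝ) ^ (1 / p - 1) * (1 / 50 * min (√d / √(n₁ * ε ^ 2)) 1) := by
          rw [mul_left_comm, mul_min_of_nonneg _ _ (by positivity : 0 ≤ (d : ℝ) ^ (1 / p - 1)),
            e4, mul_div_assoc, mul_one]
      _ ≤ _ := by gcongr

end Interactive

end LDPTest

end

noncomputable section

namespace LDPTest

/-! ### A prior adapted to a positive semidefinite form -/

section Prior

variable {m : ℕ}

lemma sum_prod_sign {f : Fin m → Bool → ℝ} :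
    ∑ ξ : Fin m → Bool, ∏ j, f j (ξ j) = ∏ j, (f j true + f j false) := by
  have := Finset.prod_univ_sum (fun _ : Fin m => (Finset.univ : Finset Bool)) f
  simp only [Fintype.piFinset_univ, Fintype.sum_bool] at this
  exact this.symm

/-- Hoeffding's bound for the moment generating function of a Rademacher sum. -/
lemma signAvg_exp_le (a : Fin m → ℝ) :
    signAvg (fun ξ => Real.exp (∑ j, a j * sgn (ξ j))) ≤ Real.exp ((∑ j, a j ^ 2) / 2) := by
  unfold signAvg
  simp only [Real.exp_sum]
  rw [sum_prod_sign (f := fun j b => Real.exp (a j * sgn b)), Finset.sum_div, Real.exp_sum]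
  have h1 : (2 : ℝ) ^ m = ∏ _j : Fin m, (2 : ℝ) := by simp
  rw [h1, ← Finset.prod_div_distrib]
  refine Finset.prod_le_prod (fun j _ => by positivity) fun j _ => ?_
  have := Real.cosh_le_exp_half_sq (a j)
  rw [Real.cosh_eq] at this
  simpa using this

lemma signAvg_add (f g : (Fin m → Bool) → ℝ) :
    signAvg (fun ξ => f ξ + g ξ) = signAvg f + signAvg g := by
  simp [signAvg, Finset.sum_add_distrib, add_div]

lemma signAvg_const_mul (c : ℝ) (f : (Fin m → Bool) → ℝ) :
    signAvg (fun ξ => c * f ξ) = c * signAvg f := by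
  simp [signAvg, ← Finset.mul_sum, mul_div_assoc]

lemma signAvg_sum {ι : Type*} (s : Finset ι) (f : ι → (Fin m → Bool) → ℝ) :
    signAvg (fun ξ => ∑ i ∈ s, f i ξ) = ∑ i ∈ s, signAvg (f i) := by
  simp only [signAvg, ← Finset.sum_div]
  rw [Finset.sum_comm]

/-- Tail bound for a Rademacher sum, as a bound on exponential moments. -/
lemma signAvg_exp_add_exp_neg_le {a : Fin m → ℝ} {γ : ℝ} (ha : ∑ j, a j ^ 2 ≤ γ ^ 2) (t : ℝ) :
    signAvg (fun ξ => Real.exp (t * ∑ j, a j * sgn (ξ j)) + Real.exp (-(t * ∑ j, a j * sgn (ξ j))))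
      ≤ 2 * Real.exp (t ^ 2 * γ ^ 2 / 2) := by
  have key : ∀ s : ℝ, s ^ 2 = t ^ 2 → signAvg (fun ξ => Real.exp (s * ∑ j, a j * sgn (ξ j))) ≤
      Real.exp (t ^ 2 * γ ^ 2 / 2) := by
    intro s hs
    have h := signAvg_exp_le fun j => s * a j
    simp only [mul_assoc, ← Finset.mul_sum, mul_pow, hs] at h
    refine h.trans (Real.exp_le_exp.2 ?_)
    gcongr
  rw [signAvg_add]
  have h1 := key t rfl
  have h2 := key (-t) (by ring)
  simp only [neg_mul] at h2
  linarith

/-- An orthonormal eigenbasis in coordinates. -/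
lemma exists_eigenbasis {B : Matrix (Fin m) (Fin m) ℝ} (hB : B.PosSemidef) :
    ∃ (v : Fin m → Fin m → ℝ) (lam : Fin m → ℝ), (∀ j, 0 ≤ lam j) ∧ ∑ j, lam j = B.trace ∧
      (∀ k, ∑ j, v j k ^ 2 = 1) ∧
      (∀ j l, ∑ k, v j k * v l k = if j = l then 1 else 0) ∧
      ∀ j l, ∑ k, ∑ k', v j k * B k k' * v l k' = if j = l then lam j else 0 := by
  have hH := hB.1
  set U : Matrix (Fin m) (Fin m) ℝ := (hH.eigenvectorUnitary : Matrix (Fin m) (Fin m) ℝ) with hU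
  have hUU : star U * U = 1 := Unitary.coe_star_mul_self _
  have hUU' : U * star U = 1 := Unitary.coe_mul_star_self _
  have hspec : star U * B * U = Matrix.diagonal hH.eigenvalues := by
    have := hH.conjStarAlgAut_star_eigenvectorUnitary
    simpa [Unitary.conjStarAlgAut_apply, Function.comp_def] using this
  refine ⟨fun j k => U k j, hH.eigenvalues, hB.eigenvalues_nonneg, ?_, fun k => ?_, fun j l => ?_,
    fun j l => ?_⟩
  · have := hH.trace_eq_sum_eigenvalues
    simpa using this.symm
  · have := congrFun (congrFun hUU' k) k
    simp only [Matrix.mul_apply, Matrix.star_apply, star_trivial, Matrix.one_apply_eq] at this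
    simpa [pow_two] using this
  · have := congrFun (congrFun hUU j) l
    simpa only [Matrix.mul_apply, Matrix.star_apply, star_trivial, Matrix.one_apply] using this
  · have := congrFun (congrFun hspec j) l
    simp only [Matrix.mul_apply, Matrix.star_apply, star_trivial, Matrix.diagonal_apply,
      Finset.sum_mul] at this
    rw [Finset.sum_comm]
    exact this

/-- Interpolation between first and fourth powers: a vector with large `ℓ₂` norm and controlled `ℓ₄`
norm has a large `ℓ₁` norm. -/
lemma sq_le_mul_abs_add {y t : ℝ} (ht : 0 < t) : y ^ 2 ≤ t * |y| + y ^ 4 / t ^ 2 := by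
  rcases le_total |y| t with h | h
  · have h1 : y ^ 2 ≤ t * |y| := by
      rw [← sq_abs, pow_two]; gcongr
    have h2 : 0 ≤ y ^ 4 / t ^ 2 := by positivity
    linarith
  · have h1 : y ^ 2 ≤ y ^ 4 / t ^ 2 := by
      rw [le_div_iff₀ (by positivity)]
      have : t ^ 2 ≤ y ^ 2 := by rw [← sq_abs y]; gcongr
      nlinarith [sq_nonneg y]
    have h2 : 0 ≤ t * |y| := by positivity
    linarith

lemma pow_four_le_exp (x : ℝ) : x ^ 4 ≤ 24 * (Real.exp x + Real.exp (-x)) := by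
  have h : ∀ y : ℝ, 0 ≤ y → y ^ 4 ≤ 24 * Real.exp y := fun y hy => by
    have := Real.pow_div_factorial_le_exp y hy 4
    rw [div_le_iff₀ (by positivity)] at this
    norm_num [Nat.factorial] at this
    linarith
  rcases le_total 0 x with hx | hx
  · have := h x hx
    have := Real.exp_pos (-x)
    linarith
  · have h1 := h (-x) (by linarith)
    have h2 := Real.exp_pos x
    rw [show (-x) ^ 4 = x ^ 4 by ring] at h1
    linarith

/-- Given a quadratic form `B`, there are random tilts that are nearly uncorrelated under `B`, and
with high probability bounded by `1` and of large `ℓ₁` norm. -/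
lemma exists_prior (hm : 0 < m) {B : Matrix (Fin m) (Fin m) ℝ} (hB : B.PosSemidef) {T γ : ℝ}
    (hT : 0 < T) (htr : B.trace ≤ T * m) (hγ : 0 < γ) (hγT : 8 * (γ ^ 4 * T ^ 2) ≤ m ^ 3)
    (hγm : 128 * m ≤ Real.exp (1 / (2 * γ ^ 2))) :
    ∃ (η : (Fin m → Bool) → Fin m → ℝ) (G : Finset (Fin m → Bool)),
      (∀ ξ ∈ G, ∀ k, |η ξ k| ≤ 1) ∧ (∀ ξ ∈ G, γ * m / 576 ≤ ∑ k, |η ξ k|) ∧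
      1 - 1 / 32 ≤ (G.card : ℝ) / 2 ^ m ∧
      signAvg (fun ξ => signAvg fun ξ' => Real.exp ((∑ k, ∑ k', η ξ k * B k k' * η ξ' k') /
        (2 * m) ^ 2)) ≤ 1 + 1 / 32 := by
  classical
  obtain ⟨v, lam, hlam, hsum, hv1, hv2, hv3⟩ := exists_eigenbasis hB
  have hm0 : (0 : ℝ) < m := by exact_mod_cast hm
  set J : Finset (Fin m) := Finset.univ.filter fun j => lam j ≤ 2 * T with hJ
  set χ : Fin m → ℝ := fun j => if lam j ≤ 2 * T then 1 else 0 with hχ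
  have hχ01 : ∀ j, 0 ≤ χ j ∧ χ j ≤ 1 := fun j => by rw [hχ]; simp only; split_ifs <;> norm_num
  have hχsq : ∀ j, χ j ^ 2 = χ j := fun j => by rw [hχ]; simp only; split_ifs <;> norm_num
  -- Markov's inequality for the eigenvalues: their mean is at most `T`, so at most half of them
  -- exceed `2 * T`.
  have hχsum : (m : ℝ) / 2 ≤ ∑ j, χ j := by
    have h1 : ∀ j, 1 - χ j ≤ lam j / (2 * T) := fun j => by
      rw [hχ]; simp only
      split_ifs with h
      · have := hlam j; simp only [sub_self]; positivity
      · rw [le_div_iff₀ (by positivity)]; push Not at h; linarith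
    have h2 := Finset.sum_le_sum fun j (_ : j ∈ Finset.univ) => h1 j
    rw [Finset.sum_sub_distrib, ← Finset.sum_div, hsum] at h2
    simp only [Finset.sum_const, Finset.card_univ, Fintype.card_fin, nsmul_eq_mul, mul_one] at h2
    have h3 : B.trace / (2 * T) ≤ m / 2 := by
      rw [div_le_iff₀ (by positivity)]; linarith
    linarith
  -- The tilt is `γ` times the sum of the retained eigenvectors with independent signs.
  set a : Fin m → Fin m → ℝ := fun k j => γ * χ j * v j k with ha
  set η : (Fin m → Bool) → Fin m → ℝ := fun ξ k => ∑ j, a k j * sgn (ξ j) with hη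
  have ha2 : ∀ k, ∑ j, a k j ^ 2 ≤ γ ^ 2 := fun k => by
    calc ∑ j, a k j ^ 2 ≤ ∑ j, γ ^ 2 * v j k ^ 2 := Finset.sum_le_sum fun j _ => by
          rw [ha]; simp only; rw [mul_pow, mul_pow, hχsq]
          have := (hχ01 j).2
          have h0 : 0 ≤ γ ^ 2 * v j k ^ 2 := by positivity
          nlinarith
      _ = γ ^ 2 := by rw [← Finset.mul_sum, hv1, mul_one]
  -- By orthonormality the `ℓ₂` norm of the tilt does not depend on the signs.
  have hη2 : ∀ ξ, ∑ k, η ξ k ^ 2 = γ ^ 2 * ∑ j, χ j := by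
    intro ξ
    have e1 : ∀ k, η ξ k ^ 2 = ∑ j, ∑ l, (γ ^ 2 * (χ j * sgn (ξ j)) * (χ l * sgn (ξ l))) *
        (v j k * v l k) := fun k => by
      rw [hη]; simp only
      rw [pow_two, Finset.sum_mul_sum]
      refine Finset.sum_congr rfl fun j _ => Finset.sum_congr rfl fun l _ => ?_
      rw [ha]; ring
    simp only [e1]
    rw [Finset.sum_comm, Finset.mul_sum]
    refine Finset.sum_congr rfl fun j _ => ?_
    rw [Finset.sum_comm]
    simp only [← Finset.mul_sum, hv2]
    simp only [mul_ite, mul_one, mul_zero, Finset.sum_ite_eq, Finset.mem_univ, if_true]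
    calc _ = γ ^ 2 * χ j ^ 2 * (sgn (ξ j) * sgn (ξ j)) := by ring
      _ = _ := by rw [sgn_mul_self, hχsq, mul_one]
  have hquad : ∀ ξ ξ', ∑ k, ∑ k', η ξ k * B k k' * η ξ' k' =
      ∑ j, (γ ^ 2 * χ j * lam j * sgn (ξ j)) * sgn (ξ' j) := by
    intro ξ ξ'
    have e1 : ∀ k k', η ξ k * B k k' * η ξ' k' = ∑ j, ∑ l,
        (γ ^ 2 * (χ j * sgn (ξ j)) * (χ l * sgn (ξ' l))) * (v j k * B k k' * v l k') := by
      intro k k'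
      rw [hη]; simp only
      rw [Finset.sum_mul, Finset.sum_mul_sum]
      refine Finset.sum_congr rfl fun j _ => Finset.sum_congr rfl fun l _ => ?_
      rw [ha]; ring
    simp only [e1]
    have e2 : ∀ k, ∑ k', ∑ j, ∑ l, (γ ^ 2 * (χ j * sgn (ξ j)) * (χ l * sgn (ξ' l))) *
        (v j k * B k k' * v l k') = ∑ j, ∑ l, (γ ^ 2 * (χ j * sgn (ξ j)) * (χ l * sgn (ξ' l))) *
          ∑ k', v j k * B k k' * v l k' := fun k => by
      rw [Finset.sum_comm]
      refine Finset.sum_congr rfl fun j _ => ?_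
      rw [Finset.sum_comm]
      exact Finset.sum_congr rfl fun l _ => by rw [Finset.mul_sum]
    simp only [e2]
    rw [Finset.sum_comm]
    refine Finset.sum_congr rfl fun j _ => ?_
    rw [Finset.sum_comm]
    simp only [← Finset.mul_sum, hv3]
    simp only [mul_ite, mul_zero, Finset.sum_ite_eq, Finset.mem_univ, if_true]
    calc _ = γ ^ 2 * χ j ^ 2 * lam j * sgn (ξ j) * sgn (ξ' j) := by ring
      _ = _ := by rw [hχsq]
  set G : Finset (Fin m → Bool) := Finset.univ.filter fun ξ =>
    (∀ k, |η ξ k| ≤ 1) ∧ ∑ k, η ξ k ^ 4 ≤ 5120 * γ ^ 4 * m with hG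
  refine ⟨η, G, fun ξ hξ => (Finset.mem_filter.1 hξ).2.1, fun ξ hξ => ?_, ?_, ?_⟩
  · have h4 := (Finset.mem_filter.1 hξ).2.2
    -- With this threshold the fourth-power term is at most `γ² m / 4`, half of the lower bound `γ²
    -- m / 2` on the squared `ℓ₂` norm, because `5120 / 144² < 1/4`.
    have ht : 0 < 144 * γ := by positivity
    have h1 := Finset.sum_le_sum fun k (_ : k ∈ Finset.univ) => sq_le_mul_abs_add (y := η ξ k) ht
    rw [Finset.sum_add_distrib, ← Finset.mul_sum, ← Finset.sum_div, hη2] at h1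
    have h2 : (∑ k, η ξ k ^ 4) / (144 * γ) ^ 2 ≤ γ ^ 2 * m / 4 := by
      rw [div_le_iff₀ (by positivity)]
      refine h4.trans ?_
      have : 0 ≤ γ ^ 4 * m := by positivity
      nlinarith
    have h3 : γ ^ 2 * (m / 2) ≤ γ ^ 2 * ∑ j, χ j := by gcongr
    have h5 : γ * (γ * m / 4) ≤ γ * (144 * ∑ k, |η ξ k|) := by nlinarith
    have h6 := le_of_mul_le_mul_left h5 hγ
    linarith
  -- A pointwise Chernoff bound for the complement of `G`. The first sum covers a coordinate above
  -- `1`, with the optimal exponent `1 / γ²`; the second covers a large fourth moment. Each averages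
  -- to at most `1/64`.
  · have hpt : ∀ ξ, 1 - (if ξ ∈ G then (1 : ℝ) else 0) ≤
        ∑ k, Real.exp (-(1 / γ ^ 2)) * (Real.exp (1 / γ ^ 2 * η ξ k) +
          Real.exp (-(1 / γ ^ 2 * η ξ k))) +
        ∑ k, 1 / (5120 * m) * (24 * (Real.exp (1 / γ * η ξ k) + Real.exp (-(1 / γ * η ξ k)))) := by
      intro ξ
      have hp1 : ∀ k, 0 ≤ Real.exp (-(1 / γ ^ 2)) * (Real.exp (1 / γ ^ 2 * η ξ k) +
          Real.exp (-(1 / γ ^ 2 * η ξ k))) := fun k => by positivity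
      have hp2 : ∀ k, 0 ≤ 1 / (5120 * (m : ℝ)) * (24 * (Real.exp (1 / γ * η ξ k) +
        Real.exp (-(1 / γ * η ξ k)))) := fun k => by positivity
      have hs1 := Finset.sum_nonneg fun k (_ : k ∈ Finset.univ) => hp1 k
      have hs2 := Finset.sum_nonneg fun k (_ : k ∈ Finset.univ) => hp2 k
      by_cases hξ : ξ ∈ G
      · rw [if_pos hξ]; linarith
      · rw [if_neg hξ, sub_zero]
        rw [hG, Finset.mem_filter, not_and_or, not_and_or] at hξ
        rcases hξ with h | h | h
        · exact absurd (Finset.mem_univ _) h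
        · push Not at h
          obtain ⟨k, hk⟩ := h
          have h1 := Finset.single_le_sum (fun k _ => hp1 k) (Finset.mem_univ k)
          have h2 : 1 ≤ Real.exp (-(1 / γ ^ 2)) * (Real.exp (1 / γ ^ 2 * η ξ k) +
              Real.exp (-(1 / γ ^ 2 * η ξ k))) := by
            have h3 : Real.exp (1 / γ ^ 2) ≤ Real.exp (1 / γ ^ 2 * η ξ k) +
                Real.exp (-(1 / γ ^ 2 * η ξ k)) := by
              have hg : 0 < 1 / γ ^ 2 := by positivity
              rcases lt_abs.1 hk with h | h
              · have : Real.exp (1 / γ ^ 2) ≤ Real.exp (1 / γ ^ 2 * η ξ k) :=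
                  Real.exp_le_exp.2 (by nlinarith)
                have := Real.exp_pos (-(1 / γ ^ 2 * η ξ k))
                linarith
              · have : Real.exp (1 / γ ^ 2) ≤ Real.exp (-(1 / γ ^ 2 * η ξ k)) :=
                  Real.exp_le_exp.2 (by nlinarith)
                have := Real.exp_pos (1 / γ ^ 2 * η ξ k)
                linarith
            calc (1 : ℝ) = Real.exp (-(1 / γ ^ 2)) * Real.exp (1 / γ ^ 2) := by
                  rw [← Real.exp_add]; simp
              _ ≤ _ := by gcongr
          linarith
        · push Not at h
          have h1 : ∑ k, η ξ k ^ 4 ≤ ∑ k, γ ^ 4 * (24 * (Real.exp (1 / γ * η ξ k) +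
              Real.exp (-(1 / γ * η ξ k)))) := Finset.sum_le_sum fun k _ => by
            have := pow_four_le_exp (1 / γ * η ξ k)
            calc η ξ k ^ 4 = γ ^ 4 * (1 / γ * η ξ k) ^ 4 := by field_simp
              _ ≤ _ := by gcongr
          rw [← Finset.mul_sum] at h1 ⊢
          rw [← Finset.mul_sum] at hs2 ⊢
          have h2 : 5120 * m * γ ^ 4 < γ ^ 4 * ∑ k, 24 * (Real.exp (1 / γ * η ξ k) +
              Real.exp (-(1 / γ * η ξ k))) := by linarith
          have h3 : 5120 * m < ∑ k, 24 * (Real.exp (1 / γ * η ξ k) +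
              Real.exp (-(1 / γ * η ξ k))) := by
            have hg : 0 < γ ^ 4 := by positivity
            refine lt_of_mul_lt_mul_left ?_ hg.le
            linarith
          have h4 : 1 ≤ 1 / (5120 * (m : ℝ)) * ∑ k, 24 * (Real.exp (1 / γ * η ξ k) +
              Real.exp (-(1 / γ * η ξ k))) := by
            rw [one_div, inv_mul_eq_div, le_div_iff₀ (by positivity), one_mul]; exact h3.le
          rw [← Finset.mul_sum] at hs1
          linarith
    have havg := signAvg_mono hpt
    have hl : signAvg (fun ξ => 1 - (if ξ ∈ G then (1 : ℝ) else 0)) = 1 - G.card / 2 ^ m := by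
      simp [signAvg, sub_div]
    rw [hl, signAvg_add, signAvg_sum, signAvg_sum] at havg
    simp only [signAvg_const_mul] at havg
    have hb1 : ∀ k, Real.exp (-(1 / γ ^ 2)) * signAvg (fun ξ => Real.exp (1 / γ ^ 2 * η ξ k) +
        Real.exp (-(1 / γ ^ 2 * η ξ k))) ≤ 1 / (64 * m) := fun k => by
      have h1 := signAvg_exp_add_exp_neg_le (ha2 k) (1 / γ ^ 2)
      calc _ ≤ Real.exp (-(1 / γ ^ 2)) * (2 * Real.exp ((1 / γ ^ 2) ^ 2 * γ ^ 2 / 2)) := by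
            gcongr
        _ = 2 * (Real.exp (1 / (2 * γ ^ 2)))⁻¹ := by
            rw [mul_left_comm, ← Real.exp_add, ← Real.exp_neg]
            congr 2; field_simp; ring
        _ ≤ 2 * (128 * (m : ℝ))⁻¹ := by gcongr
        _ = _ := by field_simp; norm_num
    have hb2 : ∀ k, 1 / (5120 * (m : ℝ)) * (24 * signAvg (fun ξ => Real.exp (1 / γ * η ξ k) +
        Real.exp (-(1 / γ * η ξ k)))) ≤ 1 / (64 * m) := fun k => by
      have h1 := signAvg_exp_add_exp_neg_le (ha2 k) (1 / γ)
      have h2 : Real.exp ((1 / γ) ^ 2 * γ ^ 2 / 2) ≤ 5 / 3 := by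
        rw [show (1 / γ) ^ 2 * γ ^ 2 / 2 = 1 / 2 by field_simp]
        have e1 : Real.exp (1 / 2) ^ 2 = Real.exp 1 := by rw [← Real.exp_nat_mul]; norm_num
        nlinarith [Real.exp_one_lt_d9, Real.exp_pos (1 / 2)]
      calc _ ≤ 1 / (5120 * (m : ℝ)) * (24 * (2 * (5 / 3))) := by
            have := h1.trans (mul_le_mul_of_nonneg_left h2 (by norm_num : (0 : ℝ) ≤ 2))
            gcongr
        _ = _ := by field_simp; norm_num
    have h1 : ∑ k, Real.exp (-(1 / γ ^ 2)) * signAvg (fun ξ => Real.exp (1 / γ ^ 2 * η ξ k) +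
        Real.exp (-(1 / γ ^ 2 * η ξ k))) ≤ 1 / 64 := by
      calc _ ≤ ∑ _k : Fin m, 1 / (64 * (m : ℝ)) := Finset.sum_le_sum fun k _ => hb1 k
        _ = _ := by simp; field_simp
    have h2 : ∑ k, 1 / (5120 * (m : ℝ)) * (24 * signAvg (fun ξ => Real.exp (1 / γ * η ξ k) +
        Real.exp (-(1 / γ * η ξ k)))) ≤ 1 / 64 := by
      calc _ ≤ ∑ _k : Fin m, 1 / (64 * (m : ℝ)) := Finset.sum_le_sum fun k _ => hb2 k
        _ = _ := by simp; field_simp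
    linarith
  -- For fixed `ξ` the exponent is a Rademacher sum in `ξ'`, so Hoeffding's bound applies uniformly
  -- in `ξ`.
  · have hin : ∀ ξ, signAvg (fun ξ' => Real.exp ((∑ k, ∑ k', η ξ k * B k k' * η ξ' k') /
        (2 * m) ^ 2)) ≤ 1 + 1 / 32 := by
      intro ξ
      have h1 := signAvg_exp_le fun j => γ ^ 2 * χ j * lam j * sgn (ξ j) / (2 * m) ^ 2
      simp only [hquad, Finset.sum_div]
      have e1 : ∀ ξ' : Fin m → Bool, ∑ j, (γ ^ 2 * χ j * lam j * sgn (ξ j)) * sgn (ξ' j) /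
          (2 * m) ^ 2 = ∑ j, γ ^ 2 * χ j * lam j * sgn (ξ j) / (2 * m) ^ 2 * sgn (ξ' j) :=
        fun ξ' => Finset.sum_congr rfl fun j _ => by ring
      simp only [e1]
      refine h1.trans ?_
      have h2 : (∑ j, (γ ^ 2 * χ j * lam j * sgn (ξ j) / (2 * m) ^ 2) ^ 2) / 2 ≤ 1 / 64 := by
        have h3 : ∀ j, (γ ^ 2 * χ j * lam j * sgn (ξ j) / (2 * m) ^ 2) ^ 2 ≤
            γ ^ 4 * (2 * T) ^ 2 / (2 * (m : ℝ)) ^ 4 := fun j => by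
          have h4 : χ j * lam j ≤ 2 * T := by
            rw [hχ]; simp only
            split_ifs with h
            · linarith
            · simp; positivity
          have h5 : 0 ≤ χ j * lam j := mul_nonneg (hχ01 j).1 (hlam j)
          calc _ = γ ^ 4 * (χ j * lam j) ^ 2 * sgn (ξ j) ^ 2 / (2 * (m : ℝ)) ^ 4 := by
                rw [div_pow]; congr 1 <;> ring
            _ ≤ _ := by rw [sgn_sq, mul_one]; gcongr
        calc _ ≤ (∑ _j : Fin m, γ ^ 4 * (2 * T) ^ 2 / (2 * (m : ℝ)) ^ 4) / 2 := by
              gcongr with j _; exact h3 j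
          _ = (γ ^ 4 * T ^ 2) / (8 * m ^ 3) := by
              simp only [Finset.sum_const, Finset.card_univ, Fintype.card_fin, nsmul_eq_mul]
              field_simp; norm_num
          _ ≤ _ := by
              rw [div_le_div_iff₀ (by positivity) (by norm_num)]; linarith
      have h6 : Real.exp (1 / 64 : ℝ) ≤ 1 + 1 / 32 := by
        have := (abs_le.1 (Real.abs_exp_sub_one_sub_id_le (x := (1 / 64 : ℝ))
          (by rw [abs_of_pos] <;> norm_num))).2
        linarith
      exact (Real.exp_le_exp.2 h2).trans h6
    exact (signAvg_mono hin).trans (signAvg_const (m := m) _).le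

end Prior

end LDPTest

end

noncomputable section

namespace LDPTest

/-! ### The non-interactive lower bound. -/

section NonInteractive

variable {d m : ℕ}

lemma toReal_withDensity_ofReal {Ω : Type*} [MeasurableSpace Ω] (ν : Measure Ω) {g : Ω → ℝ}
    (hg : Measurable g) (hg0 : ∀ ω, 0 ≤ g ω) {S : Set Ω} (hS : MeasurableSet S) :
    ((ν.withDensity fun ω => ENNReal.ofReal (g ω)) S).toReal = ∫ ω in S, g ω ∂ν := by
  rw [withDensity_apply _ hS, integral_eq_lintegral_of_nonneg_ae
    (Filter.Eventually.of_forall hg0) hg.aestronglyMeasurable]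

/-- The density of a product of measures with densities. -/
lemma pi_withDensity_ofReal {ι 𝒵 : Type*} [Fintype ι] [MeasurableSpace 𝒵] (ν : ι → Measure 𝒵)
    [∀ i, IsFiniteMeasure (ν i)] {g : ι → 𝒵 → ℝ} (hg : ∀ i, Measurable (g i))
    (hg0 : ∀ i z, 0 ≤ g i z) {C : ℝ} (hC : ∀ i z, g i z ≤ C) :
    Measure.pi (fun i => (ν i).withDensity fun z => ENNReal.ofReal (g i z)) =
      (Measure.pi ν).withDensity fun z => ENNReal.ofReal (∏ i, g i (z i)) := by
  have hfin : ∀ i, IsFiniteMeasure ((ν i).withDensity fun z => ENNReal.ofReal (g i z)) := fun i =>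
    isFiniteMeasure_withDensity_ofReal (integrable_of_bounded (ν i) (hg i) (C := C) fun z => by
      rw [abs_of_nonneg (hg0 i z)]; exact hC i z).2
  have hm : Measurable fun z : ι → 𝒵 => ∏ i, g i (z i) :=
    Finset.measurable_prod _ fun i _ => (hg i).comp (measurable_pi_apply i)
  have hp0 : ∀ z : ι → 𝒵, 0 ≤ ∏ i, g i (z i) := fun z => Finset.prod_nonneg fun i _ => hg0 i _
  have hfin' : IsFiniteMeasure ((Measure.pi ν).withDensity fun z =>
      ENNReal.ofReal (∏ i, g i (z i))) :=
    isFiniteMeasure_withDensity_ofReal (integrable_of_bounded _ hm (C := ∏ _i : ι, C) fun z => by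
      rw [abs_of_nonneg (hp0 z)]
      exact Finset.prod_le_prod (fun i _ => hg0 i _) fun i _ => hC i _).2
  refine Measure.pi_eq fun s hs => ?_
  have hbox : MeasurableSet (Set.univ.pi s) := MeasurableSet.univ_pi hs
  rw [← ENNReal.toReal_eq_toReal_iff' (measure_ne_top _ _)
    (ENNReal.prod_ne_top fun i _ => measure_ne_top _ _), ENNReal.toReal_prod,
    toReal_withDensity_ofReal _ hm hp0 hbox]
  simp only [toReal_withDensity_ofReal _ (hg _) (hg0 _) (hs _)]
  rw [← integral_indicator hbox]
  have : ∀ z : ι → 𝒵, (Set.univ.pi s).indicator (fun z => ∏ i, g i (z i)) z =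
      ∏ i, (s i).indicator (g i) (z i) := by
    intro z
    by_cases hz : z ∈ Set.univ.pi s
    · rw [Set.indicator_of_mem hz]
      exact Finset.prod_congr rfl fun i _ =>
        (Set.indicator_of_mem (hz i (Set.mem_univ i)) _).symm
    · rw [Set.indicator_of_notMem hz]
      simp only [Set.mem_univ_pi, not_forall] at hz
      obtain ⟨i, hi⟩ := hz
      exact (Finset.prod_eq_zero (Finset.mem_univ i) (Set.indicator_of_notMem hi _)).symm
  simp only [this]
  rw [integral_fintype_prod_eq_prod (fun i => (s i).indicator (g i))]
  exact Finset.prod_congr rfl fun i _ => integral_indicator (hs i)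

/-- The total error of a test of a non-interactive mechanism. -/
lemma ofReal_le_typeTwoError_nonInteractive {n₁ n₂ : ℕ} {𝒵 𝒲 : Type} [MeasurableSpace 𝒵]
    [MeasurableSpace 𝒲] (Q : NonInteractive d n₁ n₂ 𝒵 𝒲) {ε : ℝ} (hQ : Q.IsLDP ε) (hε : 0 < ε)
    (hε1 : ε ≤ 1) (hn : 0 < n₁) {α β : ℝ} (hα : 0 ≤ α) (hβ : 0 ≤ β) (hαβ : α + β ≤ 1 / 2)
    {φ : (Fin n₁ → 𝒵) × (Fin n₂ → 𝒲) → Bool} (hφ : IsLevel Q.law α φ)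
    (h2m : 2 * m ≤ d) (hm : 0 < m) {γ : ℝ} (hγ : 0 < γ)
    (hγT : 8 * (γ ^ 4 * (9 * (n₁ * ε ^ 2)) ^ 2) ≤ m ^ 3)
    (hγm : 128 * m ≤ Real.exp (1 / (2 * γ ^ 2))) {p ρ : ℝ} (hp : 1 ≤ p)
    (hρ : ρ ≤ (2 * m : ℝ) ^ (1 / p - 1) * (γ / 576)) :
    ENNReal.ofReal (β + 1 / 8) ≤ typeTwoError Q.law p ρ φ := by
  classical
  by_contra hlt
  push Not at hlt
  have hm0 : (0 : ℝ) < m := by exact_mod_cast hm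
  have hn0 : (0 : ℝ) < n₁ := by exact_mod_cast hn
  have := Q.markovX
  have := Q.markovY
  set q₀ := nullVec h2m hm with hq₀
  have hdens := fun i => exists_mixture_densities (fun x => Q.QX i x) hε.le
    (fun x x' S hS => hQ.1 i x x' S hS) q₀
  simp only [← bind_toMeasure] at hdens
  choose r hr hr1 hr2 hr3 using hdens
  set ν : Fin n₁ → Measure 𝒵 := fun i => Q.QX i ∘ₘ q₀.toMeasure with hν
  set D : Fin n₁ → Fin m → 𝒵 → ℝ :=
    fun i k z => r i (pairIdx h2m (k, true)) z - r i (pairIdx h2m (k, false)) z with hD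
  have hDb : ∀ i k z, |D i k z| ≤ 3 * ε := fun i k z =>
    abs_sub_le_of_exp_bounds hε.le hε1 (hr1 _ _ _) (hr2 _ _ _) (hr1 _ _ _) (hr2 _ _ _)
  have hDm : ∀ i k, Measurable (D i k) := fun i k => (hr i _).sub (hr i _)
  have hDDi : ∀ i k l, Integrable (fun z => D i k z * D i l z) (ν i) := fun i k l =>
    integrable_of_bounded _ ((hDm i k).mul (hDm i l)) (C := 3 * ε * (3 * ε)) fun z => by
      rw [abs_mul]
      exact mul_le_mul (hDb i k z) (hDb i l z) (abs_nonneg _) (by positivity)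
  set B : Matrix (Fin m) (Fin m) ℝ := Matrix.of fun k l => ∑ i, ∫ z, D i k z * D i l z ∂ν i with hB
  have hquad : ∀ (u w : Fin m → ℝ), ∑ k, ∑ l, u k * B k l * w l =
      ∑ i, ∫ z, (∑ k, u k * D i k z) * (∑ l, w l * D i l z) ∂ν i := by
    intro u w
    have e1 : ∀ i, ∫ z, (∑ k, u k * D i k z) * (∑ l, w l * D i l z) ∂ν i =
        ∑ k, ∑ l, u k * w l * ∫ z, D i k z * D i l z ∂ν i := fun i => by
      have e2 : ∀ z, (∑ k, u k * D i k z) * (∑ l, w l * D i l z) =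
          ∑ k, ∑ l, u k * w l * (D i k z * D i l z) := fun z => by
        rw [Finset.sum_mul_sum]
        exact Finset.sum_congr rfl fun k _ => Finset.sum_congr rfl fun l _ => by ring
      simp only [e2]
      rw [integral_finsetSum _ fun k _ => integrable_finsetSum _ fun l _ =>
        (hDDi i k l).const_mul _]
      refine Finset.sum_congr rfl fun k _ => ?_
      rw [integral_finsetSum _ fun l _ => (hDDi i k l).const_mul _]
      exact Finset.sum_congr rfl fun l _ => integral_const_mul _ _
    simp only [e1, hB, Matrix.of_apply]
    rw [Finset.sum_comm]
    have e3 : ∀ k l, u k * (∑ i, ∫ z, D i k z * D i l z ∂ν i) * w l =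
        ∑ i, u k * w l * ∫ z, D i k z * D i l z ∂ν i := fun k l => by
      rw [← Finset.mul_sum]; ring
    simp only [e3]
    rw [Finset.sum_comm]
    conv_rhs => rw [Finset.sum_comm]
    exact Finset.sum_congr rfl fun k _ => by rw [Finset.sum_comm]
  have hpsd : B.PosSemidef := by
    refine Matrix.PosSemidef.of_dotProduct_mulVec_nonneg ?_ fun x => ?_
    · ext k l
      simp only [hB, Matrix.conjTranspose_apply, Matrix.of_apply, star_trivial, mul_comm]
    · have : star x ⬝ᵥ B.mulVec x = ∑ k, ∑ l, x k * B k l * x l := by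
        simp only [dotProduct, Matrix.mulVec, Finset.mul_sum, star_trivial, Pi.star_apply, mul_assoc]
      rw [this, hquad]
      exact Finset.sum_nonneg fun i _ => integral_nonneg fun z => mul_self_nonneg _
  have htr : B.trace ≤ 9 * (n₁ * ε ^ 2) * m := by
    simp only [Matrix.trace, Matrix.diag_apply, hB, Matrix.of_apply]
    have h1 : ∀ k i, ∫ z, D i k z * D i k z ∂ν i ≤ 9 * ε ^ 2 := fun k i => by
      calc _ ≤ ∫ _z, 9 * ε ^ 2 ∂ν i := integral_mono (hDDi i k k) (integrable_const _) fun z => by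
            have := abs_le.1 (hDb i k z)
            simp only
            nlinarith
        _ = _ := by simp
    calc _ ≤ ∑ _k : Fin m, ∑ _i : Fin n₁, 9 * ε ^ 2 :=
          Finset.sum_le_sum fun k _ => Finset.sum_le_sum fun i _ => h1 k i
      _ = _ := by
          simp only [Finset.sum_const, Finset.card_univ, Fintype.card_fin, nsmul_eq_mul]; ring
  obtain ⟨η₀, G, hG1, hG2, hG3, hG4⟩ := exists_prior hm hpsd (by positivity) htr hγ hγT hγm
  -- Zero off `G`, so that every sign vector yields a probability vector; the mixture below runs
  -- over `G` only.
  set η : (Fin m → Bool) → Fin m → ℝ := fun ξ => if ξ ∈ G then η₀ ξ else 0 with hη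
  have hηb : ∀ ξ k, |η ξ k| ≤ 1 := fun ξ k => by
    rw [hη]; simp only
    split_ifs with h
    · exact hG1 ξ h k
    · simp
  set q : (Fin m → Bool) → ProbVec d := fun ξ => pairVec h2m hm (η ξ) (hηb ξ) with hq
  set g : (Fin m → Bool) → Fin n₁ → 𝒵 → ℝ := fun ξ i z => ∑ x, (q ξ).1 x * r i x z with hg
  have hgm : ∀ ξ i, Measurable (g ξ i) := fun ξ i =>
    Finset.measurable_sum _ fun x _ => (hr i x).const_mul _
  have hg0 : ∀ ξ i z, 0 ≤ g ξ i z := fun ξ i z => Finset.sum_nonneg fun x _ =>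
    mul_nonneg ((q ξ).2.1 x) ((Real.exp_pos _).le.trans (hr1 i x z))
  have hgu : ∀ ξ i z, g ξ i z ≤ Real.exp ε := fun ξ i z =>
    (sum_probVec_mul_mem (fun x => hr1 i x z) fun x => hr2 i x z).2
  have hgabs : ∀ ξ i z, |g ξ i z| ≤ Real.exp ε := fun ξ i z => by
    rw [abs_of_nonneg (hg0 ξ i z)]; exact hgu ξ i z
  have hgi : ∀ ξ i, Integrable (g ξ i) (ν i) := fun ξ i =>
    integrable_of_bounded _ (hgm ξ i) (hgabs ξ i)
  have hden : ∀ ξ i, Q.QX i ∘ₘ (q ξ).toMeasure =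
      (ν i).withDensity fun z => ENNReal.ofReal (g ξ i z) := fun ξ i => hr3 i (q ξ)
  have hgint : ∀ ξ i, ∫ z, g ξ i z ∂ν i = 1 := fun ξ i => by
    have h1 := toReal_withDensity_ofReal (ν i) (hgm ξ i) (hg0 ξ i) MeasurableSet.univ
    rw [← hden, measure_univ, setIntegral_univ] at h1
    simpa using h1.symm
  have hnull : ∀ i, ∀ᵐ z ∂ν i, ∑ x, q₀.1 x * r i x z = 1 := fun i => by
    have hm0 : Measurable fun z => ∑ x, q₀.1 x * r i x z :=
      Finset.measurable_sum _ fun x _ => (hr i x).const_mul _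
    have h8 : (ν i).withDensity (fun z => ENNReal.ofReal (∑ x, q₀.1 x * r i x z)) =
        (ν i).withDensity (fun _ => 1) := by
      rw [withDensity_const, one_smul]; exact (hr3 i _).symm
    rw [withDensity_eq_iff_of_sigmaFinite hm0.ennreal_ofReal.aemeasurable aemeasurable_const] at h8
    filter_upwards [h8] with z hz
    simpa using hz
  have hgD : ∀ ξ i, ∀ᵐ z ∂ν i, g ξ i z = 1 + (∑ k, η ξ k * D i k z) / (2 * m) := by
    intro ξ i
    filter_upwards [hnull i] with z hz
    rw [← hz, hg]
    exact sum_pairVec_mul_eq h2m hm _ (hηb ξ) (by simp) _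
  -- Both densities are `1` plus a centred linear form, so only the product of the two forms
  -- survives.
  have hcross : ∀ ξ ξ' i, ∫ z, g ξ i z * g ξ' i z ∂ν i =
      1 + (∫ z, (∑ k, η ξ k * D i k z) * (∑ l, η ξ' l * D i l z) ∂ν i) / (2 * m) ^ 2 := by
    intro ξ ξ' i
    have e1 : ∫ z, g ξ i z * g ξ' i z ∂ν i = ∫ z, (g ξ i z + g ξ' i z - 1 +
        (∑ k, η ξ k * D i k z) * (∑ l, η ξ' l * D i l z) / (2 * m) ^ 2) ∂ν i := by
      refine integral_congr_ae ?_
      filter_upwards [hgD ξ i, hgD ξ' i] with z h1 h2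
      rw [h1, h2]
      field_simp
      ring
    have hi : Integrable (fun z => (∑ k, η ξ k * D i k z) * (∑ l, η ξ' l * D i l z) /
        (2 * m) ^ 2) (ν i) := by
      refine Integrable.div_const ?_ _
      have : ∀ z, (∑ k, η ξ k * D i k z) * (∑ l, η ξ' l * D i l z) =
          ∑ k, ∑ l, η ξ k * η ξ' l * (D i k z * D i l z) := fun z => by
        rw [Finset.sum_mul_sum]
        exact Finset.sum_congr rfl fun k _ => Finset.sum_congr rfl fun l _ => by ring
      simp only [this]
      exact integrable_finsetSum _ fun k _ => integrable_finsetSum _ fun l _ =>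
        (hDDi i k l).const_mul _
    have hadd : Integrable (fun z => g ξ i z + g ξ' i z) (ν i) := (hgi ξ i).add (hgi ξ' i)
    have hsub : Integrable (fun z => g ξ i z + g ξ' i z - 1) (ν i) := hadd.sub (integrable_const 1)
    rw [e1, integral_add hsub hi, integral_sub hadd (integrable_const 1),
      integral_add (hgi ξ i) (hgi ξ' i), hgint, hgint, integral_div]
    simp
  set P₀ := Measure.pi ν with hP₀
  set R := Measure.pi (fun j => Q.QY j ∘ₘ q₀.toMeasure) with hR
  set L : (Fin m → Bool) → (Fin n₁ → 𝒵) → ℝ := fun ξ z => ∏ i, g ξ i (z i) with hL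
  have hLm : ∀ ξ, Measurable (L ξ) := fun ξ =>
    Finset.measurable_prod _ fun i _ => (hgm ξ i).comp (measurable_pi_apply i)
  have hL0 : ∀ ξ z, 0 ≤ L ξ z := fun ξ z => Finset.prod_nonneg fun i _ => hg0 ξ i _
  set M : ℝ := ∏ _i : Fin n₁, Real.exp ε
  have hM0 : 0 ≤ M := Finset.prod_nonneg fun i _ => (Real.exp_pos _).le
  have hLM : ∀ ξ z, L ξ z ≤ M := fun ξ z =>
    Finset.prod_le_prod (fun i _ => hg0 ξ i _) fun i _ => hgu ξ i _
  have hLi : ∀ ξ, Integrable (L ξ) P₀ := fun ξ => integrable_of_bounded _ (hLm ξ) (C := M) fun z => by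
    rw [abs_of_nonneg (hL0 ξ z)]; exact hLM ξ z
  have hLLi : ∀ ξ ξ', Integrable (fun z => L ξ z * L ξ' z) P₀ := fun ξ ξ' =>
    integrable_of_bounded _ ((hLm ξ).mul (hLm ξ')) (C := M * M) fun z => by
      rw [abs_of_nonneg (mul_nonneg (hL0 ξ z) (hL0 ξ' z))]
      exact mul_le_mul (hLM ξ z) (hLM ξ' z) (hL0 ξ' z) hM0
  have hLint : ∀ ξ, ∫ z, L ξ z ∂P₀ = 1 := fun ξ => by
    rw [hL, hP₀, integral_fintype_prod_eq_prod (fun i => g ξ i)]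
    simp [hgint]
  have hLL : ∀ ξ ∈ G, ∀ ξ' ∈ G, ∫ z, L ξ z * L ξ' z ∂P₀ ≤
      Real.exp ((∑ k, ∑ k', η₀ ξ k * B k k' * η₀ ξ' k') / (2 * m) ^ 2) := by
    intro ξ hξ ξ' hξ'
    have e1 : ∀ z, L ξ z * L ξ' z = ∏ i, (g ξ i (z i) * g ξ' i (z i)) := fun z => by
      rw [hL, Finset.prod_mul_distrib]
    simp only [e1]
    rw [hP₀, integral_fintype_prod_eq_prod (fun i z => g ξ i z * g ξ' i z), hquad, Finset.sum_div,
      Real.exp_sum]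
    refine Finset.prod_le_prod (fun i _ => integral_nonneg fun z =>
      mul_nonneg (hg0 ξ i z) (hg0 ξ' i z)) fun i _ => ?_
    rw [hcross, add_comm]
    have e2 : η ξ = η₀ ξ := if_pos hξ
    have e3 : η ξ' = η₀ ξ' := if_pos hξ'
    rw [e2, e3]
    exact Real.add_one_le_exp _
  -- the truncated mixture
  set s : (Fin n₁ → 𝒵) → ℝ := fun z => (∑ ξ ∈ G, L ξ z) / 2 ^ m with hs
  have hsi : Integrable s P₀ := (integrable_finsetSum _ fun ξ _ => hLi ξ).div_const _
  have hsm : Measurable s := (Finset.measurable_sum _ fun ξ _ => hLm ξ).div_const _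
  have hssum : ∀ z, s z * s z = (∑ ξ ∈ G, ∑ ξ' ∈ G, L ξ z * L ξ' z) / 2 ^ m / 2 ^ m := fun z => by
    rw [hs]; simp only
    rw [div_mul_div_comm, Finset.sum_mul_sum, div_div]
  have hssi : Integrable (fun z => s z * s z) P₀ := by
    simp only [hssum]
    exact ((integrable_finsetSum _ fun ξ _ => integrable_finsetSum _ fun ξ' _ =>
      hLLi ξ ξ').div_const _).div_const _
  have hsint : ∫ z, s z ∂P₀ = G.card / 2 ^ m := by
    rw [hs, integral_div, integral_finsetSum _ fun ξ _ => hLi ξ]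
    simp [hLint]
  have hss : ∫ z, s z * s z ∂P₀ ≤ 1 + 1 / 32 := by
    simp only [hssum]
    rw [integral_div, integral_div, integral_finsetSum _ fun ξ _ => integrable_finsetSum _
      fun ξ' _ => hLLi ξ ξ']
    refine le_trans ?_ hG4
    have h1 : signAvg (fun ξ => signAvg fun ξ' => Real.exp ((∑ k, ∑ k', η₀ ξ k * B k k' * η₀ ξ' k') /
        (2 * m) ^ 2)) = (∑ ξ, ∑ ξ', Real.exp ((∑ k, ∑ k', η₀ ξ k * B k k' * η₀ ξ' k') /
        (2 * m) ^ 2)) / 2 ^ m / 2 ^ m := by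
      simp only [signAvg, ← Finset.sum_div]
    rw [h1]
    gcongr
    calc _ ≤ ∑ ξ ∈ G, ∑ ξ' ∈ G, Real.exp ((∑ k, ∑ k', η₀ ξ k * B k k' * η₀ ξ' k') /
          (2 * m) ^ 2) := Finset.sum_le_sum fun ξ hξ => by
          rw [integral_finsetSum _ fun ξ' _ => hLLi ξ ξ']
          exact Finset.sum_le_sum fun ξ' hξ' => hLL ξ hξ ξ' hξ'
      _ ≤ ∑ ξ ∈ G, ∑ ξ', Real.exp ((∑ k, ∑ k', η₀ ξ k * B k k' * η₀ ξ' k') / (2 * m) ^ 2) :=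
          Finset.sum_le_sum fun ξ _ => Finset.sum_le_sum_of_subset_of_nonneg
            (Finset.subset_univ _) fun _ _ _ => (Real.exp_pos _).le
      _ ≤ _ := Finset.sum_le_sum_of_subset_of_nonneg (Finset.subset_univ _) fun _ _ _ =>
          Finset.sum_nonneg fun _ _ => (Real.exp_pos _).le
  have hsabs : Integrable (fun z => |s z - 1|) P₀ := (hsi.sub (integrable_const 1)).abs
  -- From `|x| ≤ (3/2) x² + 1/6`. The truncated mixture has mass at least `31/32` and second moment
  -- at most `33/32`, so the bound is `(3/2) * (3/32) + 1/6 < 1/3`.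
  have hL1 : ∫ z, |s z - 1| ∂P₀ ≤ 1 / 3 := by
    have hi : Integrable (fun z => 3 / 2 * (s z * s z) - 3 * s z + (3 / 2 + 1 / 6)) P₀ :=
      ((hssi.const_mul _).sub (hsi.const_mul _)).add (integrable_const _)
    have h1 : ∫ z, |s z - 1| ∂P₀ ≤ ∫ z, (3 / 2 * (s z * s z) - 3 * s z + (3 / 2 + 1 / 6)) ∂P₀ :=
      integral_mono hsabs hi fun z => by
        have h2 : |s z - 1| ^ 2 = (s z - 1) ^ 2 := sq_abs _
        simp only
        nlinarith [sq_nonneg (|s z - 1| - 1 / 3)]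
    have hi2 : Integrable (fun z => 3 / 2 * (s z * s z) - 3 * s z) P₀ :=
      (hssi.const_mul _).sub (hsi.const_mul _)
    rw [integral_add hi2 (integrable_const _), integral_sub (hssi.const_mul _) (hsi.const_mul _),
      integral_const_mul, integral_const_mul, hsint] at h1
    simp only [integral_const, probReal_univ, one_smul] at h1
    linarith
  have hlaw : ∀ ξ, Q.law (q ξ) q₀ = (P₀.prod R).withDensity fun z => ENNReal.ofReal (L ξ z.1) := by
    intro ξ
    have hpi : Measure.pi (fun i => Q.QX i ∘ₘ (q ξ).toMeasure) =
        P₀.withDensity fun z => ENNReal.ofReal (L ξ z) := by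
      simp only [hden]
      exact pi_withDensity_ofReal ν (hgm ξ) (hg0 ξ) (hgu ξ)
    rw [NonInteractive.law, hpi, prod_withDensity_left (hLm ξ).ennreal_ofReal]
  have hlaw0 : Q.law q₀ q₀ = P₀.prod R := rfl
  have hS : MeasurableSet {ω | φ ω = false} := hφ.1 (measurableSet_singleton false)
  set S := {ω | φ ω = false} with hSdef
  have hLfi : ∀ ξ, Integrable (fun z : (Fin n₁ → 𝒵) × (Fin n₂ → 𝒲) => L ξ z.1) (P₀.prod R) :=
    fun ξ => integrable_of_bounded _ ((hLm ξ).comp measurable_fst) (C := M) fun z => by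
      rw [abs_of_nonneg (hL0 ξ z.1)]; exact hLM ξ z.1
  have hmass : ∀ ξ ∈ G, ∫ z in S, L ξ z.1 ∂(P₀.prod R) ≤ β + 1 / 8 := by
    intro ξ hξ
    have hm1 : Measurable fun z : (Fin n₁ → 𝒵) × (Fin n₂ → 𝒲) => L ξ z.1 :=
      (hLm ξ).comp measurable_fst
    have h2 : Q.law (q ξ) q₀ S ≤ ENNReal.ofReal (β + 1 / 8) := by
      refine le_trans ?_ hlt.le
      refine le_iSup_of_le (q ξ) (le_iSup_of_le q₀ (le_iSup_of_le ?_ le_rfl))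
      refine hρ.trans (le_trans ?_ (le_lpDist_pairVec h2m hm _ _ _ hp))
      refine mul_le_mul_of_nonneg_left ?_ (by positivity)
      rw [le_div_iff₀ hm0]
      have e2 : η ξ = η₀ ξ := if_pos hξ
      rw [e2]
      have := hG2 ξ hξ
      linarith
    have h3 := toReal_withDensity_ofReal (P₀.prod R) hm1 (fun z => hL0 ξ z.1) hS
    rw [← hlaw ξ] at h3
    rw [← h3]
    exact ENNReal.toReal_le_of_le_ofReal (by positivity) h2
  have hsfi : Integrable (fun z : (Fin n₁ → 𝒵) × (Fin n₂ → 𝒲) => s z.1) (P₀.prod R) :=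
    (integrable_finsetSum _ fun ξ _ => hLfi ξ).div_const _
  have hsS : ∫ z in S, s z.1 ∂(P₀.prod R) ≤ β + 1 / 8 := by
    rw [hs, integral_div, integral_finsetSum _ fun ξ _ => (hLfi ξ).integrableOn,
      div_le_iff₀ (by positivity)]
    calc _ ≤ ∑ _ξ ∈ G, (β + 1 / 8) := Finset.sum_le_sum hmass
      _ ≤ ∑ _ξ : Fin m → Bool, (β + 1 / 8) := Finset.sum_le_sum_of_subset_of_nonneg
          (Finset.subset_univ _) fun _ _ _ => by positivity
      _ = _ := by
          simp only [Finset.sum_const, Finset.card_univ, nsmul_eq_mul]; simp [mul_comm]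
  have habs' : Integrable (fun z : (Fin n₁ → 𝒵) × (Fin n₂ → 𝒲) => |s z.1 - 1|) (P₀.prod R) :=
    (hsfi.sub (integrable_const 1)).abs
  have h9 : ((P₀.prod R) S).toReal = ∫ z in S, (1 : ℝ) ∂(P₀.prod R) := by
    simp [Measure.real]
  have h10 : ∫ z in S, (1 : ℝ) ∂(P₀.prod R) ≤ ∫ z in S, (s z.1 + |s z.1 - 1|) ∂(P₀.prod R) := by
    refine integral_mono (integrable_const 1) (hsfi.add habs').integrableOn fun z => ?_
    have := neg_abs_le (s z.1 - 1)
    simp only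
    linarith
  rw [integral_add hsfi.integrableOn habs'.integrableOn] at h10
  have h11 : ∫ z in S, |s z.1 - 1| ∂(P₀.prod R) ≤ ∫ z, |s z.1 - 1| ∂(P₀.prod R) :=
    setIntegral_le_integral habs' (Filter.Eventually.of_forall fun z => abs_nonneg _)
  have h12 : ∫ z, |s z.1 - 1| ∂(P₀.prod R) = ∫ x, |s x - 1| ∂P₀ := by
    rw [integral_fun_fst (fun x => |s x - 1|)]
    simp
  have hlevel := hφ.2 q₀
  have hcompl : Q.law q₀ q₀ {ω | φ ω = true} = 1 - Q.law q₀ q₀ S := by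
    rw [← prob_compl_eq_one_sub hS]
    congr 1
    ext ω
    simp [hSdef]
  have h1 : 1 - α ≤ ((P₀.prod R) S).toReal := by
    have h2 := ENNReal.toReal_le_of_le_ofReal hα hlevel
    rw [hcompl, ENNReal.toReal_sub_of_le prob_le_one ENNReal.one_ne_top, ENNReal.toReal_one,
      hlaw0] at h2
    linarith
  linarith

/-- The non-interactive lower bound, with the constant `1 / 10368`. -/
theorem nonInteractive_lower_bound {n₁ n₂ : ℕ} {ε p α β : ℝ} (hd : 2 ≤ d) (hp : 1 ≤ p)
    (hε : 0 < ε) (hε1 : ε ≤ 1) (hα : 0 ≤ α) (hβ : 0 ≤ β) (hαβ : α + β ≤ 1 / 2) (hn : 0 < n₁)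
    (hne : ∃ ρ, 0 < ρ ∧ riskNI d n₁ n₂ ε p α ρ ≤ ENNReal.ofReal (α + β)) :
    1 / 10368 * min ((d : ℝ) ^ (1 / p - 1 / 4) / √(n₁ * ε ^ 2))
      (1 / ((d : ℝ) ^ (1 - 1 / p) * √(Real.log d))) ≤ radiusNI d n₁ n₂ ε p α β := by
  have hn0 : (0 : ℝ) < n₁ := by exact_mod_cast hn
  have hN : 0 < √(n₁ * ε ^ 2) := Real.sqrt_pos.2 (by positivity)
  have hN2 : √(n₁ * ε ^ 2) ^ 2 = n₁ * ε ^ 2 := Real.sq_sqrt (by positivity)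
  have hd0 : (0 : ℝ) < d := by positivity
  have hd2 : (2 : ℝ) ≤ d := by exact_mod_cast hd
  have hlog : 0 < Real.log d := Real.log_pos (by linarith)
  have hsl : 0 < √(Real.log d) := Real.sqrt_pos.2 hlog
  have hm : 0 < d / 2 := by omega
  have h2m : 2 * (d / 2) ≤ d := by omega
  set m := d / 2 with hmdef
  have hm0 : (0 : ℝ) < m := by exact_mod_cast hm
  have hmd : (d : ℝ) ≤ 3 * m := by
    have : d ≤ 3 * m := by omega
    exact_mod_cast this
  have hmd' : (2 * m : ℝ) ≤ d := by exact_mod_cast h2m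
  -- With `γ₁` the moment condition holds, as `8 * 9² / 6⁴ = 1/2`. With `γ₂` one has `exp (1 /
  -- (2γ²)) ≥ d⁷ ≥ 64 d ≥ 128 m`.
  set γ₁ : ℝ := (m : ℝ) ^ (3 / 4 : ℝ) / (6 * √(n₁ * ε ^ 2)) with hγ₁
  set γ₂ : ℝ := 1 / √(14 * Real.log d) with hγ₂
  have hγ₁0 : 0 < γ₁ := by positivity
  have hγ₂0 : 0 < γ₂ := by positivity
  have hmain : (2 * m : ℝ) ^ (1 / p - 1) * (min γ₁ γ₂ / 576) ≤ radiusNI d n₁ n₂ ε p α β := by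
    refine le_radiusNI hα hβ hne fun 𝒵 𝒲 _ _ Q hQ φ hφ ρ hρ => ?_
    refine ofReal_le_typeTwoError_nonInteractive Q hQ hε hε1 hn hα hβ hαβ hφ h2m hm
      (lt_min hγ₁0 hγ₂0) ?_ ?_ hp hρ
    · have h1 : min γ₁ γ₂ ^ 4 ≤ γ₁ ^ 4 := pow_le_pow_left₀ (by positivity) (min_le_left _ _) 4
      have h2 : γ₁ ^ 4 = (m : ℝ) ^ 3 / (1296 * (n₁ * ε ^ 2) ^ 2) := by
        have h4 : √(n₁ * ε ^ 2) ^ 4 = (n₁ * ε ^ 2) ^ 2 :=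
          calc √(n₁ * ε ^ 2) ^ 4 = (√(n₁ * ε ^ 2) ^ 2) ^ 2 := by ring
            _ = _ := by rw [hN2]
        rw [hγ₁, div_pow, mul_pow, h4, ← Real.rpow_natCast, ← Real.rpow_mul hm0.le,
          ← Real.rpow_natCast (m : ℝ) 3]
        norm_num
      calc 8 * (min γ₁ γ₂ ^ 4 * (9 * (n₁ * ε ^ 2)) ^ 2)
          ≤ 8 * ((m : ℝ) ^ 3 / (1296 * (n₁ * ε ^ 2) ^ 2) * (9 * (n₁ * ε ^ 2)) ^ 2) := by
            rw [← h2]; gcongr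
        _ = 1 / 2 * (m : ℝ) ^ 3 := by field_simp; norm_num
        _ ≤ (m : ℝ) ^ 3 := by have : (0 : ℝ) ≤ (m : ℝ) ^ 3 := by positivity
                              linarith
    · have h1 : min γ₁ γ₂ ^ 2 ≤ γ₂ ^ 2 := pow_le_pow_left₀ (by positivity) (min_le_right _ _) 2
      have h2 : γ₂ ^ 2 = 1 / (14 * Real.log d) := by
        rw [hγ₂, div_pow, Real.sq_sqrt (by positivity)]; norm_num
      have h3 : 7 * Real.log d ≤ 1 / (2 * min γ₁ γ₂ ^ 2) := by
        have h0 : 0 < min γ₁ γ₂ := lt_min hγ₁0 hγ₂0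
        rw [le_div_iff₀ (by positivity)]
        calc 7 * Real.log d * (2 * min γ₁ γ₂ ^ 2) ≤ 7 * Real.log d * (2 * (1 / (14 * Real.log d))) := by
              rw [← h2]; gcongr
          _ = 1 := by field_simp; norm_num
      refine le_trans ?_ (Real.exp_le_exp.2 h3)
      have h4 : Real.exp (7 * Real.log d) = (d : ℝ) ^ 7 := by
        rw [mul_comm, Real.exp_mul, Real.exp_log hd0, ← Real.rpow_natCast]; norm_num
      rw [h4]
      have h5 : (64 : ℝ) ≤ (d : ℝ) ^ 6 := by
        calc (64 : ℝ) = 2 ^ 6 := by norm_num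
          _ ≤ _ := by gcongr
      calc 128 * (m : ℝ) ≤ 64 * d := by linarith
        _ ≤ (d : ℝ) ^ 6 * d := by gcongr
        _ = _ := by ring
  refine le_trans ?_ hmain
  have e1 : (d : ℝ) ^ (1 / p - 1) ≤ (2 * m : ℝ) ^ (1 / p - 1) := by
    refine Real.rpow_le_rpow_of_nonpos (by positivity) hmd' ?_
    have : 1 / p ≤ 1 := by rw [div_le_one (by linarith)]; exact hp
    linarith
  have e2 : (d : ℝ) ^ (3 / 4 : ℝ) ≤ 3 * (m : ℝ) ^ (3 / 4 : ℝ) := by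
    calc (d : ℝ) ^ (3 / 4 : ℝ) ≤ (3 * m : ℝ) ^ (3 / 4 : ℝ) := by gcongr
      _ = 3 ^ (3 / 4 : ℝ) * (m : ℝ) ^ (3 / 4 : ℝ) := Real.mul_rpow (by norm_num) hm0.le
      _ ≤ 3 ^ (1 : ℝ) * (m : ℝ) ^ (3 / 4 : ℝ) := by
          gcongr
          · norm_num
          · norm_num
      _ = _ := by rw [Real.rpow_one]
  have e3 : 1 / 18 * min ((d : ℝ) ^ (3 / 4 : ℝ) / √(n₁ * ε ^ 2)) (1 / √(Real.log d)) ≤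
      min γ₁ γ₂ := by
    refine le_min ?_ ?_
    · calc _ ≤ 1 / 18 * ((d : ℝ) ^ (3 / 4 : ℝ) / √(n₁ * ε ^ 2)) := by gcongr; exact min_le_left _ _
        _ ≤ 1 / 18 * (3 * (m : ℝ) ^ (3 / 4 : ℝ) / √(n₁ * ε ^ 2)) := by gcongr
        _ = γ₁ := by rw [hγ₁]; field_simp; norm_num
    · calc _ ≤ 1 / 18 * (1 / √(Real.log d)) := by gcongr; exact min_le_right _ _
        _ ≤ 1 / (√14 * √(Real.log d)) := by
          rw [div_mul_div_comm, one_mul]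
          refine one_div_le_one_div_of_le (by positivity) ?_
          gcongr
          rw [Real.sqrt_le_left (by norm_num)]; norm_num
        _ = γ₂ := by rw [hγ₂, Real.sqrt_mul (by norm_num)]
  have e4 : (d : ℝ) ^ (1 / p - 1 / 4) = (d : ℝ) ^ (1 / p - 1) * (d : ℝ) ^ (3 / 4 : ℝ) := by
    rw [← Real.rpow_add hd0]; congr 1; ring
  have e5 : 1 / ((d : ℝ) ^ (1 - 1 / p) * √(Real.log d)) =
      (d : ℝ) ^ (1 / p - 1) * (1 / √(Real.log d)) := by
    rw [show 1 / p - 1 = -(1 - 1 / p) by ring, Real.rpow_neg hd0.le]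
    field_simp
  calc _ = (d : ℝ) ^ (1 / p - 1) * ((1 / 18 * min ((d : ℝ) ^ (3 / 4 : ℝ) / √(n₁ * ε ^ 2))
        (1 / √(Real.log d))) / 576) := by
        rw [e4, e5, mul_div_assoc, ← mul_min_of_nonneg _ _ (by positivity)]
        ring
    _ ≤ _ := by gcongr

end NonInteractive

end LDPTest

end

noncomputable section

namespace LDPTest

/-! ### Expectation and variance on finite probability spaces -/

/-- Probability weights on a finite type. -/
abbrev FinLaw (Ω : Type*) [Fintype Ω] : Type _ := stdSimplex ℝ Ω

namespace FinLaw

variable {Ω Ω' : Type*} [Fintype Ω] [Fintype Ω']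

/-- The expectation of `f`. -/
def ev (P : FinLaw Ω) (f : Ω → ℝ) : ℝ := ∑ a, P.1 a * f a

/-- The variance of `f`. -/
def var (P : FinLaw Ω) (f : Ω → ℝ) : ℝ := P.ev (fun a => f a ^ 2) - P.ev f ^ 2

lemma ev_add (P : FinLaw Ω) (f g : Ω → ℝ) : P.ev (fun a => f a + g a) = P.ev f + P.ev g := by
  simp [ev, mul_add, Finset.sum_add_distrib]

lemma ev_sub (P : FinLaw Ω) (f g : Ω → ℝ) : P.ev (fun a => f a - g a) = P.ev f - P.ev g := by
  simp [ev, mul_sub, Finset.sum_sub_distrib]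

lemma ev_const_mul (P : FinLaw Ω) (c : ℝ) (f : Ω → ℝ) : P.ev (fun a => c * f a) = c * P.ev f := by
  simp only [ev, Finset.mul_sum]
  exact Finset.sum_congr rfl fun a _ => by ring

lemma ev_const (P : FinLaw Ω) (c : ℝ) : P.ev (fun _ => c) = c := by
  rw [ev, ← Finset.sum_mul, P.2.2, one_mul]

lemma ev_sum (P : FinLaw Ω) {ι : Type*} (s : Finset ι) (f : ι → Ω → ℝ) :
    P.ev (fun a => ∑ i ∈ s, f i a) = ∑ i ∈ s, P.ev (f i) := by
  simp only [ev, Finset.mul_sum]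
  exact Finset.sum_comm

lemma ev_mono (P : FinLaw Ω) {f g : Ω → ℝ} (h : ∀ a, f a ≤ g a) : P.ev f ≤ P.ev g :=
  Finset.sum_le_sum fun a _ => mul_le_mul_of_nonneg_left (h a) (P.2.1 a)

lemma ev_nonneg (P : FinLaw Ω) {f : Ω → ℝ} (h : ∀ a, 0 ≤ f a) : 0 ≤ P.ev f :=
  Finset.sum_nonneg fun a _ => mul_nonneg (P.2.1 a) (h a)

lemma ev_sq_sub (P : FinLaw Ω) (f : Ω → ℝ) (c : ℝ) :
    P.ev (fun a => (f a - c) ^ 2) = P.var f + (P.ev f - c) ^ 2 := by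
  have h : (fun a => (f a - c) ^ 2) = fun a => f a ^ 2 - (2 * c) * f a + c ^ 2 := by
    ext a; ring
  rw [h, ev_add P (fun a => f a ^ 2 - (2 * c) * f a), ev_sub, ev_const_mul, ev_const, var]
  ring

lemma var_eq (P : FinLaw Ω) (f : Ω → ℝ) : P.var f = P.ev (fun a => (f a - P.ev f) ^ 2) := by
  rw [ev_sq_sub]; ring

lemma var_le_ev_sq_sub (P : FinLaw Ω) (f : Ω → ℝ) (c : ℝ) :
    P.var f ≤ P.ev (fun a => (f a - c) ^ 2) := by
  rw [ev_sq_sub]; nlinarith [sq_nonneg (P.ev f - c)]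

lemma var_nonneg (P : FinLaw Ω) (f : Ω → ℝ) : 0 ≤ P.var f := by
  rw [var_eq]; exact P.ev_nonneg fun a => sq_nonneg _

lemma sq_ev_le (P : FinLaw Ω) (f : Ω → ℝ) : P.ev f ^ 2 ≤ P.ev (fun a => f a ^ 2) := by
  have := P.var_nonneg f
  rw [var] at this; linarith

lemma var_const_mul (P : FinLaw Ω) (c : ℝ) (f : Ω → ℝ) :
    P.var (fun a => c * f a) = c ^ 2 * P.var f := by
  have h : (fun a => (c * f a) ^ 2) = fun a => c ^ 2 * f a ^ 2 := by ext a; ring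
  rw [var, var, h, ev_const_mul, ev_const_mul]; ring

lemma ev_indicator_le_var_div (P : FinLaw Ω) (f : Ω → ℝ) {r : ℝ} (hr : 0 < r) (B : Ω → Bool)
    (hB : ∀ a, B a = true → r ≤ |f a - P.ev f|) :
    P.ev (fun a => if B a then 1 else 0) ≤ P.var f / r ^ 2 := by
  rw [var_eq, div_eq_inv_mul, ← ev_const_mul]
  refine P.ev_mono fun a => ?_
  by_cases h : B a = true
  · rw [if_pos h, ← sq_abs (f a - P.ev f), ← div_eq_inv_mul, one_le_div (by positivity)]
    exact pow_le_pow_left₀ hr.le (hB a h) 2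
  · rw [if_neg h]; positivity

/-- The joint law of a `P`-distributed variable and of one drawn from `Q` given the first. -/
def bind (P : FinLaw Ω) (Q : Ω → FinLaw Ω') : FinLaw (Ω × Ω') :=
  ⟨fun x => P.1 x.1 * (Q x.1).1 x.2, fun x => mul_nonneg (P.2.1 _) ((Q _).2.1 _), by
    rw [Fintype.sum_prod_type]
    simp [← Finset.mul_sum, (Q _).2.2, P.2.2]⟩

lemma ev_bind (P : FinLaw Ω) (Q : Ω → FinLaw Ω') (F : Ω × Ω' → ℝ) :
    (P.bind Q).ev F = P.ev fun a => (Q a).ev fun b => F (a, b) := by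
  simp only [ev, bind, Fintype.sum_prod_type, Finset.mul_sum, mul_assoc]

lemma var_bind (P : FinLaw Ω) (Q : Ω → FinLaw Ω') (F : Ω × Ω' → ℝ) :
    (P.bind Q).var F = P.ev (fun a => (Q a).var fun b => F (a, b)) +
      P.var (fun a => (Q a).ev fun b => F (a, b)) := by
  simp only [var, ev_bind, ev_sub]; ring

lemma var_ev_le (P : FinLaw Ω) (Q : FinLaw Ω') (F : Ω → Ω' → ℝ) :
    P.var (fun a => Q.ev (F a)) ≤ Q.ev fun b => P.var fun a => F a b := by
  have hswap : ∀ G : Ω → Ω' → ℝ, P.ev (fun a => Q.ev (G a)) = Q.ev fun b => P.ev fun a => G a b := by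
    intro G
    simp only [ev, Finset.mul_sum]
    rw [Finset.sum_comm]
    exact Finset.sum_congr rfl fun b _ => Finset.sum_congr rfl fun a _ => by ring
  rw [var_eq, hswap F]
  simp only [← ev_sub]
  calc _ ≤ P.ev (fun a => Q.ev fun b => (F a b - P.ev fun a => F a b) ^ 2) :=
        P.ev_mono fun a => Q.sq_ev_le _
    _ = _ := by rw [hswap]; simp only [var_eq]

/-- The Efron–Stein inequality for two independent variables: total variance, with Jensen
(`var_ev_le`) for the variance of the conditional mean. -/
lemma var_bind_const_le (P : FinLaw Ω) (Q : FinLaw Ω') (F : Ω × Ω' → ℝ) {c c' : ℝ}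
    (h : ∀ b, P.var (fun a => F (a, b)) ≤ c) (h' : ∀ a, Q.var (fun b => F (a, b)) ≤ c') :
    (P.bind fun _ => Q).var F ≤ c + c' := by
  rw [var_bind, add_comm]
  refine add_le_add ((var_ev_le P Q fun a b => F (a, b)).trans ?_) ?_
  · exact (Q.ev_mono h).trans_eq (Q.ev_const c)
  · exact (P.ev_mono h').trans_eq (P.ev_const c')

/-- The mixture of the laws `Q x` with mixing weights `q`. -/
def mix (q : FinLaw Ω) (Q : Ω → FinLaw Ω') : FinLaw Ω' :=
  ⟨fun b => ∑ x, q.1 x * (Q x).1 b,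
    fun b => Finset.sum_nonneg fun x _ => mul_nonneg (q.2.1 x) ((Q x).2.1 b), by
    rw [Finset.sum_comm]
    simp [← Finset.mul_sum, (Q _).2.2, q.2.2]⟩

lemma ev_mix (q : FinLaw Ω) (Q : Ω → FinLaw Ω') (f : Ω' → ℝ) :
    (q.mix Q).ev f = q.ev fun x => (Q x).ev f := by
  simp only [ev, mix, Finset.mul_sum, Finset.sum_mul]
  rw [Finset.sum_comm]
  exact Finset.sum_congr rfl fun b _ => Finset.sum_congr rfl fun a _ => by ring

/-- The law of `n` independent variables with common law `P`. -/
def iid (P : FinLaw Ω) (n : ℕ) : FinLaw (Fin n → Ω) :=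
  ⟨fun h => ∏ i, P.1 (h i), fun h => Finset.prod_nonneg fun i _ => P.2.1 _, by
    have := Finset.prod_univ_sum (fun _ : Fin n => (Finset.univ : Finset Ω)) (fun _ a => P.1 a)
    rw [Fintype.piFinset_univ] at this
    rw [← this]; simp [P.2.2]⟩

lemma ev_iid_zero (P : FinLaw Ω) (F : (Fin 0 → Ω) → ℝ) : (P.iid 0).ev F = F Fin.elim0 := by
  simp [ev, iid, Subsingleton.elim (default : Fin 0 → Ω) Fin.elim0]

lemma ev_iid_succ (P : FinLaw Ω) (n : ℕ) (F : (Fin (n + 1) → Ω) → ℝ) :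
    (P.iid (n + 1)).ev F = P.ev fun a => (P.iid n).ev fun h => F (Fin.cons a h) := by
  simp only [ev, iid]
  rw [← (Fin.consEquiv fun _ => Ω).sum_comp, Fintype.sum_prod_type]
  simp [Fin.consEquiv, Fin.prod_univ_succ, Finset.mul_sum, mul_assoc]

lemma ev_iid_sum (P : FinLaw Ω) (n : ℕ) (f : Ω → ℝ) :
    (P.iid n).ev (fun h => ∑ i, f (h i)) = n * P.ev f := by
  induction n with
  | zero => rw [ev_iid_zero]; simp
  | succ n ih =>
    rw [ev_iid_succ]
    simp only [Fin.sum_univ_succ, Fin.cons_zero, Fin.cons_succ, ev_add, ev_const, ih]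
    push_cast; ring

/-- Tensorisation of the variance. The hypothesis must hold for every shift `s`, since the other
summands act as a shift when one variable is resampled. -/
lemma var_iid_le {E : Type*} [AddCommMonoid E] (P : FinLaw Ω) (D : Ω → E) (g : E → ℝ) {c : ℝ}
    (hc : ∀ s, P.var (fun a => g (s + D a)) ≤ c) (n : ℕ) (s : E) :
    (P.iid n).var (fun h => g (s + ∑ i, D (h i))) ≤ n * c := by
  induction n generalizing s with
  | zero => rw [var, ev_iid_zero, ev_iid_zero]; simp
  | succ n ih =>
    have hv : (P.iid (n + 1)).var (fun h => g (s + ∑ i, D (h i))) =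
        (P.bind fun _ => P.iid n).var fun x => g (s + (D x.1 + ∑ i, D (x.2 i))) := by
      simp only [var, ev_bind, ev_iid_succ, Fin.sum_univ_succ, Fin.cons_zero, Fin.cons_succ]
    rw [hv]
    refine (var_bind_const_le P (P.iid n) _ (c := c) (c' := n * c) (fun b => ?_)
      fun a => ?_).trans_eq (by push_cast; ring)
    · convert hc (s + ∑ i, D (b i)) using 4
      abel
    · convert ih (s + D a) using 4
      abel

/-- Places the extra variable after the partial sum, where the replacement argument acts on it. -/
lemma ev_iid_succ_comp {E : Type*} [AddCommMonoid E] (P : FinLaw Ω) (D : Ω → E) (g : E → ℝ)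
    (n : ℕ) : (P.iid (n + 1)).ev (fun h => g (∑ i, D (h i))) =
      (P.iid n).ev fun h => P.ev fun a => g (∑ i, D (h i) + D a) := by
  rw [ev_iid_succ]
  simp only [Fin.sum_univ_succ, Fin.cons_zero, Fin.cons_succ]
  simp only [ev, Finset.mul_sum]
  rw [Finset.sum_comm]
  refine Finset.sum_congr rfl fun b _ => Finset.sum_congr rfl fun a _ => ?_
  rw [add_comm (D a)]; ring

/-- If a statistic errs with probability at most `1/16`, then at least half of `B` independent
copies err with probability at most `2⁻ᴮ`. -/
lemma ev_iid_majority_le (P : FinLaw Ω) (bad : Ω → Bool) (B : ℕ)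
    (h : P.ev (fun a => if bad a then 1 else 0) ≤ 1 / 16) :
    (P.iid B).ev (fun g => if B ≤ 2 * (Finset.univ.filter fun b => bad (g b) = true).card
      then 1 else 0) ≤ (1 / 2) ^ B := by
  have hprod : ∀ (n : ℕ) (f : Ω → ℝ), (P.iid n).ev (fun g => ∏ b, f (g b)) = P.ev f ^ n := by
    intro n f
    have := Finset.prod_univ_sum (fun _ : Fin n => (Finset.univ : Finset Ω))
      (fun _ a => P.1 a * f a)
    rw [Fintype.piFinset_univ] at this
    simp only [ev, iid, ← Finset.prod_mul_distrib, ← this, Finset.prod_const, Finset.card_univ,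
      Fintype.card_fin]
  -- A Chernoff bound with weight `16` per error: with at least `B / 2` errors the product reaches
  -- `4 ^ B`, while each factor has mean at most `1 + 15/16 ≤ 2`.
  have hpt : ∀ g : Fin B → Ω, (if B ≤ 2 * (Finset.univ.filter fun b => bad (g b) = true).card
      then (1 : ℝ) else 0) ≤ (1 / 4) ^ B * ∏ b, (if bad (g b) then (16 : ℝ) else 1) := by
    intro g
    rw [Finset.prod_ite]
    simp only [Finset.prod_const, one_pow, mul_one]
    split_ifs with hB
    · have h1 : (4 : ℝ) ^ B ≤ 4 ^ (2 * (Finset.univ.filter fun b => bad (g b) = true).card) :=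
        pow_le_pow_right₀ (by norm_num) hB
      rw [pow_mul] at h1
      norm_num at h1
      rw [one_div, inv_pow, ← div_eq_inv_mul, one_le_div (by positivity)]
      exact h1
    · positivity
  refine (ev_mono _ hpt).trans ?_
  rw [ev_const_mul, hprod B fun a => if bad a then (16 : ℝ) else 1]
  have h16 : P.ev (fun a => if bad a then (16 : ℝ) else 1) ≤ 2 := by
    have : (fun a => if bad a then (16 : ℝ) else 1) =
        fun a => 15 * (if bad a then (1 : ℝ) else 0) + 1 := by
      ext a; split_ifs <;> norm_num
    rw [this, ev_add, ev_const_mul, ev_const]; linarith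
  have h0 : 0 ≤ P.ev (fun a => if bad a then (16 : ℝ) else 1) :=
    ev_nonneg _ fun a => by split_ifs <;> norm_num
  calc _ ≤ (1 / 4 : ℝ) ^ B * 2 ^ B := by gcongr
    _ = (1 / 2) ^ B := by rw [← mul_pow]; norm_num

end FinLaw

end LDPTest

end

noncomputable section

namespace LDPTest

variable {d : ℕ}

/-! ### Sign channels -/

lemma signAvg_sgn (j : Fin d) : signAvg (fun v : Fin d → Bool => sgn (v j)) = 0 := by
  have h := sum_flipSign j fun v => sgn (v j)
  simp only [flipSign_apply_self, sgn_not, Finset.sum_neg_distrib] at h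
  have : ∑ v : Fin d → Bool, sgn (v j) = 0 := by linarith
  rw [signAvg, this, zero_div]

lemma signAvg_sgn_mul_sgn (j l : Fin d) :
    signAvg (fun v : Fin d → Bool => sgn (v j) * sgn (v l)) = if j = l then 1 else 0 := by
  split_ifs with hjl
  · subst hjl; simp only [sgn_mul_self, signAvg_const]
  · have h := sum_flipSign j fun v => sgn (v j) * sgn (v l)
    simp only [flipSign_apply_self, flipSign_apply_of_ne (Ne.symm hjl), sgn_not, neg_mul,
      Finset.sum_neg_distrib] at h
    have : ∑ v : Fin d → Bool, sgn (v j) * sgn (v l) = 0 := by linarith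
    rw [signAvg, this, zero_div]

lemma signAvg_eq_zero_of_odd {f : (Fin d → Bool) → ℝ} (h : ∀ v, f (fun x => !v x) = - f v) :
    signAvg f = 0 := by
  have hinv : Function.Involutive fun (v : Fin d → Bool) x => !v x := fun v => by ext; simp
  have h1 := Equiv.sum_comp hinv.toPerm f
  simp only [Function.Involutive.coe_toPerm, h, Finset.sum_neg_distrib] at h1
  have : ∑ v, f v = 0 := by linarith
  rw [signAvg, this, zero_div]

lemma signAvg_sq_sum (b : Fin d → ℝ) :
    signAvg (fun v => (∑ j, b j * sgn (v j)) ^ 2) = ∑ j, b j ^ 2 := by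
  have h : (fun v : Fin d → Bool => (∑ j, b j * sgn (v j)) ^ 2) =
      fun v => ∑ j, ∑ l, (b j * b l) * (sgn (v j) * sgn (v l)) := by
    ext v
    rw [sq, Finset.sum_mul_sum]
    exact Finset.sum_congr rfl fun j _ => Finset.sum_congr rfl fun l _ => by ring
  rw [h, signAvg_sum]
  simp only [signAvg_sum, signAvg_const_mul, signAvg_sgn_mul_sgn, mul_ite, mul_one, mul_zero,
    Finset.sum_ite_eq, Finset.mem_univ, if_true, sq]

/-- The parameters of a channel that reports a uniform sign vector, reweighted towards those whose
entry `idx x` has the sign of `coef x`, where `x` is the raw datum. -/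
structure SignFeature (d : ℕ) where
  coef : Fin d → ℝ
  idx : Fin d → Fin d
  abs_coef_le : ∀ x, |coef x| ≤ 1

variable {k : ℝ}

lemma SignFeature.abs_tilt_le (F : SignFeature d) (k : ℝ) (x : Fin d) (v : Fin d → Bool) :
    |k * (F.coef x * sgn (v (F.idx x)))| ≤ |k| := by
  rw [abs_mul, abs_mul, abs_sgn, mul_one]
  exact mul_le_of_le_one_right (abs_nonneg _) (F.abs_coef_le x)

/-- The law of the sign vector reported for the raw datum `x`. -/
def signLaw (hk : |k| ≤ 1) (F : SignFeature d) (x : Fin d) : FinLaw (Fin d → Bool) :=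
  ⟨fun v => (1 + k * (F.coef x * sgn (v (F.idx x)))) / 2 ^ d, fun v => by
    have := abs_le.1 ((F.abs_tilt_le k x v).trans hk)
    have : 0 ≤ 1 + k * (F.coef x * sgn (v (F.idx x))) := by linarith
    positivity, by
    have h := signAvg_add (fun _ => (1 : ℝ)) fun v => (k * F.coef x) * sgn (v (F.idx x))
    rw [signAvg_const_mul, signAvg_sgn, signAvg_const, mul_zero, add_zero] at h
    rw [← Finset.sum_div]
    simpa only [signAvg, mul_assoc] using h⟩

lemma ev_signLaw (hk : |k| ≤ 1) (F : SignFeature d) (x : Fin d) (f : (Fin d → Bool) → ℝ) :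
    (signLaw hk F x).ev f =
      signAvg f + k * F.coef x * signAvg fun v => sgn (v (F.idx x)) * f v := by
  rw [← signAvg_const_mul, ← signAvg_add, signAvg, Finset.sum_div]
  exact Finset.sum_congr rfl fun v _ => by simp only [signLaw]; ring

/-- The law of the sign vector reported for a raw datum with probability vector `q`. -/
def viewLaw (hk : |k| ≤ 1) (F : SignFeature d) (q : ProbVec d) : FinLaw (Fin d → Bool) :=
  FinLaw.mix q (signLaw hk F)

/-- The tilt of the uniform law is an odd function of the sign vector, so it is orthogonal to every
even function. Second moments of linear forms in the signs are therefore exactly those of uniform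
signs, whatever the feature and the raw law. -/
lemma ev_viewLaw_of_even (hk : |k| ≤ 1) (F : SignFeature d) (q : ProbVec d)
    {f : (Fin d → Bool) → ℝ} (h : ∀ v, f (fun x => !v x) = f v) :
    (viewLaw hk F q).ev f = signAvg f := by
  have h0 : ∀ j, signAvg (fun v => sgn (v j) * f v) = 0 := fun j =>
    signAvg_eq_zero_of_odd fun v => by rw [h, sgn_not, neg_mul]
  rw [viewLaw, FinLaw.ev_mix]
  simp only [ev_signLaw, h0, mul_zero, add_zero]
  exact FinLaw.ev_const _ _

lemma ev_viewLaw_sgn (hk : |k| ≤ 1) (F : SignFeature d) (q : ProbVec d) (j : Fin d) :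
    (viewLaw hk F q).ev (fun v => sgn (v j)) =
      k * ∑ x, q.1 x * (F.coef x * if F.idx x = j then 1 else 0) := by
  rw [viewLaw, FinLaw.ev_mix]
  simp only [ev_signLaw, signAvg_sgn, zero_add, signAvg_sgn_mul_sgn]
  rw [FinLaw.ev, Finset.mul_sum]
  exact Finset.sum_congr rfl fun x _ => by ring

/-- Centring each `g j` at the midpoint of its two values leaves a linear form in the signs. Its
square is even, hence has its uniform expectation, the sum of the squared coefficients. -/
lemma var_viewLaw_sum_le (hk : |k| ≤ 1) (F : SignFeature d) (q : ProbVec d) (g : Fin d → Bool → ℝ)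
    (u : Fin d → ℝ) (hg : ∀ j, |g j true - g j false| ≤ 2 * |u j|) :
    (viewLaw hk F q).var (fun v => ∑ j, g j (v j)) ≤ ∑ j, u j ^ 2 := by
  refine ((viewLaw hk F q).var_le_ev_sq_sub _ (∑ j, (g j true + g j false) / 2)).trans ?_
  have h : ∀ v : Fin d → Bool, (∑ j, g j (v j)) - ∑ j, (g j true + g j false) / 2 =
      ∑ j, ((g j true - g j false) / 2) * sgn (v j) := by
    intro v
    rw [← Finset.sum_sub_distrib]
    refine Finset.sum_congr rfl fun j _ => ?_
    cases v j <;> simp <;> ring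
  simp only [h]
  rw [ev_viewLaw_of_even, signAvg_sq_sum]
  · refine Finset.sum_le_sum fun j _ => ?_
    rw [← sq_abs, ← sq_abs (u j)]
    refine pow_le_pow_left₀ (abs_nonneg _) ?_ 2
    rw [abs_div, abs_two]
    linarith [hg j]
  · intro v
    simp only [sgn_not, mul_neg, Finset.sum_neg_distrib, neg_sq]

/-- The law of a pair of views from the two samples. -/
def pairLaw (hk : |k| ≤ 1) (F : SignFeature d) (qX qY : ProbVec d) :
    FinLaw ((Fin d → Bool) × (Fin d → Bool)) :=
  (viewLaw hk F qX).bind fun _ => viewLaw hk F qY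

/-- The difference of the two sign vectors of a pair of views. -/
def signDiff (a : (Fin d → Bool) × (Fin d → Bool)) (j : Fin d) : ℝ := sgn (a.1 j) - sgn (a.2 j)

lemma ev_pairLaw_signDiff (hk : |k| ≤ 1) (F : SignFeature d) (qX qY : ProbVec d) (j : Fin d) :
    (pairLaw hk F qX qY).ev (fun a => signDiff a j) =
      k * ∑ x, (qX.1 x - qY.1 x) * (F.coef x * if F.idx x = j then 1 else 0) := by
  rw [pairLaw, FinLaw.ev_bind]
  simp only [signDiff, FinLaw.ev_sub, FinLaw.ev_const, ev_viewLaw_sgn, ← mul_sub,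
    ← Finset.sum_sub_distrib, ← sub_mul]

/-- Lipschitz functions are no more variable than linear ones. The bound is uniform in the shift
`s`, as tensorisation over a block requires. -/
lemma var_pairLaw_le (hk : |k| ≤ 1) (F : SignFeature d) (qX qY : ProbVec d) (g : Fin d → ℝ → ℝ)
    (u : Fin d → ℝ) (hg : ∀ j s t, |g j s - g j t| ≤ |u j| * |s - t|) (s : Fin d → ℝ) :
    (pairLaw hk F qX qY).var (fun a => ∑ j, g j ((s + signDiff a) j)) ≤ 2 * ∑ j, u j ^ 2 := by
  rw [two_mul]
  refine FinLaw.var_bind_const_le _ _ _ (fun b => ?_) fun a => ?_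
  · refine var_viewLaw_sum_le hk F qX (fun j c => g j (s j + (sgn c - sgn (b j)))) u fun j => ?_
    refine (hg j _ _).trans_eq ?_
    simp only [sgn_true, sgn_false]
    rw [mul_comm]; congr 1; norm_num
  · refine var_viewLaw_sum_le hk F qY (fun j c => g j (s j + (sgn (a j) - sgn c))) u fun j => ?_
    refine (hg j _ _).trans_eq ?_
    simp only [sgn_true, sgn_false]
    rw [mul_comm]; congr 1
    rw [show s j + (sgn (a j) - 1) - (s j + (sgn (a j) - -1)) = -2 by ring]; norm_num

/-- The sum of the sign differences of a block of pairs of views. -/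
def blockSum {m : ℕ} (h : Fin m → (Fin d → Bool) × (Fin d → Bool)) : Fin d → ℝ :=
  ∑ i, signDiff (h i)

lemma blockSum_apply {m : ℕ} (h : Fin m → (Fin d → Bool) × (Fin d → Bool)) (j : Fin d) :
    blockSum h j = ∑ i, signDiff (h i) j := Finset.sum_apply _ _ _

lemma var_blockSum_le (hk : |k| ≤ 1) (F : SignFeature d) (qX qY : ProbVec d) (m : ℕ)
    (g : Fin d → ℝ → ℝ) (u : Fin d → ℝ) (hg : ∀ j s t, |g j s - g j t| ≤ |u j| * |s - t|) :
    ((pairLaw hk F qX qY).iid m).var (fun h => ∑ j, g j (blockSum h j)) ≤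
      m * (2 * ∑ j, u j ^ 2) := by
  have := FinLaw.var_iid_le (pairLaw hk F qX qY) signDiff (fun s => ∑ j, g j (s j))
    (var_pairLaw_le hk F qX qY g u hg) m 0
  simpa only [zero_add, blockSum] using this

lemma var_blockSum_linear_le (hk : |k| ≤ 1) (F : SignFeature d) (qX qY : ProbVec d) (m : ℕ)
    (u : Fin d → ℝ) :
    ((pairLaw hk F qX qY).iid m).var (fun h => ∑ j, u j * blockSum h j) ≤
      m * (2 * ∑ j, u j ^ 2) :=
  var_blockSum_le hk F qX qY m (fun j s => u j * s) u fun j s t => by rw [← mul_sub, abs_mul]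

lemma var_blockSum_apply_le (hk : |k| ≤ 1) (F : SignFeature d) (qX qY : ProbVec d) (m : ℕ)
    (j : Fin d) : ((pairLaw hk F qX qY).iid m).var (fun h => blockSum h j) ≤ 2 * m := by
  have := var_blockSum_linear_le hk F qX qY m fun l => if l = j then 1 else 0
  simp only [ite_mul, one_mul, zero_mul, Finset.sum_ite_eq', Finset.mem_univ, if_true, ite_pow,
    one_pow, ne_eq, OfNat.ofNat_ne_zero, not_false_eq_true, zero_pow] at this
  linarith

lemma ev_blockSum_apply (hk : |k| ≤ 1) (F : SignFeature d) (qX qY : ProbVec d) (m : ℕ)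
    (j : Fin d) : ((pairLaw hk F qX qY).iid m).ev (fun h => blockSum h j) =
      m * (k * ∑ x, (qX.1 x - qY.1 x) * (F.coef x * if F.idx x = j then 1 else 0)) := by
  simp only [blockSum_apply]
  rw [FinLaw.ev_iid_sum _ m fun a => signDiff a j, ev_pairLaw_signDiff]

/-- The feature of the channel that favours sign vectors with a positive entry at the datum. -/
def coordFeature (d : ℕ) : SignFeature d := ⟨fun _ => 1, id, by simp⟩

lemma sum_mul_coordFeature (f : Fin d → ℝ) (j : Fin d) :
    ∑ x, f x * ((coordFeature d).coef x * if (coordFeature d).idx x = j then 1 else 0) = f j := by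
  rw [Finset.sum_eq_single j]
  · simp [coordFeature]
  · intro b _ hb; simp [coordFeature, hb]
  · simp

lemma ev_blockSum_coordFeature (hk : |k| ≤ 1) (qX qY : ProbVec d) (m : ℕ) (j : Fin d) :
    ((pairLaw hk (coordFeature d) qX qY).iid m).ev (fun h => blockSum h j) =
      m * (k * (qX.1 j - qY.1 j)) := by
  rw [ev_blockSum_apply, sum_mul_coordFeature (fun x => qX.1 x - qY.1 x)]

/-! ### The inner product statistic of two independent blocks -/

/-- The law of two independent blocks of pairs of views. -/
def twoBlockLaw (hk : |k| ≤ 1) (qX qY : ProbVec d) (m : ℕ) :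
    FinLaw ((Fin m → (Fin d → Bool) × (Fin d → Bool)) × (Fin m → (Fin d → Bool) × (Fin d → Bool))) :=
  ((pairLaw hk (coordFeature d) qX qY).iid m).bind fun _ => (pairLaw hk (coordFeature d) qX qY).iid m

/-- The inner product of the sums of two blocks. -/
def blockInner {m : ℕ}
    (x : (Fin m → (Fin d → Bool) × (Fin d → Bool)) × (Fin m → (Fin d → Bool) × (Fin d → Bool))) : ℝ :=
  ∑ j, blockSum x.1 j * blockSum x.2 j

lemma ev_blockInner_right (hk : |k| ≤ 1) (qX qY : ProbVec d) (m : ℕ)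
    (h : Fin m → (Fin d → Bool) × (Fin d → Bool)) :
    ((pairLaw hk (coordFeature d) qX qY).iid m).ev (fun h' => blockInner (h, h')) =
      ∑ j, (m * (k * (qX.1 j - qY.1 j))) * blockSum h j := by
  simp only [blockInner, FinLaw.ev_sum, FinLaw.ev_const_mul, ev_blockSum_coordFeature]
  exact Finset.sum_congr rfl fun j _ => mul_comm _ _

lemma ev_blockInner (hk : |k| ≤ 1) (qX qY : ProbVec d) (m : ℕ) :
    (twoBlockLaw hk qX qY m).ev blockInner = m ^ 2 * k ^ 2 * ∑ j, (qX.1 j - qY.1 j) ^ 2 := by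
  rw [twoBlockLaw, FinLaw.ev_bind]
  simp only [ev_blockInner_right, FinLaw.ev_sum, FinLaw.ev_const_mul, ev_blockSum_coordFeature,
    Finset.mul_sum]
  exact Finset.sum_congr rfl fun j _ => by ring

/-- Condition on the first block: the conditional variance is at most `2m` times the squared norm of
its sum, and the conditional mean is a linear form in it with coefficients `m k Δ j`. The term `4 m²
d` is pure noise. -/
lemma var_blockInner_le (hk : |k| ≤ 1) (qX qY : ProbVec d) (m : ℕ) :
    (twoBlockLaw hk qX qY m).var blockInner ≤
      4 * m ^ 2 * d + 4 * m * (m ^ 2 * k ^ 2 * ∑ j, (qX.1 j - qY.1 j) ^ 2) := by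
  rw [twoBlockLaw, FinLaw.var_bind]
  simp only [ev_blockInner_right]
  set P := (pairLaw hk (coordFeature d) qX qY).iid m with hP
  have h1 : P.ev (fun h => P.var fun h' => blockInner (h, h')) ≤
      2 * m * ∑ j, (2 * m + (m * (k * (qX.1 j - qY.1 j))) ^ 2) := by
    calc _ ≤ P.ev (fun h => 2 * m * ∑ j, blockSum h j ^ 2) :=
          P.ev_mono fun h =>
            (var_blockSum_linear_le hk (coordFeature d) qX qY m (blockSum h)).trans_eq (by ring)
      _ = 2 * m * ∑ j, P.ev (fun h => blockSum h j ^ 2) := by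
          rw [FinLaw.ev_const_mul, FinLaw.ev_sum]
      _ ≤ _ := by
          refine mul_le_mul_of_nonneg_left (Finset.sum_le_sum fun j _ => ?_) (by positivity)
          have h2 := var_blockSum_apply_le hk (coordFeature d) qX qY m j
          rw [FinLaw.var, ev_blockSum_coordFeature] at h2
          linarith
  have h2 := var_blockSum_linear_le hk (coordFeature d) qX qY m
    fun j => m * (k * (qX.1 j - qY.1 j))
  refine (add_le_add h1 h2).trans_eq ?_
  simp only [Finset.sum_add_distrib, mul_pow, ← Finset.mul_sum, Finset.sum_const, Finset.card_univ,
    Fintype.card_fin, nsmul_eq_mul]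
  ring

lemma twoBlockLaw_null_error (hk : |k| ≤ 1) (hd : 0 < d) {m : ℕ} (hm : 0 < m) (q : ProbVec d) :
    (twoBlockLaw hk q q m).ev (fun x => if decide (8 * m * √d ≤ blockInner x) then 1 else 0) ≤
      1 / 16 := by
  have hd0 : (0 : ℝ) < d := by exact_mod_cast hd
  have hm0 : (0 : ℝ) < m := by exact_mod_cast hm
  have he := ev_blockInner hk q q m
  have hv := var_blockInner_le hk q q m
  simp only [sub_self, ne_eq, OfNat.ofNat_ne_zero, not_false_eq_true, zero_pow,
    Finset.sum_const_zero, mul_zero, add_zero] at he hv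
  refine (FinLaw.ev_indicator_le_var_div _ blockInner (r := 8 * m * √d) (by positivity) _
    fun x hx => ?_).trans ?_
  · rw [he, sub_zero]
    exact (of_decide_eq_true hx).trans (le_abs_self _)
  · rw [div_le_iff₀ (by positivity), mul_pow, Real.sq_sqrt hd0.le]
    linarith

lemma twoBlockLaw_alternative_error (hk : |k| ≤ 1) (hd : 0 < d) {m : ℕ} (hm : 0 < m)
    (qX qY : ProbVec d) (h : 512 * √d ≤ m * (k ^ 2 * ∑ j, (qX.1 j - qY.1 j) ^ 2)) :
    (twoBlockLaw hk qX qY m).ev (fun x => if !decide (8 * m * √d ≤ blockInner x) then 1 else 0) ≤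
      1 / 16 := by
  have hd0 : (1 : ℝ) ≤ d := by exact_mod_cast hd
  have hm0 : (0 : ℝ) < m := by exact_mod_cast hm
  have he := ev_blockInner hk qX qY m
  have hv := var_blockInner_le hk qX qY m
  set s : ℝ := m ^ 2 * k ^ 2 * ∑ j, (qX.1 j - qY.1 j) ^ 2 with hs
  have hsq : 1 ≤ √d := Real.one_le_sqrt.2 hd0
  have hs1 : 512 * (m * √d) ≤ s := by
    calc 512 * (m * √d) = m * (512 * √d) := by ring
      _ ≤ m * (m * (k ^ 2 * ∑ j, (qX.1 j - qY.1 j) ^ 2)) := by gcongr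
      _ = s := by rw [hs]; ring
  have hs2 : 512 * (m : ℝ) ≤ s := le_trans (by nlinarith) hs1
  have hs0 : 0 < s := lt_of_lt_of_le (by positivity) hs1
  -- The mean `s` is at least `64` times the threshold, so acceptance is a deviation of at least `s
  -- / 2`. Chebyshev's bound is `16 m² d / s² + 16 m / s`, at most `1/512² * 16 + 16/512`.
  refine (FinLaw.ev_indicator_le_var_div _ blockInner (r := s / 2) (by positivity) _
    fun x hx => ?_).trans ?_
  · simp only [Bool.not_eq_true', decide_eq_false_iff_not, not_le] at hx
    rw [he, abs_sub_comm]
    refine le_trans ?_ (le_abs_self _)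
    nlinarith
  · rw [div_le_iff₀ (by positivity)]
    refine hv.trans ?_
    have h1 : (m : ℝ) ^ 2 * d * 512 ^ 2 ≤ s ^ 2 := by
      calc (m : ℝ) ^ 2 * d * 512 ^ 2 = (512 * (m * √d)) ^ 2 := by
            rw [mul_pow, mul_pow, Real.sq_sqrt (by positivity)]; ring
        _ ≤ s ^ 2 := pow_le_pow_left₀ (by positivity) hs1 2
    nlinarith

end LDPTest

end

noncomputable section

namespace LDPTest

variable {d : ℕ}

/-! ### Truncation -/

/-- Truncation to `[-τ, τ]`. -/
def clip (τ x : ℝ) : ℝ := max (-τ) (min x τ)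

lemma abs_clip_le {τ : ℝ} (hτ : 0 ≤ τ) (x : ℝ) : |clip τ x| ≤ τ :=
  abs_le.2 ⟨le_max_left _ _, max_le (by linarith) (min_le_right _ _)⟩

lemma clip_neg {τ : ℝ} (hτ : 0 ≤ τ) (x : ℝ) : clip τ (-x) = - clip τ x := by
  unfold clip
  rcases le_total x τ with h | h <;> rcases le_total x (-τ) with h' | h' <;>
    grind

lemma abs_clip_sub_clip_le (τ x y : ℝ) : |clip τ x - clip τ y| ≤ |x - y| := by
  unfold clip
  rw [max_comm (-τ) (min x τ), max_comm (-τ) (min y τ)]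
  exact (abs_max_sub_max_le_abs _ _ _).trans (abs_inf_sub_inf_le_abs x y τ)

/-- Away from the truncation points the increment is exactly `4`. A quadratic penalty covers the
rest; it is chosen quadratic because second moments of the walk are available. -/
lemma clip_add_sub_clip_sub_ge {τ : ℝ} (hτ : 2 < τ) (s : ℝ) :
    4 - 4 / (τ - 2) ^ 2 * s ^ 2 ≤ clip τ (s + 2) - clip τ (s - 2) := by
  have h0 : 0 < τ - 2 := by linarith
  rcases le_total |s| (τ - 2) with h | h
  · have h1 := abs_le.1 h
    have e1 : clip τ (s + 2) = s + 2 := by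
      unfold clip; rw [min_eq_left (by linarith), max_eq_right (by linarith)]
    have e2 : clip τ (s - 2) = s - 2 := by
      unfold clip; rw [min_eq_left (by linarith), max_eq_right (by linarith)]
    have : 0 ≤ 4 / (τ - 2) ^ 2 * s ^ 2 := by positivity
    rw [e1, e2]; linarith
  · have h1 : (τ - 2) ^ 2 ≤ s ^ 2 := by
      rw [← sq_abs s]; exact pow_le_pow_left₀ h0.le h 2
    have h2 : clip τ (s - 2) ≤ clip τ (s + 2) :=
      max_le_max le_rfl (min_le_min (by linarith) le_rfl)
    have h3 : 4 ≤ 4 / (τ - 2) ^ 2 * s ^ 2 := by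
      rw [div_mul_eq_mul_div, le_div_iff₀ (by positivity)]; linarith
    linarith

/-- If `x ≥ τ / 8` the truncation is at least `τ / 8`. Otherwise `x` is at least `μ / 2` below `μ`,
and the penalty `9τ/8` brings the left side down to at most `-τ`. -/
lemma clip_ge_of_pos {τ μ : ℝ} (hτ : 0 < τ) (hμ : τ / 4 ≤ μ) (x : ℝ) :
    τ / 8 - 9 * τ / 2 / μ ^ 2 * (x - μ) ^ 2 ≤ clip τ x := by
  have hμ0 : 0 < μ := by linarith
  rcases le_total (τ / 8) x with h | h
  · have h1 : τ / 8 ≤ clip τ x := le_max_of_le_right (le_min h (by linarith))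
    have : 0 ≤ 9 * τ / 2 / μ ^ 2 * (x - μ) ^ 2 := by positivity
    linarith
  · have h1 : - τ ≤ clip τ x := le_max_left _ _
    have h2 : μ ^ 2 / 4 ≤ (x - μ) ^ 2 := by nlinarith
    have h3 : 9 * τ / 8 ≤ 9 * τ / 2 / μ ^ 2 * (x - μ) ^ 2 := by
      calc 9 * τ / 8 = 9 * τ / 2 / μ ^ 2 * (μ ^ 2 / 4) := by field_simp; norm_num
        _ ≤ _ := by gcongr
    linarith

lemma mul_clip_ge {τ μ δ c : ℝ} (hτ : 0 < τ) (hc : 0 ≤ c) (hμc : μ = c * δ) (hμ : τ / 4 ≤ |μ|)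
    (x : ℝ) : |δ| * (τ / 8 - 9 * τ / 2 / μ ^ 2 * (x - μ) ^ 2) ≤ δ * clip τ x := by
  rcases le_total 0 δ with h | h
  · have h0 : 0 ≤ μ := by rw [hμc]; positivity
    rw [abs_of_nonneg h0] at hμ
    rw [abs_of_nonneg h]
    exact mul_le_mul_of_nonneg_left (clip_ge_of_pos hτ hμ x) h
  · have h0 : μ ≤ 0 := by rw [hμc]; exact mul_nonpos_of_nonneg_of_nonpos hc h
    rw [abs_of_nonpos h0] at hμ
    have h1 := mul_le_mul_of_nonneg_left (clip_ge_of_pos hτ hμ (-x)) (neg_nonneg.2 h)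
    rw [clip_neg hτ.le] at h1
    rw [abs_of_nonpos h]
    calc _ = -δ * (τ / 8 - 9 * τ / 2 / (-μ) ^ 2 * (-x - -μ) ^ 2) := by ring
      _ ≤ _ := h1
      _ = _ := by ring

/-! ### The expected truncated block sum -/

/-- One step of the symmetric walk with steps `-2, 0, 2` and step variance `v`. -/
def symStep (v : ℝ) (g : ℝ → ℝ) (s : ℝ) : ℝ := g s + v / 8 * (g (s + 2) + g (s - 2) - 2 * g s)

lemma symStep_iterate_odd {v : ℝ} {f : ℝ → ℝ} (hf : ∀ s, f (-s) = - f s) (l : ℕ) (s : ℝ) :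
    (symStep v)^[l] f (-s) = - (symStep v)^[l] f s := by
  induction l generalizing s with
  | zero => exact hf s
  | succ l ih =>
    rw [Function.iterate_succ_apply', symStep, symStep,
      show -s + 2 = -(s - 2) by ring, show -s - 2 = -(s + 2) by ring, ih, ih, ih]
    ring

/-- A symmetric step raises the mean of `s²` by `v`. For `v ≤ 4` it is an average with nonnegative
weights, hence preserves the inequality. -/
lemma symStep_iterate_diff_ge {v a c : ℝ} (hv : 0 ≤ v) (hv4 : v ≤ 4) {f : ℝ → ℝ}
    (hf : ∀ s, a - c * s ^ 2 ≤ f (s + 2) - f (s - 2)) (l : ℕ) (s : ℝ) :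
    a - c * (s ^ 2 + v * l) ≤ (symStep v)^[l] f (s + 2) - (symStep v)^[l] f (s - 2) := by
  induction l generalizing s with
  | zero => simpa using hf s
  | succ l ih =>
    rw [Function.iterate_succ_apply', symStep, symStep]
    set g := (symStep v)^[l] f
    have h1 := mul_le_mul_of_nonneg_left (ih s) (by linarith : 0 ≤ 1 - v / 4)
    have h2 := mul_le_mul_of_nonneg_left (ih (s + 2)) (by linarith : 0 ≤ v / 8)
    have h3 := mul_le_mul_of_nonneg_left (ih (s - 2)) (by linarith : 0 ≤ v / 8)
    rw [show s - 2 + 2 = s + 2 - 2 by ring] at *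
    push_cast
    linarith

variable {k : ℝ}

lemma signDiff_sq_le (a : (Fin d → Bool) × (Fin d → Bool)) (j : Fin d) : signDiff a j ^ 2 ≤ 4 := by
  unfold signDiff; cases a.1 j <;> cases a.2 j <;> norm_num

/-- On the three possible steps `-2, 0, 2` every function is a quadratic polynomial, so the law of a
step enters only through its mean and second moment. The mean gives the drift term. -/
lemma ev_pairLaw_comp_add_signDiff (hk : |k| ≤ 1) (qX qY : ProbVec d) (j : Fin d) (g : ℝ → ℝ)
    (s : ℝ) : (pairLaw hk (coordFeature d) qX qY).ev (fun a => g (s + signDiff a j)) =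
      symStep ((pairLaw hk (coordFeature d) qX qY).ev fun a => signDiff a j ^ 2) g s +
        k * (qX.1 j - qY.1 j) / 4 * (g (s + 2) - g (s - 2)) := by
  have h : ∀ a : (Fin d → Bool) × (Fin d → Bool), g (s + signDiff a j) = g s +
      ((g (s + 2) - g (s - 2)) / 4 * signDiff a j +
        (g (s + 2) + g (s - 2) - 2 * g s) / 8 * signDiff a j ^ 2) := by
    intro a
    unfold signDiff
    cases a.1 j <;> cases a.2 j <;> simp only [sgn_true, sgn_false]
    · rw [show s + (-1 - -1) = s by ring]; ring
    · rw [show s + (-1 - 1) = s - 2 by ring]; ring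
    · rw [show s + (1 - -1) = s + 2 by ring]; ring
    · rw [show s + (1 - 1) = s by ring]; ring
  simp only [h]
  rw [FinLaw.ev_add, FinLaw.ev_add, FinLaw.ev_const, FinLaw.ev_const_mul, FinLaw.ev_const_mul,
    ev_pairLaw_signDiff, sum_mul_coordFeature (fun x => qX.1 x - qY.1 x), symStep]
  ring

/-- A replacement argument: `i` steps of the true walk are followed by `l` symmetric steps of the
same second moment. With no true step left, oddness gives `0` at the origin. Each true step adds
`kΔ²/4` times the mean increment of `f` over an interval of length `4`, bounded below through a
second moment of at most `4m + (mkΔ)²`. The factor `Δ` makes the sign of the drift irrelevant. -/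
lemma mul_ev_iterate_blockSum_ge (hk : |k| ≤ 1) (hk0 : 0 ≤ k) (qX qY : ProbVec d) (j : Fin d)
    {a c : ℝ} (hc : 0 ≤ c) {f : ℝ → ℝ} (hodd : ∀ s, f (-s) = - f s)
    (hf : ∀ s, a - c * s ^ 2 ≤ f (s + 2) - f (s - 2)) {m : ℕ} (i l : ℕ) (hil : i + l ≤ m) :
    i * (k * (qX.1 j - qY.1 j) ^ 2 / 4 *
        (a - c * (4 * m + (m * (k * (qX.1 j - qY.1 j))) ^ 2))) ≤
      (qX.1 j - qY.1 j) * ((pairLaw hk (coordFeature d) qX qY).iid i).ev (fun h =>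
        (symStep ((pairLaw hk (coordFeature d) qX qY).ev fun a => signDiff a j ^ 2))^[l] f
          (blockSum h j)) := by
  set P := pairLaw hk (coordFeature d) qX qY with hP
  set v := P.ev fun a => signDiff a j ^ 2 with hv
  set δ := qX.1 j - qY.1 j with hδ
  have hv0 : 0 ≤ v := P.ev_nonneg fun a => sq_nonneg _
  have hv4 : v ≤ 4 := (P.ev_mono fun a => signDiff_sq_le a j).trans_eq (P.ev_const 4)
  induction i generalizing l with
  | zero =>
    have h0 : (symStep v)^[l] f 0 = 0 := by
      have := symStep_iterate_odd (v := v) hodd l 0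
      rw [neg_zero] at this; linarith
    rw [FinLaw.ev_iid_zero, blockSum_apply]
    simp [h0]
  | succ i ih =>
    have hstep := FinLaw.ev_iid_succ_comp P (fun a => signDiff a j) ((symStep v)^[l] f) i
    simp only [blockSum_apply] at ih ⊢
    rw [hstep]
    simp only [hP, ev_pairLaw_comp_add_signDiff]
    rw [← hP, ← hv, FinLaw.ev_add, FinLaw.ev_const_mul, ← hδ]
    have ih' := ih (l + 1) (by omega)
    simp only [Function.iterate_succ_apply'] at ih'
    have hil' : (i : ℝ) + 1 + l ≤ m := by exact_mod_cast hil
    have h2 : a - c * (4 * m + (m * (k * δ)) ^ 2) ≤ (P.iid i).ev (fun h =>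
        (symStep v)^[l] f (∑ i, signDiff (h i) j + 2) -
          (symStep v)^[l] f (∑ i, signDiff (h i) j - 2)) := by
      refine le_trans ?_ (FinLaw.ev_mono _ fun h => symStep_iterate_diff_ge hv0 hv4 hf l _)
      rw [FinLaw.ev_sub, FinLaw.ev_const, FinLaw.ev_const_mul, FinLaw.ev_add, FinLaw.ev_const]
      have h3 := var_blockSum_apply_le hk (coordFeature d) qX qY i j
      rw [FinLaw.var, ev_blockSum_coordFeature, ← hP, ← hδ] at h3
      simp only [blockSum_apply] at h3
      have h4 : ((i : ℝ) * (k * δ)) ^ 2 ≤ (m * (k * δ)) ^ 2 := by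
        rw [mul_pow, mul_pow (m : ℝ)]; gcongr; linarith [(Nat.cast_nonneg l : (0 : ℝ) ≤ l)]
      have h5 : v * l ≤ 4 * l := by gcongr
      have h6 : (P.iid i).ev (fun h => (∑ i, signDiff (h i) j) ^ 2) + v * l ≤
          4 * m + (m * (k * δ)) ^ 2 := by
        have : (0 : ℝ) ≤ i := Nat.cast_nonneg i
        linarith
      have := mul_le_mul_of_nonneg_left h6 hc
      linarith
    have h7 : 0 ≤ k * δ ^ 2 / 4 := by positivity
    have h8 := mul_le_mul_of_nonneg_left h2 h7
    push_cast
    rw [mul_add]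
    calc _ = i * (k * δ ^ 2 / 4 * (a - c * (4 * m + (m * (k * δ)) ^ 2))) +
          k * δ ^ 2 / 4 * (a - c * (4 * m + (m * (k * δ)) ^ 2)) := by ring
      _ ≤ _ := add_le_add ih' h8
      _ = _ := by ring

/-- A truncated walk keeps a mean proportional to its drift up to saturation at the truncation
level. No limit theorem is involved: the replacement argument treats a small drift, Chebyshev's
inequality a large one. -/
lemma mul_ev_clip_blockSum_ge (hk : |k| ≤ 1) (hk0 : 0 ≤ k) (qX qY : ProbVec d) {m : ℕ}
    (hm : 0 < m) (j : Fin d) :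
    √m / 16 * (|qX.1 j - qY.1 j| * min |k * √m * (qX.1 j - qY.1 j)| 256) ≤
      (qX.1 j - qY.1 j) * ((pairLaw hk (coordFeature d) qX qY).iid m).ev (fun h =>
        clip (256 * √m) (blockSum h j)) := by
  have hm1 : (1 : ℝ) ≤ m := by exact_mod_cast hm
  have hs1 : 1 ≤ √m := Real.one_le_sqrt.2 hm1
  have hs2 : √m ^ 2 = m := Real.sq_sqrt (by positivity)
  set σ := √(m : ℝ)
  set δ := qX.1 j - qY.1 j with hδ
  have hτ0 : 0 < 256 * σ := by positivity
  have hmu : (m * (k * δ)) = σ * (k * σ * δ) := by rw [← hs2]; ring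
  -- The regimes meet where the drift `m k δ` is a quarter of the truncation level, the condition
  -- needed by `mul_clip_ge`. For smaller drifts the quadratic penalty removes at most half of the
  -- increment `4`.
  rcases le_total |k * σ * δ| 64 with hu | hu
  · have h1 := mul_ev_iterate_blockSum_ge hk hk0 qX qY j (f := clip (256 * σ))
      (a := 4) (c := 4 / (256 * σ - 2) ^ 2) (by positivity) (clip_neg hτ0.le)
      (clip_add_sub_clip_sub_ge (by linarith)) (m := m) m 0 (by omega)
    simp only [Function.iterate_zero, id] at h1
    refine le_trans ?_ h1
    rw [← hδ, hmu, mul_pow, ← sq_abs (k * σ * δ), hs2]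
    have h2 : 4 / (256 * σ - 2) ^ 2 * (4 * m + m * |k * σ * δ| ^ 2) ≤ 2 := by
      have h3 : (128 * σ) ^ 2 ≤ (256 * σ - 2) ^ 2 := pow_le_pow_left₀ (by positivity) (by linarith) 2
      rw [mul_pow, hs2] at h3
      have h4 : |k * σ * δ| ^ 2 ≤ 64 ^ 2 := pow_le_pow_left₀ (abs_nonneg _) hu 2
      have h5 : (0 : ℝ) < (256 * σ - 2) ^ 2 := lt_of_lt_of_le (by positivity) h3
      rw [div_mul_eq_mul_div, div_le_iff₀ h5]
      nlinarith
    have h6 : σ * (|δ| * |k * σ * δ|) = m * (k * δ ^ 2) := by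
      rw [abs_mul, abs_mul, abs_of_nonneg hk0, abs_of_nonneg (by linarith : (0 : ℝ) ≤ σ), ← sq_abs δ,
        ← hs2]
      ring
    have h7 : 0 ≤ m * (k * δ ^ 2) := by positivity
    calc _ ≤ σ / 16 * (|δ| * |k * σ * δ|) := by gcongr; exact min_le_left _ _
      _ = m * (k * δ ^ 2) / 16 := by rw [← h6]; ring
      _ ≤ m * (k * δ ^ 2) / 4 * 2 := by linarith
      _ ≤ m * (k * δ ^ 2) / 4 * (4 - 4 / (256 * σ - 2) ^ 2 * (4 * m + m * |k * σ * δ| ^ 2)) := by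
        gcongr; linarith
      _ = _ := by ring
  · have hmu4 : 256 * σ / 4 ≤ |m * (k * δ)| := by
      rw [hmu, abs_mul, abs_of_nonneg (by linarith : (0 : ℝ) ≤ σ)]; nlinarith
    rw [← FinLaw.ev_const_mul]
    refine le_trans ?_ (FinLaw.ev_mono _ fun h => mul_clip_ge hτ0 (c := m * k) (by positivity)
      (by ring : m * (k * δ) = m * k * δ) hmu4 (blockSum h j))
    rw [FinLaw.ev_const_mul, FinLaw.ev_sub, FinLaw.ev_const, FinLaw.ev_const_mul, FinLaw.ev_sq_sub,
      ev_blockSum_coordFeature, ← hδ, sub_self]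
    have h1 := var_blockSum_apply_le hk (coordFeature d) qX qY m j
    set V := ((pairLaw hk (coordFeature d) qX qY).iid m).var fun h => blockSum h j
    have h2 : (4096 : ℝ) * m ≤ (m * (k * δ)) ^ 2 := by
      rw [← sq_abs]
      calc (4096 : ℝ) * m = (256 * σ / 4) ^ 2 := by rw [← hs2]; ring
        _ ≤ _ := pow_le_pow_left₀ (by positivity) hmu4 2
    have h3 : 0 < (m * (k * δ)) ^ 2 := lt_of_lt_of_le (by positivity) h2
    have h4 : 9 * (256 * σ) / 2 / (m * (k * δ)) ^ 2 * V ≤ 256 * σ / 16 := by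
      rw [div_mul_eq_mul_div, div_le_iff₀ h3]
      nlinarith
    have h5 : min |k * σ * δ| 256 ≤ 256 := min_le_right _ _
    calc _ ≤ σ / 16 * (|δ| * 256) := by gcongr
      _ = |δ| * (256 * σ / 8 - 256 * σ / 16) := by ring
      _ ≤ _ := by gcongr; linarith

/-! ### The adaptive statistic -/

/-- The feature of the second-stage channel, that reports the truncated block sum at the datum
through the sign of the entry `o`. -/
def clipFeature {τ : ℝ} (hτ : 0 < τ) (o : Fin d) (s : Fin d → ℝ) : SignFeature d :=
  ⟨fun x => clip τ (s x) / τ, fun _ => o, fun x => by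
    rw [abs_div, abs_of_pos hτ, div_le_one hτ]; exact abs_clip_le hτ.le _⟩

/-- The law of two blocks of pairs of views, of which the second is adapted to the first. -/
def adaptiveBlockLaw (hk : |k| ≤ 1) {τ : ℝ} (hτ : 0 < τ) (o : Fin d) (qX qY : ProbVec d) (m : ℕ) :
    FinLaw ((Fin m → (Fin d → Bool) × (Fin d → Bool)) × (Fin m → (Fin d → Bool) × (Fin d → Bool))) :=
  ((pairLaw hk (coordFeature d) qX qY).iid m).bind fun h =>
    (pairLaw hk (clipFeature hτ o (blockSum h)) qX qY).iid m

lemma ev_blockSum_clipFeature (hk : |k| ≤ 1) {τ : ℝ} (hτ : 0 < τ) (o : Fin d) (qX qY : ProbVec d)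
    (m : ℕ) (s : Fin d → ℝ) :
    ((pairLaw hk (clipFeature hτ o s) qX qY).iid m).ev (fun h => blockSum h o) =
      m * k / τ * ∑ x, (qX.1 x - qY.1 x) * clip τ (s x) := by
  rw [ev_blockSum_apply]
  simp only [clipFeature, if_true, mul_one, Finset.mul_sum]
  exact Finset.sum_congr rfl fun x _ => by ring

lemma ev_adaptiveBlockLaw (hk : |k| ≤ 1) {τ : ℝ} (hτ : 0 < τ) (o : Fin d) (qX qY : ProbVec d)
    (m : ℕ) : (adaptiveBlockLaw hk hτ o qX qY m).ev (fun x => blockSum x.2 o) =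
      m * k / τ * ∑ j, (qX.1 j - qY.1 j) *
        ((pairLaw hk (coordFeature d) qX qY).iid m).ev (fun h => clip τ (blockSum h j)) := by
  rw [adaptiveBlockLaw, FinLaw.ev_bind]
  simp only [ev_blockSum_clipFeature, FinLaw.ev_const_mul, FinLaw.ev_sum]

/-- The noise of the second half contributes `2m`. The conditional mean is a sum of `1`-Lipschitz
functions of the first block sum weighted by `Δ`, so it obeys the variance bound of the linear form.
-/
lemma var_adaptiveBlockLaw_le (hk : |k| ≤ 1) {τ : ℝ} (hτ : 0 < τ) (o : Fin d) (qX qY : ProbVec d)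
    (m : ℕ) : (adaptiveBlockLaw hk hτ o qX qY m).var (fun x => blockSum x.2 o) ≤
      2 * m + (m * k / τ) ^ 2 * (m * (2 * ∑ j, (qX.1 j - qY.1 j) ^ 2)) := by
  rw [adaptiveBlockLaw, FinLaw.var_bind]
  simp only [ev_blockSum_clipFeature, FinLaw.var_const_mul]
  refine add_le_add ?_ (mul_le_mul_of_nonneg_left ?_ (sq_nonneg _))
  · exact (FinLaw.ev_mono _ fun h => var_blockSum_apply_le hk _ qX qY m o).trans_eq
      (FinLaw.ev_const _ _)
  · exact var_blockSum_le hk (coordFeature d) qX qY m (fun j s => (qX.1 j - qY.1 j) * clip τ s)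
      (fun j => qX.1 j - qY.1 j) fun j s t => by
        rw [← mul_sub, abs_mul]
        exact mul_le_mul_of_nonneg_left (abs_clip_sub_clip_le τ s t) (abs_nonneg _)

lemma adaptiveBlockLaw_null_error (hk : |k| ≤ 1) {τ : ℝ} (hτ : 0 < τ) (o : Fin d) {m : ℕ}
    (hm : 0 < m) (q : ProbVec d) : (adaptiveBlockLaw hk hτ o q q m).ev (fun x =>
      if decide (6 * √m ≤ blockSum x.2 o) then 1 else 0) ≤ 1 / 16 := by
  have hm0 : (0 : ℝ) < m := by exact_mod_cast hm
  have he := ev_adaptiveBlockLaw hk hτ o q q m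
  have hv := var_adaptiveBlockLaw_le hk hτ o q q m
  simp only [sub_self, ne_eq, OfNat.ofNat_ne_zero, not_false_eq_true, zero_pow, zero_mul,
    Finset.sum_const_zero, mul_zero, add_zero] at he hv
  -- Under the null the mean is zero and the variance at most `2m`, so Chebyshev gives `2/36`.
  refine (FinLaw.ev_indicator_le_var_div _ (fun x => blockSum x.2 o) (r := 6 * √m) (by positivity) _
    fun x hx => ?_).trans ?_
  · rw [he, sub_zero]
    exact (of_decide_eq_true hx).trans (le_abs_self _)
  · rw [div_le_iff₀ (by positivity), mul_pow, Real.sq_sqrt hm0.le]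
    linarith

lemma adaptiveBlockLaw_alternative_error (hk : |k| ≤ 1) (hk0 : 0 ≤ k) (o : Fin d) {m : ℕ}
    (hm : 0 < m) (hτ : 0 < 256 * √m) (qX qY : ProbVec d)
    (h : 256 ≤ k * √m * √(∑ j, (qX.1 j - qY.1 j) ^ 2)) :
    (adaptiveBlockLaw hk hτ o qX qY m).ev (fun x =>
      if !decide (6 * √m ≤ blockSum x.2 o) then 1 else 0) ≤ 1 / 16 := by
  have hm0 : (0 : ℝ) < m := by exact_mod_cast hm
  have he := ev_adaptiveBlockLaw hk hτ o qX qY m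
  have hv := var_adaptiveBlockLaw_le hk hτ o qX qY m
  have hs2 : √m ^ 2 = m := Real.sq_sqrt (by positivity)
  set σ := √(m : ℝ)
  set Δ : Fin d → ℝ := fun j => qX.1 j - qY.1 j with hΔ
  have hD : 0 ≤ ∑ j, Δ j ^ 2 := Finset.sum_nonneg fun j _ => sq_nonneg _
  set D := √(∑ j, Δ j ^ 2) with hDdef
  have hD2 : D ^ 2 = ∑ j, Δ j ^ 2 := Real.sq_sqrt hD
  have hσ : 0 < σ := by linarith
  set N := k * σ * D with hN
  have hN0 : 0 < N := by linarith
  have hkσ : 0 < k * σ := by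
    rcases (mul_nonneg hk0 hσ.le).eq_or_lt with h0 | h0
    · rw [hN, ← h0] at hN0; simp at hN0
    · exact h0
  have hD0 : 0 < D := by
    rcases (Real.sqrt_nonneg (∑ j, Δ j ^ 2)).eq_or_lt with h0 | h0
    · rw [hN, hDdef, ← h0] at hN0; simp at hN0
    · exact h0
  have hmean : σ * N / 16 ≤ (adaptiveBlockLaw hk hτ o qX qY m).ev (fun x => blockSum x.2 o) := by
    rw [he]
    -- Both entries of the minimum are at least `256 |Δ j| / D`: the first because `k σ D ≥ 256`,
    -- the second because `|Δ j| ≤ D`. Summing over `j` then gives a bound linear in `D`.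
    have h1 : ∀ j, σ / 16 * (Δ j ^ 2 * (256 / D)) ≤
        Δ j * ((pairLaw hk (coordFeature d) qX qY).iid m).ev
          (fun h => clip (256 * σ) (blockSum h j)) := by
      intro j
      refine le_trans ?_ (mul_ev_clip_blockSum_ge hk hk0 qX qY hm j)
      have hle : |Δ j| ≤ D :=
        Real.abs_le_sqrt (Finset.single_le_sum (f := fun j => Δ j ^ 2) (fun i _ => sq_nonneg _)
          (Finset.mem_univ j))
      refine mul_le_mul_of_nonneg_left ?_ (by positivity)
      rw [← sq_abs (Δ j), sq, mul_assoc]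
      refine mul_le_mul_of_nonneg_left (le_min ?_ ?_) (abs_nonneg _)
      · rw [abs_mul, abs_of_pos hkσ, mul_comm]
        refine mul_le_mul_of_nonneg_right ?_ (abs_nonneg _)
        rw [div_le_iff₀ hD0]; exact h
      · rw [← mul_div_assoc, div_le_iff₀ hD0]; nlinarith
    calc σ * N / 16 = m * k / (256 * σ) * ∑ j, σ / 16 * (Δ j ^ 2 * (256 / D)) := by
          rw [← Finset.mul_sum, ← Finset.sum_mul, ← hD2, ← hs2, hN]; field_simp
      _ ≤ _ := mul_le_mul_of_nonneg_left (Finset.sum_le_sum fun j _ => h1 j) (by positivity)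
  have hvar : (adaptiveBlockLaw hk hτ o qX qY m).var (fun x => blockSum x.2 o) ≤
      4 * (σ * N / 256) ^ 2 := by
    refine hv.trans ?_
    have h1 : (m * k / (256 * σ)) ^ 2 * (m * (2 * ∑ j, Δ j ^ 2)) = 2 * (σ * N / 256) ^ 2 := by
      rw [← hD2, ← hs2, hN]; field_simp
    rw [h1]
    have h2 : (m : ℝ) ≤ (σ * N / 256) ^ 2 := by
      rw [← hs2]
      refine pow_le_pow_left₀ hσ.le ?_ 2
      rw [le_div_iff₀ (by norm_num)]
      exact mul_le_mul_of_nonneg_left h hσ.le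
    linarith
  -- The mean is at least `σN/16`, and since `N ≥ 256` half of it exceeds the threshold `6σ`.
  -- Chebyshev gives `4 * (32/256)² = 1/16`.
  refine (FinLaw.ev_indicator_le_var_div _ (fun x => blockSum x.2 o) (r := σ * N / 32)
    (by positivity) _ fun x hx => ?_).trans ?_
  · simp only [Bool.not_eq_true', decide_eq_false_iff_not, not_le] at hx
    rw [abs_sub_comm]
    refine le_trans ?_ (le_abs_self _)
    nlinarith
  · rw [div_le_iff₀ (by positivity)]
    refine hvar.trans_eq ?_
    ring

end LDPTest

end

noncomputable section

namespace LDPTest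

variable {d : ℕ} {k : ℝ}

/-! ### Finite laws as measures -/

namespace FinLaw

variable {Ω : Type*} [Fintype Ω] [MeasurableSpace Ω]

/-- The measure with the given weights. -/
def toMeasure (P : FinLaw Ω) : Measure Ω := ∑ a, ENNReal.ofReal (P.1 a) • Measure.dirac a

instance (P : FinLaw Ω) : IsProbabilityMeasure P.toMeasure := by
  constructor
  have h : ∑ a, ENNReal.ofReal (P.1 a) = 1 := by
    rw [← ENNReal.ofReal_sum_of_nonneg (fun a _ => P.2.1 a), P.2.2, ENNReal.ofReal_one]
  simpa [toMeasure] using h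

lemma toMeasure_singleton [MeasurableSingletonClass Ω] (P : FinLaw Ω) (a : Ω) :
    P.toMeasure {a} = ENNReal.ofReal (P.1 a) := by
  classical
  simp only [toMeasure, Measure.coe_finsetSum, Finset.sum_apply, Measure.smul_apply,
    Measure.dirac_apply, smul_eq_mul]
  rw [Finset.sum_eq_single a]
  · simp
  · intro b _ hb; simp [hb]
  · simp

lemma toMeasure_le_mul {P P' : FinLaw Ω} {c : ℝ} (hc : 0 ≤ c) (h : ∀ a, P.1 a ≤ c * P'.1 a)
    (S : Set Ω) : P.toMeasure S ≤ ENNReal.ofReal c * P'.toMeasure S := by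
  simp only [toMeasure, Measure.coe_finsetSum, Finset.sum_apply, Measure.smul_apply,
    smul_eq_mul, Finset.mul_sum, ← mul_assoc, ← ENNReal.ofReal_mul hc]
  gcongr with a
  exact h a

end FinLaw

/-- The weights lie between `1 - ε/4` and `1 + ε/4`, and `1 + ε/4 ≤ (1 + ε)(1 - ε/4)` for `ε ≤ 1`.
-/
lemma signLaw_le_exp_mul {ε : ℝ} (hε : 0 < ε) (hε1 : ε ≤ 1) (hk : |ε / 4| ≤ 1) (F : SignFeature d)
    (x x' : Fin d) (v : Fin d → Bool) :
    (signLaw hk F x).1 v ≤ Real.exp ε * (signLaw hk F x').1 v := by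
  have h1 := (abs_le.1 (F.abs_tilt_le (ε / 4) x v)).2
  have h2 := (abs_le.1 (F.abs_tilt_le (ε / 4) x' v)).1
  have h3 := Real.add_one_le_exp ε
  rw [abs_of_pos (by linarith)] at h1 h2
  simp only [signLaw]
  rw [← mul_div_assoc]
  gcongr
  calc _ ≤ 1 + ε / 4 := by linarith
    _ ≤ (ε + 1) * (1 - ε / 4) := by nlinarith
    _ ≤ Real.exp ε * (1 + ε / 4 * (F.coef x' * sgn (v (F.idx x')))) := by
      gcongr
      · linarith
      · linarith

section Kernels

variable {H : Type} [MeasurableSpace H] [Countable H] [MeasurableSingletonClass H]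

/-- The channel whose sign feature depends on the past views. -/
def signKernel (hk : |k| ≤ 1) (F : H → SignFeature d) : Kernel (Fin d × H) (Fin d → Bool) :=
  ⟨fun x => (signLaw hk (F x.2) x.1).toMeasure, Measurable.of_discrete⟩

instance (hk : |k| ≤ 1) (F : H → SignFeature d) : IsMarkovKernel (signKernel hk F) :=
  ⟨fun x => inferInstanceAs (IsProbabilityMeasure (signLaw hk (F x.2) x.1).toMeasure)⟩

lemma isLDPChannel_signKernel {ε : ℝ} (hε : 0 < ε) (hε1 : ε ≤ 1) (hk : |ε / 4| ≤ 1)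
    (F : H → SignFeature d) : IsLDPChannel ε (signKernel hk F) :=
  fun x x' h S _ => FinLaw.toMeasure_le_mul (Real.exp_pos ε).le
    (fun v => signLaw_le_exp_mul hε hε1 hk (F h) x x' v) S

lemma sum_ofReal_mul_signLaw (hk : |k| ≤ 1) (F : SignFeature d) (q : ProbVec d) (v : Fin d → Bool) :
    ∑ x, ENNReal.ofReal (q.1 x) * (signLaw hk F x).toMeasure {v} =
      ENNReal.ofReal ((viewLaw hk F q).1 v) := by
  simp only [FinLaw.toMeasure_singleton, ← ENNReal.ofReal_mul (q.2.1 _)]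
  rw [← ENNReal.ofReal_sum_of_nonneg fun x _ => mul_nonneg (q.2.1 x) ((signLaw hk F x).2.1 v)]
  rfl

lemma privateView_signKernel (hk : |k| ≤ 1) (F : H → SignFeature d) (q : ProbVec d) (h : H)
    (v : Fin d → Bool) : privateView q.toMeasure (signKernel hk F) h {v} =
      ENNReal.ofReal ((viewLaw hk (F h) q).1 v) := by
  rw [privateView_apply, ← sum_ofReal_mul_signLaw]
  simp only [Measure.coe_finsetSum, Finset.sum_apply, Measure.smul_apply, smul_eq_mul]
  rfl

lemma prod_privateView_signKernel (hk : |k| ≤ 1) (F : H → SignFeature d) (qX qY : ProbVec d) (h : H)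
    (a : (Fin d → Bool) × (Fin d → Bool)) :
    (privateView qX.toMeasure (signKernel hk F) ×ₖ privateView qY.toMeasure (signKernel hk F)) h {a} =
      ENNReal.ofReal ((pairLaw hk (F h) qX qY).1 a) := by
  rw [Kernel.prod_apply, ← Set.singleton_prod_singleton (a := a.1) (b := a.2), Measure.prod_prod,
    privateView_signKernel, privateView_signKernel, ← ENNReal.ofReal_mul ((viewLaw hk _ _).2.1 _)]
  rfl

end Kernels

/-! ### Probabilities of cylinders -/

/-- On the cylinder the past is fixed, so each kernel is evaluated at one history; the coordinates
beyond `N` integrate to one. -/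
lemma sequentialLaw_cylinder {H α : Type} [MeasurableSpace H] [MeasurableSpace α] [Finite α]
    [MeasurableSingletonClass α] (κ : (i : ℕ) → Kernel (H × (Fin i → α)) α)
    (hκ : ∀ i, IsMarkovKernel (κ i)) (a : H) (h : ℕ → α) {N n : ℕ} (hN : N ≤ n) :
    sequentialLaw n (fun i _ => κ i) a {ω | ∀ i : Fin n, (i : ℕ) < N → ω i = h i} =
      ∏ i ∈ Finset.range N, κ i (a, fun l => h l) {h i} := by
  induction n generalizing N with
  | zero =>
    obtain rfl : N = 0 := by omega
    have := isMarkovKernel_sequentialLaw (H := H) 0 (fun i _ => κ i) fun i _ => hκ i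
    simp
  | succ n ih =>
    have hM := isMarkovKernel_sequentialLaw (H := H) n (fun i _ => κ i) fun i _ => hκ i
    have := hκ n
    rw [sequentialLaw_succ_apply n _ (fun i _ => hκ i), Measure.map_apply (measurable_snoc n)
      MeasurableSet.of_discrete]
    rcases Nat.lt_or_ge n N with hn | hn
    · obtain rfl : N = n + 1 := by omega
      have hset : (fun x : (Fin n → α) × α => (Fin.snoc (α := fun _ => α) x.1 x.2 : Fin (n + 1) → α)) ⁻¹'
          {ω | ∀ i : Fin (n + 1), (i : ℕ) < n + 1 → ω i = h i} =
          {ω : Fin n → α | ∀ i : Fin n, (i : ℕ) < n → ω i = h i} ×ˢ {h n} := by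
        ext x
        simp [Fin.forall_fin_succ']
      have hset' : {ω : Fin n → α | ∀ i : Fin n, (i : ℕ) < n → ω i = h i} =
          {fun i : Fin n => h i} := by
        ext ω; simp [funext_iff]
      rw [hset, Measure.compProd_apply_prod MeasurableSet.of_discrete MeasurableSet.of_discrete,
        Finset.prod_range_succ, ← ih le_rfl, hset', lintegral_singleton, mul_comm]
      rfl
    · have hset : (fun x : (Fin n → α) × α => (Fin.snoc (α := fun _ => α) x.1 x.2 : Fin (n + 1) → α)) ⁻¹'
          {ω | ∀ i : Fin (n + 1), (i : ℕ) < N → ω i = h i} =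
          {ω : Fin n → α | ∀ i : Fin n, (i : ℕ) < N → ω i = h i} ×ˢ Set.univ := by
        ext x
        simp [Fin.forall_fin_succ', Nat.not_lt.2 hn]
      rw [hset, Measure.compProd_apply_prod MeasurableSet.of_discrete MeasurableSet.univ, ← ih hn]
      simp

lemma pi_cylinder {α : Type*} [MeasurableSpace α] (μ : Measure α) [IsProbabilityMeasure μ]
    {N n : ℕ} (hN : N ≤ n) (x : Fin n → α) :
    Measure.pi (fun _ : Fin n => μ) {ω | ∀ i : Fin N, ω (Fin.castLE hN i) = x (Fin.castLE hN i)} =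
      ∏ i : Fin N, μ {x (Fin.castLE hN i)} := by
  obtain ⟨r, rfl⟩ := Nat.exists_eq_add_of_le hN
  have hset : {ω : Fin (N + r) → α | ∀ i : Fin N, ω (Fin.castLE hN i) = x (Fin.castLE hN i)} =
      Set.univ.pi (Fin.append (fun i => {x (Fin.castLE hN i)}) fun _ => Set.univ) := by
    ext ω
    simp only [Set.mem_ofPred_eq, Set.mem_univ_pi]
    constructor
    · intro h i
      refine Fin.addCases (fun j => ?_) (fun j => ?_) i
      · rw [Fin.append_left]; exact h j
      · simp
    · intro h i
      have := h (Fin.castAdd r i)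
      rwa [Fin.append_left] at this
  rw [hset, Measure.pi_pi, Fin.prod_univ_add]
  simp

/-! ### Majority votes over blocks -/

/-- Bounds on the atoms at attained values suffice: an unattained value has an empty preimage. The
mechanisms thus need only their cylinder probabilities, without identifying the whole law of `r`. -/
lemma measure_comp_le {X γ : Type*} [MeasurableSpace X] [Fintype γ] (μ : Measure X) (r : X → γ)
    (P : FinLaw γ) (h : ∀ ω₀, μ {ω | r ω = r ω₀} ≤ ENNReal.ofReal (P.1 (r ω₀))) (p : γ → Prop)
    [DecidablePred p] :
    μ {ω | p (r ω)} ≤ ENNReal.ofReal (P.ev fun c => if p c then 1 else 0) := by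
  have hsub : {ω | p (r ω)} ⊆ ⋃ c ∈ Finset.univ.filter p, {ω | r ω = c} := by
    intro ω hω
    simp only [Finset.mem_filter, Finset.mem_univ, true_and, Set.mem_iUnion, Set.mem_ofPred_eq,
      exists_prop, exists_eq_right']
    exact hω
  refine (measure_mono hsub).trans ((measure_biUnion_finset_le _ _).trans ?_)
  have hle : ∀ c, μ {ω | r ω = c} ≤ ENNReal.ofReal (P.1 c) := by
    intro c
    rcases Set.eq_empty_or_nonempty {ω | r ω = c} with he | ⟨ω₀, rfl⟩
    · rw [he]; simp
    · exact h ω₀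
  refine (Finset.sum_le_sum fun c _ => hle c).trans_eq ?_
  rw [← ENNReal.ofReal_sum_of_nonneg fun c _ => P.2.1 c, Finset.sum_filter]
  congr 1
  exact Finset.sum_congr rfl fun c _ => by by_cases hc : p c <;> simp [hc]

/-- Reject if at least half of the blocks do. -/
def majority {γ : Type*} {B : ℕ} (rej : γ → Bool) (g : Fin B → γ) : Bool :=
  decide (B ≤ 2 * (Finset.univ.filter fun b => rej (g b) = true).card)

lemma measure_majority_true_le {X γ : Type*} [MeasurableSpace X] [Fintype γ] {B : ℕ}
    (μ : Measure X) (r : X → Fin B → γ) (P : FinLaw γ)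
    (h : ∀ ω₀, μ {ω | r ω = r ω₀} ≤ ENNReal.ofReal ((P.iid B).1 (r ω₀))) (rej : γ → Bool)
    (herr : P.ev (fun a => if rej a then 1 else 0) ≤ 1 / 16) :
    μ {ω | majority rej (r ω) = true} ≤ ENNReal.ofReal ((1 / 2) ^ B) := by
  simp only [majority, decide_eq_true_eq]
  exact (measure_comp_le μ r (P.iid B) h fun g =>
    B ≤ 2 * (Finset.univ.filter fun b => rej (g b) = true).card).trans
      (ENNReal.ofReal_le_ofReal (P.ev_iid_majority_le rej B herr))

lemma measure_majority_false_le {X γ : Type*} [MeasurableSpace X] [Fintype γ] {B : ℕ}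
    (μ : Measure X) (r : X → Fin B → γ) (P : FinLaw γ)
    (h : ∀ ω₀, μ {ω | r ω = r ω₀} ≤ ENNReal.ofReal ((P.iid B).1 (r ω₀))) (rej : γ → Bool)
    (herr : P.ev (fun a => if !rej a then 1 else 0) ≤ 1 / 16) :
    μ {ω | majority rej (r ω) = false} ≤ ENNReal.ofReal ((1 / 2) ^ B) := by
  refine le_trans (measure_mono fun ω hω => ?_)
    (measure_majority_true_le μ r P h (fun a => !rej a) herr)
  simp only [majority, Set.mem_ofPred_eq, decide_eq_false_iff_not, not_le, decide_eq_true_eq] at hω ⊢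
  have hc := Finset.card_filter_add_card_filter_not (s := (Finset.univ : Finset (Fin B)))
    (fun b => rej (r ω b) = true)
  simp only [Finset.card_univ, Fintype.card_fin, Bool.not_eq_true] at hc
  simp only [Bool.not_eq_true']
  omega

/-- The division of a sequence into `B` blocks, each with two halves of length `m`. -/
def blocks {α : Type*} {B m : ℕ} (x : Fin (B * (m + m)) → α) (b : Fin B) :
    (Fin m → α) × (Fin m → α) :=
  (fun l => x (finProdFinEquiv (b, Fin.castAdd m l)), fun l => x (finProdFinEquiv (b, Fin.natAdd m l)))

lemma blocks_injective {α : Type*} {B m : ℕ} :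
    Function.Injective (blocks : (Fin (B * (m + m)) → α) → _) := by
  intro x y h
  ext i
  obtain ⟨⟨b, l⟩, rfl⟩ := finProdFinEquiv.surjective i
  have hb := congrFun h b
  refine Fin.addCases (fun l => ?_) (fun l => ?_) l
  · exact congrFun (congrArg Prod.fst hb) l
  · exact congrFun (congrArg Prod.snd hb) l

lemma prod_blocks {M : Type*} [CommMonoid M] {B m : ℕ} (f : Fin (B * (m + m)) → M) :
    ∏ i, f i = ∏ b : Fin B, (∏ l : Fin m, f (finProdFinEquiv (b, Fin.castAdd m l))) *
      ∏ l : Fin m, f (finProdFinEquiv (b, Fin.natAdd m l)) := by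
  rw [← finProdFinEquiv.prod_comp, Fintype.prod_prod_type]
  exact Finset.prod_congr rfl fun b _ => Fin.prod_univ_add _

end LDPTest

end

noncomputable section

namespace LDPTest

variable {d : ℕ} {k : ℝ}

/-! ### The non-interactive mechanism -/

/-- The non-interactive mechanism with the channels of `coordFeature`. -/
def signMechanism (d n₁ n₂ : ℕ) (hk : |k| ≤ 1) :
    NonInteractive d n₁ n₂ (Fin d → Bool) (Fin d → Bool) where
  QX _ := ⟨fun x => (signLaw hk (coordFeature d) x).toMeasure, Measurable.of_discrete⟩
  QY _ := ⟨fun x => (signLaw hk (coordFeature d) x).toMeasure, Measurable.of_discrete⟩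
  markovX _ := ⟨fun x =>
    inferInstanceAs (IsProbabilityMeasure (signLaw hk (coordFeature d) x).toMeasure)⟩
  markovY _ := ⟨fun x =>
    inferInstanceAs (IsProbabilityMeasure (signLaw hk (coordFeature d) x).toMeasure)⟩

lemma isLDP_signMechanism {n₁ n₂ : ℕ} {ε : ℝ} (hε : 0 < ε) (hε1 : ε ≤ 1) (hk : |ε / 4| ≤ 1) :
    (signMechanism d n₁ n₂ hk).IsLDP ε :=
  ⟨fun _ x x' S _ => FinLaw.toMeasure_le_mul (Real.exp_pos ε).le
      (fun v => signLaw_le_exp_mul hε hε1 hk (coordFeature d) x x' v) S,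
    fun _ x x' S _ => FinLaw.toMeasure_le_mul (Real.exp_pos ε).le
      (fun v => signLaw_le_exp_mul hε hε1 hk (coordFeature d) x x' v) S⟩

lemma law_signMechanism (hk : |k| ≤ 1) (n₁ n₂ : ℕ) (qX qY : ProbVec d) :
    (signMechanism d n₁ n₂ hk).law qX qY =
      (Measure.pi fun _ => (viewLaw hk (coordFeature d) qX).toMeasure).prod
        (Measure.pi fun _ => (viewLaw hk (coordFeature d) qY).toMeasure) := by
  have h : ∀ q : ProbVec d, (⟨fun x => (signLaw hk (coordFeature d) x).toMeasure,
      Measurable.of_discrete⟩ : Kernel (Fin d) (Fin d → Bool)) ∘ₘ q.toMeasure =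
        (viewLaw hk (coordFeature d) q).toMeasure := by
    intro q
    refine Measure.ext_of_singleton fun v => ?_
    rw [bind_toMeasure, FinLaw.toMeasure_singleton, ← sum_ofReal_mul_signLaw]
    simp only [Measure.coe_finsetSum, Finset.sum_apply, Measure.smul_apply, smul_eq_mul]
    rfl
  simp only [NonInteractive.law, signMechanism, h]

/-- The blocks of the first pairs of views of the non-interactive mechanism. -/
def pairBlocks {α : Type*} {n₁ n₂ B m : ℕ} (hN : B * (m + m) ≤ n₁) (h12 : n₁ ≤ n₂)
    (ω : (Fin n₁ → α) × (Fin n₂ → α)) : Fin B → (Fin m → α × α) × (Fin m → α × α) :=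
  blocks fun i => (ω.1 (Fin.castLE hN i), ω.2 (Fin.castLE (hN.trans h12) i))

lemma law_signMechanism_pairBlocks (hk : |k| ≤ 1) {n₁ n₂ B m : ℕ} (hN : B * (m + m) ≤ n₁)
    (h12 : n₁ ≤ n₂) (qX qY : ProbVec d) (ω₀ : (Fin n₁ → Fin d → Bool) × (Fin n₂ → Fin d → Bool)) :
    (signMechanism d n₁ n₂ hk).law qX qY {ω | pairBlocks hN h12 ω = pairBlocks hN h12 ω₀} ≤
      ENNReal.ofReal (((twoBlockLaw hk qX qY m).iid B).1 (pairBlocks hN h12 ω₀)) := by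
  have hsub : {ω | pairBlocks hN h12 ω = pairBlocks hN h12 ω₀} ⊆
      {z | ∀ i, z (Fin.castLE hN i) = ω₀.1 (Fin.castLE hN i)} ×ˢ
        {w | ∀ i, w (Fin.castLE (hN.trans h12) i) = ω₀.2 (Fin.castLE (hN.trans h12) i)} := by
    intro ω hω
    have h := blocks_injective hω
    exact ⟨fun i => congrArg Prod.fst (congrFun h i), fun i => congrArg Prod.snd (congrFun h i)⟩
  refine (measure_mono hsub).trans_eq ?_
  rw [law_signMechanism, Measure.prod_prod, pi_cylinder, pi_cylinder, ← Finset.prod_mul_distrib]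
  simp only [FinLaw.toMeasure_singleton, ← ENNReal.ofReal_mul ((viewLaw hk _ _).2.1 _)]
  rw [← ENNReal.ofReal_prod_of_nonneg fun i _ =>
    mul_nonneg ((viewLaw hk _ _).2.1 _) ((viewLaw hk _ _).2.1 _), prod_blocks]
  rfl

/-! ### The interactive mechanism -/

/-- The channel at time `i`: in the first half of each block the views do not depend on the past,
in the second half they depend on the first half. -/
def adaptiveFeature {τ : ℝ} (hτ : 0 < τ) (o : Fin d) (m i : ℕ)
    (x : Fin i → (Fin d → Bool) × (Fin d → Bool)) : SignFeature d :=
  if i % (m + m) < m then coordFeature d else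
    clipFeature hτ o (blockSum fun l : Fin m =>
      -- In the second half of a block the whole first half lies in the past, so the default value
      -- is never taken.
      if hl : (m + m) * (i / (m + m)) + l < i then x ⟨_, hl⟩ else default)

/-- The interactive mechanism whose channels in the second half of each block are adapted to the
views in the first half. -/
def adaptiveMechanism (n₁ n₂ : ℕ) (hk : |k| ≤ 1) {τ : ℝ} (hτ : 0 < τ) (o : Fin d) (m : ℕ) :
    Interactive d n₁ n₂ (Fin d → Bool) (Fin d → Bool) where
  QX i := signKernel hk (adaptiveFeature hτ o m i)
  QY i := signKernel hk (adaptiveFeature hτ o m i)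
  QYtail _ := signKernel hk fun _ => coordFeature d
  markovX _ := inferInstance
  markovY _ := inferInstance
  markovYtail _ := inferInstance

lemma isLDP_adaptiveMechanism {n₁ n₂ : ℕ} {ε : ℝ} (hε : 0 < ε) (hε1 : ε ≤ 1) (hk : |ε / 4| ≤ 1)
    {τ : ℝ} (hτ : 0 < τ) (o : Fin d) (m : ℕ) :
    (adaptiveMechanism n₁ n₂ hk hτ o m).IsLDP ε := by
  refine ⟨fun i => ?_, fun i => ?_, fun j => ?_⟩
  · exact isLDPChannel_signKernel hε hε1 hk (adaptiveFeature hτ o m i)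
  · exact isLDPChannel_signKernel hε hε1 hk (adaptiveFeature hτ o m i)
  · exact isLDPChannel_signKernel hε hε1 hk fun _ => coordFeature d

lemma law_adaptiveMechanism_cylinder (hk : |k| ≤ 1) {τ : ℝ} (hτ : 0 < τ) (o : Fin d) (m : ℕ)
    {n₁ n₂ N : ℕ} (hN : N ≤ n₁) (qX qY : ProbVec d) (h : ℕ → (Fin d → Bool) × (Fin d → Bool)) :
    (adaptiveMechanism n₁ n₂ hk hτ o m).law qX qY
        ({z | ∀ i : Fin n₁, (i : ℕ) < N → z i = h i} ×ˢ Set.univ) =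
      ∏ i : Fin N, ENNReal.ofReal
        ((pairLaw hk (adaptiveFeature hτ o m i fun l => h l) qX qY).1 (h i)) := by
  have hM := isMarkovKernel_sequentialLaw (n₂ - n₁) (fun j hj => privateView qY.toMeasure
    ((adaptiveMechanism n₁ n₂ hk hτ o m).QYtail ⟨j, hj⟩)) fun j hj => by
      have := (adaptiveMechanism n₁ n₂ hk hτ o m).markovYtail ⟨j, hj⟩
      infer_instance
  have hM' := isMarkovKernel_sequentialLaw (H := Unit) n₁ (fun i hi => Kernel.prodMkLeft Unit
    (privateView qX.toMeasure ((adaptiveMechanism n₁ n₂ hk hτ o m).QX ⟨i, hi⟩) ×ₖ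
      privateView qY.toMeasure ((adaptiveMechanism n₁ n₂ hk hτ o m).QY ⟨i, hi⟩))) fun i hi => by
      have := (adaptiveMechanism n₁ n₂ hk hτ o m).markovX ⟨i, hi⟩
      have := (adaptiveMechanism n₁ n₂ hk hτ o m).markovY ⟨i, hi⟩
      infer_instance
  rw [Interactive.law, Measure.compProd_apply_prod MeasurableSet.of_discrete MeasurableSet.univ]
  simp only [measure_univ, lintegral_const, one_mul, Measure.restrict_apply, MeasurableSet.univ,
    Set.univ_inter]
  have key := sequentialLaw_cylinder (H := Unit) (fun i => Kernel.prodMkLeft Unit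
    (privateView qX.toMeasure (signKernel hk (adaptiveFeature hτ o m i)) ×ₖ
      privateView qY.toMeasure (signKernel hk (adaptiveFeature hτ o m i))))
    (fun i => inferInstance) () h hN
  refine key.trans ?_
  rw [Finset.prod_range]
  refine Finset.prod_congr rfl fun i _ => ?_
  rw [Kernel.prodMkLeft_apply, prod_privateView_signKernel]

lemma adaptiveFeature_first {τ : ℝ} (hτ : 0 < τ) (o : Fin d) {m b l : ℕ} (hl : l < m)
    (x : Fin (l + (m + m) * b) → (Fin d → Bool) × (Fin d → Bool)) :
    adaptiveFeature hτ o m (l + (m + m) * b) x = coordFeature d := by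
  rw [adaptiveFeature, if_pos]
  rw [Nat.add_mul_mod_self_left, Nat.mod_eq_of_lt (by omega)]
  exact hl

lemma adaptiveFeature_second {τ : ℝ} (hτ : 0 < τ) (o : Fin d) {m b l : ℕ} (hl : l < m)
    (h : ℕ → (Fin d → Bool) × (Fin d → Bool)) :
    adaptiveFeature hτ o m (m + l + (m + m) * b) (fun l => h l) =
      clipFeature hτ o (blockSum fun l : Fin m => h (l + (m + m) * b)) := by
  have h1 : (m + l + (m + m) * b) % (m + m) = m + l := by
    rw [Nat.add_mul_mod_self_left, Nat.mod_eq_of_lt (by omega)]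
  have h2 : (m + l + (m + m) * b) / (m + m) = b := by
    rw [Nat.add_mul_div_left _ _ (by omega), Nat.div_eq_of_lt (by omega), zero_add]
  rw [adaptiveFeature, if_neg (by omega)]
  congr 2
  ext1 i
  rw [dif_pos (by rw [h2]; omega)]
  simp only [h2]
  rw [add_comm]

/-- The blocks of the first pairs of views of the interactive mechanism. -/
def viewBlocks {α : Type*} {n₁ B m : ℕ} (hN : B * (m + m) ≤ n₁) (z : Fin n₁ → α) :
    Fin B → (Fin m → α) × (Fin m → α) :=
  blocks fun i => z (Fin.castLE hN i)

lemma law_adaptiveMechanism_viewBlocks (hk : |k| ≤ 1) {τ : ℝ} (hτ : 0 < τ) (o : Fin d)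
    {n₁ n₂ B m : ℕ} (hN : B * (m + m) ≤ n₁) (qX qY : ProbVec d)
    (ω₀ : (Fin n₁ → (Fin d → Bool) × (Fin d → Bool)) × (Fin (n₂ - n₁) → Fin d → Bool)) :
    (adaptiveMechanism n₁ n₂ hk hτ o m).law qX qY {ω | viewBlocks hN ω.1 = viewBlocks hN ω₀.1} ≤
      ENNReal.ofReal (((adaptiveBlockLaw hk hτ o qX qY m).iid B).1 (viewBlocks hN ω₀.1)) := by
  -- Total extension of the views, as `law_adaptiveMechanism_cylinder` expects; only indices below
  -- `B * (m + m)` matter.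
  set h : ℕ → (Fin d → Bool) × (Fin d → Bool) :=
    fun i => if hi : i < n₁ then ω₀.1 ⟨i, hi⟩ else default with hh
  have hval : ∀ i : Fin (B * (m + m)), h i = ω₀.1 (Fin.castLE hN i) := fun i => by
    simp only [hh]
    rw [dif_pos (i.2.trans_le hN)]
    rfl
  have hsub : {ω : (Fin n₁ → (Fin d → Bool) × (Fin d → Bool)) × (Fin (n₂ - n₁) → Fin d → Bool) |
      viewBlocks hN ω.1 = viewBlocks hN ω₀.1} ⊆
        {z | ∀ i : Fin n₁, (i : ℕ) < B * (m + m) → z i = h i} ×ˢ Set.univ := by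
    intro ω hω
    have hb := blocks_injective hω
    refine ⟨fun i hi => ?_, trivial⟩
    exact (congrFun hb ⟨i, hi⟩).trans (hval ⟨i, hi⟩).symm
  refine (measure_mono hsub).trans_eq ?_
  rw [law_adaptiveMechanism_cylinder hk hτ o m hN qX qY h,
    ← ENNReal.ofReal_prod_of_nonneg fun i _ => (pairLaw hk _ qX qY).2.1 _, prod_blocks]
  congr 1
  have hfst : ∀ (b : Fin B) (l : Fin m), (viewBlocks hN ω₀.1 b).1 l = h (l + (m + m) * b) :=
    fun b l => by
      have := hval (finProdFinEquiv (b, Fin.castAdd m l))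
      rw [finProdFinEquiv_apply_val] at this
      exact this.symm
  refine Finset.prod_congr rfl fun b _ => ?_
  refine congrArg₂ (· * ·) (Finset.prod_congr rfl fun l _ => ?_) (Finset.prod_congr rfl fun l _ => ?_)
  · rw [hval]
    have : adaptiveFeature hτ o m (finProdFinEquiv (b, Fin.castAdd m l) : Fin (B * (m + m)))
        (fun l => h l) = coordFeature d := by
      have e : ∀ i : ℕ, i = l + (m + m) * b →
          adaptiveFeature hτ o m i (fun l => h l) = coordFeature d := by
        rintro _ rfl; exact adaptiveFeature_first hτ o l.2 _
      exact e _ (finProdFinEquiv_apply_val _)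
    rw [this]
    rfl
  · rw [hval]
    have : adaptiveFeature hτ o m (finProdFinEquiv (b, Fin.natAdd m l) : Fin (B * (m + m)))
        (fun l => h l) = clipFeature hτ o (blockSum (viewBlocks hN ω₀.1 b).1) := by
      have e : ∀ i : ℕ, i = m + l + (m + m) * b → adaptiveFeature hτ o m i (fun l => h l) =
          clipFeature hτ o (blockSum fun l : Fin m => h (l + (m + m) * b)) := by
        rintro _ rfl; exact adaptiveFeature_second hτ o l.2 h
      rw [funext (hfst b)]
      exact e _ (finProdFinEquiv_apply_val _)
    rw [this]
    rfl

end LDPTest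

end

noncomputable section

namespace LDPTest

variable {d : ℕ}

/-! ### Upper bounds -/

lemma one_le_log_one_div_mul {α β : ℝ} (hα : 0 < α) (hβ : 0 < β) (hαβ : α + β ≤ 1 / 2) :
    1 ≤ Real.log (1 / (α * β)) := by
  rw [Real.le_log_iff_exp_le (by positivity), le_div_iff₀ (by positivity)]
  have h1 : α * β ≤ 1 / 4 := by nlinarith
  have h2 := Real.exp_one_lt_d9
  nlinarith [mul_pos hα hβ]

/-- The choice `B = ⌈2L⌉` gives `2⁻ᴮ ≤ αβ` because `2 log 2 ≥ 1`. Rounding `n / (2B)` down loses at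
most a factor two, since `2B ≤ n`. -/
lemma exists_block_sizes {α β : ℝ} (hα : 0 < α) (hβ : 0 < β) (hαβ : α + β ≤ 1 / 2) {n : ℕ}
    (hn : 6 * Real.log (1 / (α * β)) ≤ n) :
    ∃ B m : ℕ, 0 < m ∧ B * (m + m) ≤ n ∧ (1 / 2 : ℝ) ^ B ≤ α ∧ (1 / 2 : ℝ) ^ B ≤ β ∧
      (n : ℝ) ≤ 12 * Real.log (1 / (α * β)) * m := by
  set L := Real.log (1 / (α * β)) with hL
  have hL1 : 1 ≤ L := one_le_log_one_div_mul hα hβ hαβ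
  set B := ⌈2 * L⌉₊ with hB
  have hB1 : 2 * L ≤ B := Nat.le_ceil _
  have hB2 : (B : ℝ) ≤ 3 * L := by
    have := Nat.ceil_lt_add_one (show 0 ≤ 2 * L by linarith)
    linarith
  have hB0 : 0 < B := by
    have : (0 : ℝ) < B := by linarith
    exact_mod_cast this
  have hpow : (1 / 2 : ℝ) ^ B ≤ α * β := by
    have h1 : α * β = Real.exp (-L) := by
      rw [hL, one_div, Real.log_inv, neg_neg, Real.exp_log (by positivity)]
    have h2 : (1 / 2 : ℝ) ^ B = Real.exp (-(B * Real.log 2)) := by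
      rw [Real.exp_neg, Real.exp_nat_mul, Real.exp_log (by norm_num), one_div, inv_pow]
    rw [h1, h2]
    refine Real.exp_le_exp.2 (neg_le_neg ?_)
    have := Real.log_two_gt_d9
    nlinarith
  have hnB : 2 * B ≤ n := by
    have : (2 * B : ℝ) ≤ n := by linarith
    exact_mod_cast this
  have hm : 0 < n / (2 * B) := Nat.div_pos hnB (by omega)
  refine ⟨B, n / (2 * B), hm, ?_, hpow.trans (by nlinarith), hpow.trans (by nlinarith), ?_⟩
  · calc B * (n / (2 * B) + n / (2 * B)) = 2 * B * (n / (2 * B)) := by ring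
      _ ≤ n := Nat.mul_div_le _ _
  · have h1 : n < 2 * B * (n / (2 * B)) + 2 * B := by
      have := Nat.lt_mul_div_succ n (show 0 < 2 * B by omega)
      linarith
    have h2 : n ≤ 4 * B * (n / (2 * B)) := by nlinarith
    have h3 : (n : ℝ) ≤ 4 * B * (n / (2 * B) : ℕ) := by exact_mod_cast h2
    refine h3.trans ?_
    have : (0 : ℝ) ≤ (n / (2 * B) : ℕ) := Nat.cast_nonneg _
    nlinarith

lemma le_l2_of_le_lpDist (hd : 0 < d) {p : ℝ} (hp : 1 ≤ p) (hp2 : p ≤ 2) {x : ℝ}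
    {qX qY : ProbVec d} (h : (d : ℝ) ^ (1 / p - 1 / 2) * x ≤ lpDist p qX qY) :
    x ≤ √(∑ j, (qX.1 j - qY.1 j) ^ 2) := by
  have hd0 : (0 : ℝ) < d := by exact_mod_cast hd
  exact le_of_mul_le_mul_left (h.trans (lpDist_le_two qX qY (by linarith) hp2))
    (Real.rpow_pos_of_pos hd0 _)

theorem riskNI_le {n₁ n₂ : ℕ} {p ε α β : ℝ} (hd : 2 ≤ d) (h12 : n₁ ≤ n₂) (hp : 1 ≤ p) (hp2 : p ≤ 2)
    (hε : 0 < ε) (hε1 : ε ≤ 1) (hα : 0 < α) (hβ : 0 < β) (hαβ : α + β ≤ 1 / 2)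
    (hn : 6 * Real.log (1 / (α * β)) ≤ n₁) :
    riskNI d n₁ n₂ ε p α (400 * ((d : ℝ) ^ (1 / p - 1 / 4) / √(n₁ * ε ^ 2) *
      Real.log (1 / (α * β)) ^ 2)) ≤ ENNReal.ofReal (α + β) := by
  obtain ⟨B, m, hm, hN, hBα, hBβ, hnm⟩ := exists_block_sizes hα hβ hαβ hn
  have hL1 := one_le_log_one_div_mul hα hβ hαβ
  set L := Real.log (1 / (α * β))
  have hd0 : (0 : ℝ) < d := by positivity
  have hm0 : (0 : ℝ) < m := by exact_mod_cast hm
  have hn0 : (0 : ℝ) < n₁ := by linarith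
  have hk : |ε / 4| ≤ 1 := by rw [abs_of_pos (by positivity)]; linarith
  rw [riskNI, ENNReal.ofReal_add hα.le hβ.le]
  refine add_le_add le_rfl ?_
  refine iInf_le_of_le (Fin d → Bool) <| iInf_le_of_le (Fin d → Bool) <|
    iInf_le_of_le inferInstance <| iInf_le_of_le inferInstance <|
    iInf_le_of_le (signMechanism d n₁ n₂ hk) <| iInf_le_of_le (isLDP_signMechanism hε hε1 hk) <|
    iInf_le_of_le (fun ω => majority (fun x => decide (8 * m * √d ≤ blockInner x))
      (pairBlocks hN h12 ω)) <| iInf_le_of_le ⟨Measurable.of_discrete, fun q => ?_⟩ ?_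
  · exact (measure_majority_true_le _ (pairBlocks hN h12) (twoBlockLaw hk q q m)
      (law_signMechanism_pairBlocks hk hN h12 q q) _
      (twoBlockLaw_null_error hk (by omega) hm q)).trans (ENNReal.ofReal_le_ofReal hBα)
  · refine iSup_le fun qX => iSup_le fun qY => iSup_le fun hρ => ?_
    refine (measure_majority_false_le _ (pairBlocks hN h12) (twoBlockLaw hk qX qY m)
      (law_signMechanism_pairBlocks hk hN h12 qX qY) _
      (twoBlockLaw_alternative_error hk (by omega) hm qX qY ?_)).trans (ENNReal.ofReal_le_ofReal hBβ)
    have hD : 0 ≤ ∑ j, (qX.1 j - qY.1 j) ^ 2 := Finset.sum_nonneg fun j _ => sq_nonneg _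
    have h1 : 400 * ((d : ℝ) ^ (1 / 4 : ℝ) / √(n₁ * ε ^ 2) * L ^ 2) ≤
        √(∑ j, (qX.1 j - qY.1 j) ^ 2) := by
      refine le_l2_of_le_lpDist (by omega) hp hp2 (le_trans (le_of_eq ?_) hρ)
      rw [show 1 / p - 1 / 4 = 1 / p - 1 / 2 + (1 / 4 : ℝ) by ring, Real.rpow_add hd0]
      ring
    have h2 := pow_le_pow_left₀ (by positivity) h1 2
    have h4 : ((d : ℝ) ^ (1 / 4 : ℝ)) ^ 2 = √d := by
      rw [← Real.rpow_natCast, ← Real.rpow_mul hd0.le, Real.sqrt_eq_rpow]; norm_num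
    rw [Real.sq_sqrt hD, mul_pow, mul_pow, div_pow, h4, Real.sq_sqrt (by positivity)] at h2
    -- The loss `m ≥ n₁ / (12L)` from blocking uses a single factor `L` of the available `L⁴`, and
    -- `400² / (16 * 12) > 512`.
    calc 512 * √d ≤ 160000 / 192 * √d := by gcongr; norm_num
      _ = m * ((ε / 4) ^ 2 * (400 ^ 2 * (√d / (12 * L * m * ε ^ 2) * L))) := by
          field_simp; norm_num
      _ ≤ m * ((ε / 4) ^ 2 * (400 ^ 2 * (√d / (n₁ * ε ^ 2) * (L ^ 2) ^ 2))) := by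
          gcongr
          nlinarith [mul_le_mul hL1 hL1 zero_le_one (by linarith : (0 : ℝ) ≤ L), sq_nonneg L]
      _ ≤ _ := by gcongr

lemma riskI_le_of_isLevel {n₁ n₂ : ℕ} {ε p α ρ : ℝ} {𝒵 𝒲 : Type} [MeasurableSpace 𝒵]
    [MeasurableSpace 𝒲] (Q : Interactive d n₁ n₂ 𝒵 𝒲) (hQ : Q.IsLDP ε)
    (φ : (Fin n₁ → 𝒵 × 𝒲) × (Fin (n₂ - n₁) → 𝒲) → Bool) (hφ : IsLevel Q.law α φ) :
    riskI d n₁ n₂ ε p α ρ ≤ ENNReal.ofReal α + typeTwoError Q.law p ρ φ :=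
  add_le_add le_rfl <| iInf_le_of_le 𝒵 <| iInf_le_of_le 𝒲 <| iInf_le_of_le _ <|
    iInf_le_of_le _ <| iInf_le_of_le Q <| iInf_le_of_le hQ <| iInf_le_of_le φ <| iInf_le _ hφ

/-- The test that rejects if the adaptive statistics of at least half of the blocks are large. -/
def adaptiveTest {n₁ n₂ B m : ℕ} (hN : B * (m + m) ≤ n₁) (o : Fin d)
    (ω : (Fin n₁ → (Fin d → Bool) × (Fin d → Bool)) × (Fin (n₂ - n₁) → Fin d → Bool)) : Bool :=
  majority (fun x : (Fin m → (Fin d → Bool) × (Fin d → Bool)) ×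
    (Fin m → (Fin d → Bool) × (Fin d → Bool)) => decide (6 * √m ≤ blockSum x.2 o))
    (viewBlocks hN ω.1)

lemma isLevel_adaptiveTest {k : ℝ} (hk : |k| ≤ 1) {τ : ℝ} (hτ : 0 < τ) (o : Fin d) {n₁ n₂ B m : ℕ}
    (hm : 0 < m) (hN : B * (m + m) ≤ n₁) {α : ℝ} (hα : (1 / 2) ^ B ≤ α) :
    IsLevel (adaptiveMechanism n₁ n₂ hk hτ o m).law α (adaptiveTest hN o) := by
  refine ⟨Measurable.of_discrete, fun q => ?_⟩
  have h := measure_majority_true_le ((adaptiveMechanism n₁ n₂ hk hτ o m).law q q)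
    (fun ω => viewBlocks hN ω.1) (adaptiveBlockLaw hk hτ o q q m)
    (law_adaptiveMechanism_viewBlocks hk hτ o hN q q) _ (adaptiveBlockLaw_null_error hk hτ o hm q)
  exact h.trans (ENNReal.ofReal_le_ofReal hα)

lemma adaptiveTest_typeTwo {k : ℝ} (hk : |k| ≤ 1) (hk0 : 0 ≤ k) (o : Fin d) {n₁ n₂ B m : ℕ}
    (hm : 0 < m) (hτ : 0 < 256 * √m) (hN : B * (m + m) ≤ n₁) {β : ℝ} (hβ : (1 / 2) ^ B ≤ β)
    (qX qY : ProbVec d) (h : 256 ≤ k * √m * √(∑ j, (qX.1 j - qY.1 j) ^ 2)) :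
    (adaptiveMechanism n₁ n₂ hk hτ o m).law qX qY {ω | adaptiveTest hN o ω = false} ≤
      ENNReal.ofReal β := by
  have h := measure_majority_false_le ((adaptiveMechanism n₁ n₂ hk hτ o m).law qX qY)
    (fun ω => viewBlocks hN ω.1) (adaptiveBlockLaw hk hτ o qX qY m)
    (law_adaptiveMechanism_viewBlocks hk hτ o hN qX qY) _
    (adaptiveBlockLaw_alternative_error hk hk0 o hm hτ qX qY h)
  exact h.trans (ENNReal.ofReal_le_ofReal hβ)

theorem riskI_le {n₁ n₂ : ℕ} {p ε α β : ℝ} (hd : 2 ≤ d) (hp : 1 ≤ p) (hp2 : p ≤ 2)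
    (hε : 0 < ε) (hε1 : ε ≤ 1) (hα : 0 < α) (hβ : 0 < β) (hαβ : α + β ≤ 1 / 2)
    (hn : 6 * Real.log (1 / (α * β)) ≤ n₁) :
    riskI d n₁ n₂ ε p α (4000 * ((d : ℝ) ^ (1 / p - 1 / 2) / √(n₁ * ε ^ 2) *
      (Real.log (1 / β) ^ 2 + √(Real.log (1 / (α * β)))))) ≤ ENNReal.ofReal (α + β) := by
  obtain ⟨B, m, hm, hN, hBα, hBβ, hnm⟩ := exists_block_sizes hα hβ hαβ hn
  have hL1 := one_le_log_one_div_mul hα hβ hαβ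
  set L := Real.log (1 / (α * β))
  have hm0 : (0 : ℝ) < m := by exact_mod_cast hm
  have hn0 : (0 : ℝ) < n₁ := by linarith
  have hk : |ε / 4| ≤ 1 := by rw [abs_of_pos (by positivity)]; linarith
  have hτ : 0 < 256 * √(m : ℝ) := by positivity
  have o : Fin d := ⟨0, by omega⟩
  refine (riskI_le_of_isLevel _ (isLDP_adaptiveMechanism hε hε1 hk hτ o m) (adaptiveTest hN o)
    (isLevel_adaptiveTest hk hτ o hm hN hBα)).trans ?_
  rw [ENNReal.ofReal_add hα.le hβ.le]
  refine add_le_add le_rfl ?_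
  refine iSup_le fun qX => iSup_le fun qY => iSup_le fun hρ =>
    adaptiveTest_typeTwo hk (by positivity) o hm hτ hN hBβ qX qY ?_
  have h1 : 4000 * (1 / √(n₁ * ε ^ 2) * (Real.log (1 / β) ^ 2 + √L)) ≤
      √(∑ j, (qX.1 j - qY.1 j) ^ 2) := by
    refine le_l2_of_le_lpDist (by omega) hp hp2 (le_trans (le_of_eq ?_) hρ)
    ring
  have h2 : √(n₁ * ε ^ 2) ≤ 7 / 2 * (√L * (√m * ε)) := by
    rw [Real.sqrt_le_left (by positivity)]
    rw [mul_pow, mul_pow, mul_pow, Real.sq_sqrt (by linarith), Real.sq_sqrt hm0.le]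
    have : (n₁ : ℝ) * ε ^ 2 ≤ 12 * L * m * ε ^ 2 := by gcongr
    have h0 : 0 ≤ L * m * ε ^ 2 := by positivity
    linarith
  have hsL : 0 < √L := Real.sqrt_pos.2 (by linarith)
  -- The summand `√L` alone suffices: blocking costs a factor at most `(7/2) √L` in the square root
  -- of the sample size.
  calc (256 : ℝ) ≤ 4000 / 14 := by norm_num
    _ = ε / 4 * √m * (4000 * (1 / (7 / 2 * (√L * (√m * ε))) * √L)) := by
        field_simp; norm_num
    _ ≤ ε / 4 * √m * (4000 * (1 / √(n₁ * ε ^ 2) * (Real.log (1 / β) ^ 2 + √L))) := by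
        gcongr
        linarith [sq_nonneg (Real.log (1 / β))]
    _ ≤ _ := by gcongr

end LDPTest

end

/-! ### The separation radii. -/

theorem theorem5 :
    (∃ C c K : ℝ, 0 < C ∧ 0 < c ∧ 0 < K ∧
      ∀ (d n₁ n₂ : ℕ) (p ε α β : ℝ), 2 ≤ d → n₁ ≤ n₂ → 1 ≤ p → p ≤ 2 → 0 < ε → ε ≤ 1 →
        0 < α → 0 < β → α + β ≤ 1 / 2 → C * Real.log (1 / (α * β)) ≤ n₁ →
        c * min ((d : ℝ) ^ (1 / p - 1 / 4) / Real.sqrt (n₁ * ε ^ 2))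
            (1 / ((d : ℝ) ^ (1 - 1 / p) * Real.sqrt (Real.log d)))
          ≤ LDPTest.radiusNI d n₁ n₂ ε p α β ∧
        LDPTest.radiusNI d n₁ n₂ ε p α β
          ≤ K * ((d : ℝ) ^ (1 / p - 1 / 4) / Real.sqrt (n₁ * ε ^ 2)
              * Real.log (1 / (α * β)) ^ 2)) ∧
    (∃ C c K : ℝ, 0 < C ∧ 0 < c ∧ 0 < K ∧
      ∀ (d n₁ n₂ : ℕ) (p ε α β : ℝ), 2 ≤ d → n₁ ≤ n₂ → 1 ≤ p → p ≤ 2 → 0 < ε → ε ≤ 1 →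
        0 < α → 0 < β → α + β ≤ 1 / 2 → C * Real.log (1 / (α * β)) ≤ n₁ * ε ^ 2 →
        c * min ((d : ℝ) ^ (1 / p - 1 / 2) / Real.sqrt (n₁ * ε ^ 2))
            (if p = 1 ∨ p = 2 then 1 else (d : ℝ) ^ (1 / p - 1))
          ≤ LDPTest.radiusI d n₁ n₂ ε p α β ∧
        LDPTest.radiusI d n₁ n₂ ε p α β
          ≤ K * ((d : ℝ) ^ (1 / p - 1 / 2) / Real.sqrt (n₁ * ε ^ 2)
              * (Real.log (1 / β) ^ 2 + Real.sqrt (Real.log (1 / (α * β)))))) := by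
  refine ⟨⟨6, 1 / 10368, 400, by norm_num, by norm_num, by norm_num, ?_⟩,
    ⟨6, 1 / 50, 4000, by norm_num, by norm_num, by norm_num, ?_⟩⟩
  · intro d n₁ n₂ p ε α β hd h12 hp hp2 hε hε1 hα hβ hαβ hn
    have hL := LDPTest.one_le_log_one_div_mul hα hβ hαβ
    have hn0 : (0 : ℝ) < n₁ := by linarith
    have hd0 : (0 : ℝ) < d := by positivity
    have hrisk := LDPTest.riskNI_le hd h12 hp hp2 hε hε1 hα hβ hαβ hn
    have hpos : 0 < 400 * ((d : ℝ) ^ (1 / p - 1 / 4) / Real.sqrt (n₁ * ε ^ 2)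
        * Real.log (1 / (α * β)) ^ 2) := by positivity
    -- The risk bound serves twice: as a member of the set bounding the infimum from above, and as
    -- the nonemptiness that the lower bound needs.
    exact ⟨LDPTest.nonInteractive_lower_bound hd hp hε hε1 hα.le hβ.le hαβ (by exact_mod_cast hn0)
      ⟨_, hpos, hrisk⟩, csInf_le ⟨0, fun ρ hρ => hρ.1.le⟩ ⟨hpos, hrisk⟩⟩
  · intro d n₁ n₂ p ε α β hd _ hp hp2 hε hε1 hα hβ hαβ hn
    have hL := LDPTest.one_le_log_one_div_mul hα hβ hαβ
    -- Since `ε ≤ 1`, the stronger sample size condition implies the one used by the test.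
    have hn' : 6 * Real.log (1 / (α * β)) ≤ n₁ :=
      hn.trans (mul_le_of_le_one_right (Nat.cast_nonneg _) (pow_le_one₀ hε.le hε1))
    have hn0 : (0 : ℝ) < n₁ := by linarith
    have hd0 : (0 : ℝ) < d := by positivity
    have hrisk := LDPTest.riskI_le (n₂ := n₂) hd hp hp2 hε hε1 hα hβ hαβ hn'
    have hpos : 0 < 4000 * ((d : ℝ) ^ (1 / p - 1 / 2) / Real.sqrt (n₁ * ε ^ 2)
        * (Real.log (1 / β) ^ 2 + Real.sqrt (Real.log (1 / (α * β))))) := by positivity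
    exact ⟨LDPTest.interactive_lower_bound hd hp hp2 hε hε1 hα.le hβ.le hαβ (by exact_mod_cast hn0)
      ⟨_, hpos, hrisk⟩, csInf_le ⟨0, fun ρ hρ => hρ.1.le⟩ ⟨hpos, hrisk⟩⟩
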